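/- **Theorem 2.** Let $\mathbb T=\mathbb R/\mathbb Z$, let $k\in\mathbb Z$ (the topological charge) and let $l\ge 0$ be an integer. Let $H^l=H^l(\mathbb T,\mathbb R)$, and let $H^l_0\subset H^l$ be the subspace of functions of mean zero. For $v\in H^l$ with $\int_{\mathbb T}v\,dx=k\pi$, i.e. $v=\mathring v+k\pi$ with $\mathring v\in H_0^l$, put $\partial_x^{-1}v=\partial_x^{-1}\mathring v+k\pi x$, where $\partial_x^{-1}\mathring v\in H^{l+1}_0$ is the mean-zero antiderivative. Let $$W^l_k=\Big\{v\in H^l:\ \int_{\mathbb T}v\,dx=k\pi,\ \int_0^1 e^{2i\partial_x^{-1}v}\,dx\neq0\Big\},\qquad c_{sg}(v)=-\arg\int_0^1 e^{2i\partial_x^{-1}v}\,dx\in\mathbb R/2\pi\mathbb Z .$$ For $m\ge1$ and $j\in\mathbb Z$ let $\mathcal L^m_j=2\pi jx+H^m_0+\mathbb R/2\pi\mathbb Z$, a space of $\mathbb R/2\pi\mathbb Z$-valued functions, and $$P^m_{\pm,j}=\Big\{u\in\mathcal L^m_j:\ \int_0^1\sin u\,dx=0,\ \pm\int_0^1\cos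 u\,dx>0\Big\}.$$ For a function $f$ put $\breve f(x)=f(-x)$. (i) $W^l_k$ is open in $k\pi+H^l_0$, and the maps $$\Psi^+_{sg}:W^l_k\to P^{l+1}_{+,k},\quad v\mapsto 2\partial_x^{-1}v+c_{sg}(v),\qquad \Psi^-_{sg}:W^l_k\to P^{l+1}_{-,-k},\quad v\mapsto (2\partial_x^{-1}v)\breve{\ }+c_{sg}(v)+\pi$$ are real-analytic parametrizations: they are bijective and real analytic, and their inverses are, locally on $P^{l+1}_{+,k}$ resp. $P^{l+1}_{-,-k}$, restrictions of real-analytic maps defined on the ambient space $\mathcal L^{l+1}_{k}$ resp. $\mathcal L^{l+1}_{-k}$. For $v\in W^l_k$ one has $\tfrac12\sin(2\partial_x^{-1}v+c_{sg}(v))\in H_0^{l+1}$. Both maps transform the sine-Gordon equation $u_{xt}=\sin u$ into $$v_t=\tfrac12\sin\big(2\partial_x^{-1}v+c_{sg}(v)\big)\qquad(*)$$ on $W^l_k$: for every interval $I\subset\mathbb R$ with nonempty interior and every curve $v:I\to W^l_k$, the curve $\Psi^{\pm}_{sg}\circ v$ is a $C^1$ solution of the sine-Gordon equation if and only if $v$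 is a $C^1$ solution of $(*)$. (ii) Equation $(*)$ is Hamiltonian with respect to the Gardner bracket $\{F,G\}=\int_0^1\partial F\,\partial_x\partial G\,dx$, where $\partial F$ is the $L^2$-gradient, with Hamiltonian $$H_{sg}:W^l_k\to\mathbb R,\qquad H_{sg}(v)=\tfrac14\int_0^1\cos\big(2\partial_x^{-1}v+c_{sg}(v)\big)dx:$$ $H_{sg}$ is $C^1$, it has an $L^2$-gradient in $H^1$, and $\partial_x\partial H_{sg}(v)=\tfrac12\sin(2\partial_x^{-1}v+c_{sg}(v))$, so that the derivative of any functional $F$ with $L^2$-gradient in $H^1$ in the direction of this vector field is $\{F,H_{sg}\}$. (iii) $H_{sg}$ is in the Poisson algebra of the focusing mKdV equation $v_t+v_{xxx}+6v^2v_x=0$: along every $C^1$ curve $v:I\to W^l_k$, $I$ an interval with nonempty interior, which satisfies $v_t=\partial_x\partial H_{sg}(v)$, the periodic and the anti-periodic spectrum (boundary conditions $f(1)=\pm f(0)$, $f'(1)=\pm f'(0)$) of the operator $L_M=-\partial_x^2-2V\partial_x$ with $V=iv$ in $L^2((0,1),\mathbb C)$ are constant in time. They are constant with multiplicities: for every $\lambda\in\mathbb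 C$ the discriminant $\Delta_M(iv,\lambda)$, i.e. the trace of the Floquet matrix of $L_M$ at $\lambda$, is constant in time. -/

import Mathlib

open MeasureTheory Filter Topology Set
open scoped ContDiff

namespace SineGordon

/-! ### Sobolev spaces on the circle `𝕋 = ℝ/ℤ` -/

/-- Lebesgue measure on the fundamental domain `(0,1]` of the circle `𝕋 = ℝ/ℤ`. -/
noncomputable abbrev μ : Measure ℝ := volume.restrict (Ioc (0 : ℝ) 1)

/-- Real-valued `L²(𝕋)`. -/
abbrev L2 : Type := Lp ℝ 2 μ

/-- Complex-valued `L²(𝕋)`. -/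
abbrev L2C : Type := Lp ℂ 2 μ

/-- `g` is the weak derivative of `f` on the circle: test functions are the smooth
`1`-periodic functions. -/
def IsWeakDeriv (f g : L2) : Prop :=
  ∀ φ : ℝ → ℝ, ContDiff ℝ ∞ φ → Function.Periodic φ 1 →
    ∫ x, f x * deriv φ x ∂μ = - ∫ x, g x * φ x ∂μ

theorem integrable_mul (f : L2) {φ : ℝ → ℝ} (hφ : Continuous φ) :
    Integrable (fun x => f x * φ x) μ := by
  have hf : Integrable f μ := (Lp.memLp f).integrable (by norm_num)
  obtain ⟨C, hC⟩ := (isCompact_Icc (a := (0 : ℝ)) (b := 1)).exists_bound_of_continuousOn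
    hφ.continuousOn
  refine hf.mul_bdd (c := C) hφ.aestronglyMeasurable ?_
  refine (ae_restrict_iff' measurableSet_Ioc).2 (Eventually.of_forall fun x hx => ?_)
  exact hC x ⟨hx.1.le, hx.2⟩

theorem integrable_L2 (f : L2) : Integrable f μ := (Lp.memLp f).integrable (by norm_num)

theorem integral_add_mul (f g : L2) {φ : ℝ → ℝ} (hφ : Continuous φ) :
    ∫ x, (f + g : L2) x * φ x ∂μ = ∫ x, f x * φ x ∂μ + ∫ x, g x * φ x ∂μ := by
  rw [← integral_add (integrable_mul f hφ) (integrable_mul g hφ)]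
  refine integral_congr_ae ?_
  filter_upwards [Lp.coeFn_add f g] with x hx
  rw [hx]; simp [add_mul]

theorem integral_smul_mul (a : ℝ) (f : L2) (φ : ℝ → ℝ) :
    ∫ x, (a • f : L2) x * φ x ∂μ = a * ∫ x, f x * φ x ∂μ := by
  rw [← integral_const_mul]
  refine integral_congr_ae ?_
  filter_upwards [Lp.coeFn_smul a f] with x hx
  rw [hx]; simp [mul_assoc]

theorem IsWeakDeriv.add {f g f' g' : L2} (h : IsWeakDeriv f g) (h' : IsWeakDeriv f' g') :
    IsWeakDeriv (f + f') (g + g') := by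
  intro φ hφ hp
  rw [integral_add_mul _ _ (hφ.continuous_deriv (by simp)), integral_add_mul _ _ hφ.continuous,
    h φ hφ hp, h' φ hφ hp]
  ring

theorem IsWeakDeriv.smul {f g : L2} (a : ℝ) (h : IsWeakDeriv f g) :
    IsWeakDeriv (a • f) (a • g) := by
  intro φ hφ hp
  rw [integral_smul_mul, integral_smul_mul, h φ hφ hp]
  ring

/-- The Sobolev space `H^m(𝕋,ℝ)`: a function in `L²` together with its weak derivatives up to
order `m`, all in `L²` (entry `j` is the `j`-th derivative), with the norm
`‖f‖² = ∑_{j ≤ m} ‖∂ₓʲ f‖²_{L²}`. -/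
noncomputable def Sob (m : ℕ) : Submodule ℝ (PiLp 2 fun _ : Fin (m + 1) => L2) where
  carrier := {F | ∀ j : Fin m, IsWeakDeriv (F j.castSucc) (F j.succ)}
  add_mem' hF hG j := (hF j).add (hG j)
  zero_mem' j := by simpa using IsWeakDeriv.smul (f := 0) (g := 0) 0 (fun φ _ _ => by
    have h := integral_smul_mul 0 0 (deriv φ)
    have h' := integral_smul_mul 0 0 φ
    simp only [smul_zero, zero_mul] at h h'
    rw [h, h']; simp)
  smul_mem' a _ hF j := (hF j).smul a

/-- `H^m(𝕋,ℝ)` as a type. -/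
abbrev H (m : ℕ) : Type := Sob m

/-- The function underlying an element of `H^m`. -/
noncomputable def fn {m : ℕ} (f : H m) : L2 := f.1 0

/-- The mean value `∫_𝕋 f dx`. -/
noncomputable def mean {m : ℕ} (f : H m) : ℝ := ∫ x, fn f x ∂μ

/-- `H_0^m`, the subspace of functions of mean zero. -/
noncomputable def Sob0 (m : ℕ) : Submodule ℝ (H m) where
  carrier := {f | mean f = 0}
  add_mem' {f g} hf hg := by
    have h := integral_add_mul (fn f) (fn g) (φ := fun _ => 1) continuous_const
    simp only [mul_one] at h
    simp only [mem_ofPred_eq, mean] at hf hg ⊢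
    rw [hf, hg, add_zero] at h
    exact h
  zero_mem' := by
    have h := integral_smul_mul 0 0 (fun _ => 1)
    simp only [smul_zero, zero_mul, mul_one] at h
    exact h
  smul_mem' a f hf := by
    have h := integral_smul_mul a (fn f) (fun _ => 1)
    simp only [mul_one] at h
    simp only [mem_ofPred_eq, mean] at hf ⊢
    rw [hf, mul_zero] at h
    exact h

/-- `H_0^m` as a type. -/
abbrev H0 (m : ℕ) : Type := Sob0 m

/-- The derivative `∂ₓ : H^{m+1} → H^m`. -/
noncomputable def dx {m : ℕ} (f : H (m + 1)) : H m :=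
  ⟨WithLp.toLp 2 fun j : Fin (m + 1) => f.1 j.succ, fun j => f.2 j.succ⟩

/-! ### The mean-zero antiderivative -/

theorem intervalIntegrable_L2 (f : L2) : IntervalIntegrable f volume 0 1 :=
  (intervalIntegrable_iff_integrableOn_Ioc_of_le zero_le_one).2 (integrable_L2 f)

/-- The primitive `x ↦ ∫₀ˣ (v - [v]) dy`, where `[v]` is the mean of `v`. -/
noncomputable def prim0 (v : L2) (x : ℝ) : ℝ := ∫ y in (0 : ℝ)..x, (v y - ∫ z, v z ∂μ)

theorem prim0_ii (v : L2) : IntervalIntegrable (fun y => v y - ∫ z, v z ∂μ) volume 0 1 :=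
  (intervalIntegrable_L2 v).sub intervalIntegrable_const

theorem prim0_ac (v : L2) : AbsolutelyContinuousOnInterval (prim0 v) 0 1 :=
  (prim0_ii v).absolutelyContinuousOnInterval_intervalIntegral (by simp)

theorem prim0_continuousOn (v : L2) : ContinuousOn (prim0 v) (Icc 0 1) := by
  simpa using (prim0_ac v).continuousOn

theorem prim0_memLp (v : L2) :
    MemLp (fun x => prim0 v x - ∫ y, prim0 v y ∂μ) 2 μ := by
  have hc := (prim0_continuousOn v).sub
    (continuousOn_const (c := ∫ y, prim0 v y ∂μ))
  obtain ⟨C, hC⟩ := isCompact_Icc.exists_bound_of_continuousOn hc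
  refine MemLp.of_bound ((hc.mono Ioc_subset_Icc_self).aestronglyMeasurable measurableSet_Ioc) C ?_
  exact (ae_restrict_iff' measurableSet_Ioc).2
    (Eventually.of_forall fun x hx => hC x ⟨hx.1.le, hx.2⟩)

/-- The primitive of `v - [v]` of mean zero, as an element of `L²`. -/
noncomputable def antiL2 (v : L2) : L2 := (prim0_memLp v).toLp _

theorem antiL2_isWeakDeriv (v g : L2) (hg : g =ᵐ[μ] fun x => v x - ∫ z, v z ∂μ) :
    IsWeakDeriv (antiL2 v) g := by
  intro φ hφ hp
  have hφd : Differentiable ℝ φ := hφ.differentiable (by simp)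
  have hφ' : Continuous (deriv φ) := hφ.continuous_deriv (by simp)
  have hac : AbsolutelyContinuousOnInterval φ 0 1 :=
    (hφ.of_le (m := 1) (by simp)).contDiffOn.absolutelyContinuousOnInterval
  have h1 : φ 1 = φ 0 := by simpa using hp 0
  have hz : prim0 v 0 = 0 := by simp [prim0]
  have hone : prim0 v 1 = 0 := by
    unfold prim0
    rw [intervalIntegral.integral_sub (intervalIntegrable_L2 v) intervalIntegrable_const,
      intervalIntegral.integral_of_le zero_le_one]
    simp
  have hib := (prim0_ac v).integral_mul_deriv_eq_deriv_mul hac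
  rw [hz, hone, zero_mul, zero_mul, sub_zero, zero_sub] at hib
  have hd : ∀ᵐ x, x ∈ uIoc (0 : ℝ) 1 → deriv (prim0 v) x = v x - ∫ z, v z ∂μ := by
    filter_upwards [(prim0_ii v).ae_hasDerivAt_integral] with x hx hx'
    exact (hx (uIoc_subset_uIcc hx') 0 (by simp)).deriv
  have hprimInt : Integrable (prim0 v) μ :=
    ((prim0_continuousOn v).integrableOn_compact isCompact_Icc).mono_set Ioc_subset_Icc_self
  have e1 : ∫ x, antiL2 v x * deriv φ x ∂μ = ∫ x in (0 : ℝ)..1, prim0 v x * deriv φ x := by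
    have hint1 : IntervalIntegrable (fun x => prim0 v x * deriv φ x) volume 0 1 := by
      refine ContinuousOn.intervalIntegrable ?_
      rw [uIcc_of_le zero_le_one]
      exact (prim0_continuousOn v).mul hφ'.continuousOn
    have : ∫ x in (0 : ℝ)..1, deriv φ x = 0 := by
      rw [intervalIntegral.integral_deriv_eq_sub (fun x _ => hφd x) (hφ'.intervalIntegrable _ _),
        h1, sub_self]
    calc ∫ x, antiL2 v x * deriv φ x ∂μ
        = ∫ x, (prim0 v x * deriv φ x - (∫ y, prim0 v y ∂μ) * deriv φ x) ∂μ := by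
          refine integral_congr_ae ?_
          filter_upwards [(prim0_memLp v).coeFn_toLp] with x hx
          change ((prim0_memLp v).toLp _ : L2) x * _ = _
          rw [hx]; ring
      _ = ∫ x in (0 : ℝ)..1, (prim0 v x * deriv φ x - (∫ y, prim0 v y ∂μ) * deriv φ x) :=
          (intervalIntegral.integral_of_le zero_le_one).symm
      _ = _ := by
          rw [intervalIntegral.integral_sub hint1 ((hφ'.intervalIntegrable _ _).const_mul _),
            intervalIntegral.integral_const_mul, this, mul_zero, sub_zero]
  have e2 : ∫ x, g x * φ x ∂μ = ∫ x in (0 : ℝ)..1, deriv (prim0 v) x * φ x := by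
    rw [intervalIntegral.integral_of_le zero_le_one]
    refine integral_congr_ae ?_
    have hd' : ∀ᵐ x ∂μ, deriv (prim0 v) x = v x - ∫ z, v z ∂μ := by
      refine (ae_restrict_iff' measurableSet_Ioc).2 ?_
      rwa [uIoc_of_le zero_le_one] at hd
    filter_upwards [hg, hd'] with x hx hx'
    rw [hx, hx']
  rw [e1, e2, hib]

theorem const_memLp (a : ℝ) : MemLp (fun _ : ℝ => a) 2 μ := memLp_const a

/-- The constant function `a` in `H^m`. -/
noncomputable def const {m : ℕ} (a : ℝ) : H m :=
  ⟨WithLp.toLp 2 fun j : Fin (m + 1) => if j = 0 then (const_memLp a).toLp _ else 0, by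
    intro j φ hφ hp
    have h1 : φ 1 = φ 0 := by simpa using hp 0
    have hR : ∫ x, (0 : L2) x * φ x ∂μ = 0 := by
      have h := integral_smul_mul 0 0 φ
      simpa only [smul_zero, zero_mul] using h
    have hL : ∫ x, (0 : L2) x * deriv φ x ∂μ = 0 := by
      have h := integral_smul_mul 0 0 (deriv φ)
      simpa only [smul_zero, zero_mul] using h
    have hs : ¬ (j.succ : Fin (m + 1)) = 0 := Fin.succ_ne_zero j
    simp only [hs, if_false]
    rw [hR, neg_zero]
    split_ifs with h
    · have : ∫ x, ((const_memLp a).toLp _ : L2) x * deriv φ x ∂μ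
          = ∫ x in (0 : ℝ)..1, a * deriv φ x := by
        rw [intervalIntegral.integral_of_le zero_le_one]
        refine integral_congr_ae ?_
        filter_upwards [(const_memLp a).coeFn_toLp] with x hx
        rw [hx]
      rw [this, intervalIntegral.integral_const_mul, intervalIntegral.integral_deriv_eq_sub
        (fun x _ => hφ.differentiable (by simp) x)
        ((hφ.continuous_deriv (by simp)).intervalIntegrable _ _), h1, sub_self, mul_zero]
    · exact hL⟩

theorem fn_sub_const {m : ℕ} (v : H m) (a : ℝ) :
    fn (v - const a) =ᵐ[μ] fun x => fn v x - a := by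
  have h : fn (v - const a) = fn v - (const_memLp a).toLp _ := rfl
  rw [h]
  filter_upwards [Lp.coeFn_sub (fn v) ((const_memLp a).toLp _), (const_memLp a).coeFn_toLp]
    with x h1 h2
  rw [h1, Pi.sub_apply, h2]

/-- The mean-zero antiderivative `∂ₓ⁻¹ v̊ ∈ H_0^{m+1}` of the mean-zero part `v̊ = v - [v]` of
`v ∈ H^m`. -/
noncomputable def anti {m : ℕ} (v : H m) : H0 (m + 1) :=
  ⟨⟨WithLp.toLp 2 (Fin.cons (antiL2 (fn v)) fun j : Fin (m + 1) => (v - const (mean v)).1 j), by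
      intro j
      refine Fin.cases ?_ (fun i => ?_) j
      · exact antiL2_isWeakDeriv (fn v) _ (fn_sub_const v (mean v))
      · exact (v - const (mean v)).2 i⟩, by
    change ∫ x, antiL2 (fn v) x ∂μ = 0
    have hprimInt : Integrable (prim0 (fn v)) μ :=
      ((prim0_continuousOn (fn v)).integrableOn_compact isCompact_Icc).mono_set
        Ioc_subset_Icc_self
    have he : antiL2 (fn v) =ᵐ[μ] fun x => prim0 (fn v) x - ∫ y, prim0 (fn v) y ∂μ :=
      (prim0_memLp (fn v)).coeFn_toLp
    rw [integral_congr_ae he, integral_sub hprimInt (integrable_const _)]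
    simp⟩

/-- The reflection `x ↦ 1 - x ≡ -x (mod 1)` preserves Lebesgue measure on the circle. -/
theorem mp_refl : MeasurePreserving (fun x : ℝ => 1 - x) μ μ := by
  have h := (Measure.measurePreserving_sub_left (volume : Measure ℝ) 1).restrict_preimage
    (measurableSet_Ioc (a := (0 : ℝ)) (b := 1))
  have hs : (fun x : ℝ => 1 - x) ⁻¹' Ioc 0 1 = Ico 0 1 := by
    ext x; simp only [mem_preimage, mem_Ioc, mem_Ico]; constructor <;> rintro ⟨a, b⟩ <;>
      constructor <;> linarith
  rw [hs, restrict_Ico_eq_restrict_Ioc] at h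
  exact h

/-- Reflection on `L²(𝕋)`. -/
noncomputable def reflL2 (f : L2) : L2 := Lp.compMeasurePreserving (fun x : ℝ => 1 - x) mp_refl f

theorem integral_reflL2_mul (f : L2) (ψ : ℝ → ℝ) :
    ∫ x, reflL2 f x * ψ x ∂μ = ∫ x, f x * ψ (1 - x) ∂μ := by
  have he : MeasurableEmbedding (fun x : ℝ => 1 - x) :=
    (MeasurableEquiv.subLeft (1 : ℝ)).measurableEmbedding
  rw [← mp_refl.integral_comp he (fun x => f x * ψ (1 - x))]
  refine integral_congr_ae ?_
  filter_upwards [Lp.coeFn_compMeasurePreserving f mp_refl] with x hx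
  simp only [sub_sub_cancel]
  change (Lp.compMeasurePreserving (fun x : ℝ => 1 - x) mp_refl f) x * _ = _
  rw [hx]; rfl

theorem IsWeakDeriv.refl {f g : L2} (h : IsWeakDeriv f g) :
    IsWeakDeriv (reflL2 f) (-reflL2 g) := by
  intro φ hφ hp
  have hψ : ContDiff ℝ ∞ (fun x => φ (1 - x)) := hφ.comp (contDiff_const.sub contDiff_id)
  have hper : Function.Periodic (fun x => φ (1 - x)) 1 := by
    intro x
    have := hp (1 - (x + 1))
    simp only at this ⊢
    rw [← this]; congr 1; ring
  have hd : ∀ x, deriv (fun x => φ (1 - x)) x = - deriv φ (1 - x) := fun x => by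
    rw [deriv_comp_const_sub]
  have key := h _ hψ hper
  simp only [hd, mul_neg, integral_neg, neg_inj] at key
  have hn := integral_smul_mul (-1) (reflL2 g) φ
  rw [neg_one_smul] at hn
  rw [hn, integral_reflL2_mul, integral_reflL2_mul, key]
  ring

/-- The reflection `f ↦ f̆`, `f̆(x) = f(-x)`, on `H_0^m`; its `j`-th derivative is
`(-1)ʲ (∂ₓʲ f)˘`. -/
noncomputable def refl {m : ℕ} (f : H0 m) : H0 m :=
  ⟨⟨WithLp.toLp 2 fun j : Fin (m + 1) => (-1 : ℝ) ^ (j : ℕ) • reflL2 (f.1.1 j), by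
      intro j
      have h := (f.1.2 j).refl.smul ((-1 : ℝ) ^ (j : ℕ))
      have e : (-1 : ℝ) ^ ((j.succ : Fin (m + 1)) : ℕ) • reflL2 (f.1.1 j.succ)
          = (-1 : ℝ) ^ (j : ℕ) • -reflL2 (f.1.1 j.succ) := by
        rw [Fin.val_succ, pow_succ, mul_smul, neg_one_smul]
      change IsWeakDeriv ((-1 : ℝ) ^ (j : ℕ) • reflL2 (f.1.1 j.castSucc)) _
      simp only [e]
      exact h⟩, by
    change ∫ x, ((-1 : ℝ) ^ ((0 : Fin (m + 1)) : ℕ) • reflL2 (f.1.1 0) : L2) x ∂μ = 0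
    have h := integral_reflL2_mul (f.1.1 0) (fun _ => 1)
    simp only [mul_one] at h
    simp only [Fin.val_zero, pow_zero, one_smul]
    rw [h]
    exact f.2⟩

/-! ### Phase spaces of sine-Gordon -/

/-- The affine space `2πkx + H_0^m + ℝ/2πℤ` of `ℝ/2πℤ`-valued functions of topological charge
`k`: the pair `(ů, c)` stands for `u(x) = 2πkx + ů(x) + c`. The charge enters through `eval`. -/
abbrev Phase (m : ℕ) : Type := H0 m × Real.Angle

/-- The function `u(x) = 2πkx + ů(x) + c ∈ ℝ/2πℤ`, `x ∈ (0,1]`. -/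
noncomputable def eval (k : ℤ) {m : ℕ} (u : Phase m) (x : ℝ) : Real.Angle :=
  ((2 * Real.pi * k * x + fn u.1.1 x : ℝ) : Real.Angle) + u.2

/-- The branch `P₊^m` for topological charge `k`. -/
def Pplus (k : ℤ) (m : ℕ) : Set (Phase m) :=
  {u | ∫ x, (eval k u x).sin ∂μ = 0 ∧ 0 < ∫ x, (eval k u x).cos ∂μ}

/-- The branch `P₋^m` for topological charge `k`. -/
def Pminus (k : ℤ) (m : ℕ) : Set (Phase m) :=
  {u | ∫ x, (eval k u x).sin ∂μ = 0 ∧ ∫ x, (eval k u x).cos ∂μ < 0}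

/-- `(∂ₓ⁻¹ v)(x) = (∂ₓ⁻¹ v̊)(x) + [v] x` for `v = v̊ + [v]`. -/
noncomputable def Dinv {l : ℕ} (v : H l) (x : ℝ) : ℝ := fn (anti v).1 x + mean v * x

/-- `∫_𝕋 exp(2i ∂ₓ⁻¹ v) dx`. -/
noncomputable def K {l : ℕ} (v : H l) : ℂ :=
  ∫ x, Complex.exp (2 * Complex.I * (Dinv v x : ℂ)) ∂μ

/-- The space `W^l`, for topological charge `k`. -/
def W (k : ℤ) (l : ℕ) : Set (H l) := {v | K v ≠ 0 ∧ mean v = k * Real.pi}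

/-- `c_sg(v) = -arg ∫ exp(2i ∂ₓ⁻¹ v) dx ∈ ℝ/2πℤ`. -/
noncomputable def csg {l : ℕ} (v : H l) : Real.Angle := -((K v).arg : Real.Angle)

/-- `Ψ⁺(v) = 2 ∂ₓ⁻¹ v + c_sg(v)`, a function of charge `k` if `[v] = kπ`. -/
noncomputable def PsiPlus {l : ℕ} (v : H l) : Phase (l + 1) :=
  ((2 : ℝ) • anti v, csg v)

/-- `Ψ⁻(v) = (2 ∂ₓ⁻¹ v)˘ + c_sg(v) + π`, a function of charge `-k` if `[v] = kπ`, since the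
reflection turns `2πkx` into `-2πkx`. -/
noncomputable def PsiMinus {l : ℕ} (v : H l) : Phase (l + 1) :=
  (refl ((2 : ℝ) • anti v), csg v + (Real.pi : Real.Angle))

/-- The angle-valued function `2 ∂ₓ⁻¹ v + c_sg(v)`. -/
noncomputable def wave {l : ℕ} (v : H l) (x : ℝ) : Real.Angle :=
  ((2 * Dinv v x : ℝ) : Real.Angle) + csg v

/-- The vector field `½ sin(2 ∂ₓ⁻¹ v + c_sg(v))`. -/
noncomputable def field {l : ℕ} (v : H l) (x : ℝ) : ℝ := 1 / 2 * (wave v x).sin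

/-- The Hamiltonian `H_sg(v) = ¼ ∫ cos(2 ∂ₓ⁻¹ v + c_sg(v)) dx`. -/
noncomputable def Hsg {l : ℕ} (v : H l) : ℝ := 1 / 4 * ∫ x, (wave v x).cos ∂μ

/-! ### Real-analytic parametrizations

Tangent vectors of the affine space `kπ + H_0^l` are elements of `H_0^l`; a map on (a subset of)
it is studied near `v` through `w ↦ v + w`, `w ∈ H_0^l`. The charts of `H_0^m × ℝ/2πℤ` are the
local inverses of `H_0^m × ℝ → H_0^m × ℝ/2πℤ`. -/

/-- `Ψ : kπ + H_0^l → H_0^m × ℝ/2πℤ` is real analytic at `v`. -/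
def AnalyticIntoPhase {l m : ℕ} (Ψ : H l → Phase m) (v : H l) : Prop :=
  AnalyticAt ℝ (fun w : H0 l => (Ψ (v + w)).1) 0 ∧
    ∃ c : H0 l → ℝ, AnalyticAt ℝ c 0 ∧
      ∀ᶠ w : H0 l in 𝓝 0, (Ψ (v + w)).2 = (c w : Real.Angle)

/-- `R : H_0^m × ℝ/2πℤ → H^l` is real analytic at `u`. -/
def AnalyticFromPhase {l m : ℕ} (R : Phase m → H l) (u : Phase m) : Prop :=
  ∀ θ : ℝ, (θ : Real.Angle) = u.2 →
    AnalyticAt ℝ (fun p : H0 m × ℝ => R (p.1, (p.2 : Real.Angle))) (u.1, θ)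

/-- `Ψ` is a real-analytic parametrization of `P` by the open subset `W` of an affine space
`kπ + H_0^l`: a bijection, real analytic, whose inverse is locally the restriction to `P` of a
real-analytic map (hence `P` is a real-analytic submanifold and `Ψ : W → P` a real-analytic
diffeomorphism). -/
structure IsAnalyticParam {l m : ℕ} (W : Set (H l)) (P : Set (Phase m)) (Ψ : H l → Phase m) :
    Prop where
  isOpen_dom : ∀ v ∈ W, ∀ᶠ w : H0 l in 𝓝 0, v + (w : H l) ∈ W
  bijOn : BijOn Ψ W P
  analytic : ∀ v ∈ W, AnalyticIntoPhase Ψ v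
  analytic_inv : ∀ u ∈ P, ∃ R : Phase m → H l, AnalyticFromPhase R u ∧
    ∀ᶠ u' in 𝓝[P] u, R u' ∈ W ∧ Ψ (R u') = u'

/-! ### Solutions -/

/-- `v : I → W^l` is a `C¹` solution of `v_t = ½ sin(2 ∂ₓ⁻¹ v + c_sg(v))`. -/
def IsSolV (k : ℤ) {l : ℕ} (I : Set ℝ) (v : ℝ → H l) : Prop :=
  ContDiffOn ℝ 1 v I ∧ ∀ t ∈ I, v t ∈ W k l ∧ fn (derivWithin v I t) =ᵐ[μ] field (v t)

/-- `u` is a `C¹` curve on `I` in `H_0^m × ℝ/2πℤ`. -/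
def IsC1Phase {m : ℕ} (I : Set ℝ) (u : ℝ → Phase m) : Prop :=
  ContDiffOn ℝ 1 (fun t => (u t).1) I ∧
    ∀ t₀ ∈ I, ∃ c : ℝ → ℝ, ContDiffWithinAt ℝ 1 c I t₀ ∧
      ∀ᶠ t in 𝓝[I] t₀, (u t).2 = (c t : Real.Angle)

/-- `u` is a `C¹` solution on `I`, of topological charge `k`, of `u_{xt} = sin u`. Here
`u_x = 2πk + ∂ₓ ů` is a curve in `H^m`. -/
def IsSolSG (k : ℤ) {m : ℕ} (I : Set ℝ) (u : ℝ → Phase (m + 1)) : Prop :=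
  IsC1Phase I u ∧ ∀ t ∈ I,
    fn (derivWithin (fun s => const (2 * Real.pi * k) + dx (u s).1.1) I t)
      =ᵐ[μ] fun x => (eval k (u t) x).sin

/-! ### Gardner bracket -/

/-- `g ∈ H¹` is an `L²`-gradient at `v` of the functional `F` on the affine space `v + H_0^l`. -/
def IsL2Gradient {l : ℕ} (F : H l → ℝ) (v : H l) (g : H 1) : Prop :=
  ∃ L : H0 l →L[ℝ] ℝ, (∀ h : H0 l, L h = ∫ x, fn g x * fn h.1 x ∂μ) ∧
    HasFDerivAt (fun w : H0 l => F (v + w)) L 0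

/-- The Gardner bracket `{F,G} = ∫ ∂F ∂ₓ∂G dx` in terms of the `L²`-gradients of `F` and `G`. -/
noncomputable def gardner (gF gG : H 1) : ℝ := ∫ x, fn gF x * fn (dx gG) x ∂μ

/-- The equation `v_t = X(v)` on `W` is Hamiltonian for the Gardner bracket with Hamiltonian
`F₀`: `F₀` is `C¹` with `L²`-gradient in `H¹`, `X = ∂ₓ ∂F₀`, and the derivative of any functional
`F` (with gradient in `H¹`) along `X` is `{F, F₀}`. -/
def IsHamiltonianFor {l : ℕ} (W : Set (H l)) (F₀ : H l → ℝ) (X : H l → ℝ → ℝ) : Prop :=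
  ∀ v ∈ W, ContDiffAt ℝ 1 (fun w : H0 l => F₀ (v + w)) 0 ∧
    ∃ g : H 1, IsL2Gradient F₀ v g ∧ fn (dx g) =ᵐ[μ] X v ∧
      ∀ (F : H l → ℝ) (gF : H 1), IsL2Gradient F v gF →
        ∀ Y : H0 l, fn Y.1 =ᵐ[μ] X v →
          fderiv ℝ (fun w : H0 l => F (v + w)) 0 Y = gardner gF g

/-- `v` is a `C¹` curve in `W` which is an orbit of the Hamiltonian flow of `F₀`:
`v_t = ∂ₓ ∂F₀(v)`. -/
def IsHamiltonianCurve {l : ℕ} (W : Set (H l)) (F₀ : H l → ℝ) (I : Set ℝ) (v : ℝ → H l) : Prop :=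
  ContDiffOn ℝ 1 v I ∧ ∀ t ∈ I, v t ∈ W ∧
    ∃ g : H 1, IsL2Gradient F₀ (v t) g ∧ fn (derivWithin v I t) =ᵐ[μ] fn (dx g)

/-! ### The operator `L_M` of the mKdV equation -/

/-- The graph of the operator `L_M(V) = -∂ₓ² - 2V∂ₓ` in complex `L²(0,1)`, with domain the
functions `f ∈ H²(0,1)` such that `f(1) = σ f(0)`, `f'(1) = σ f'(0)` (`σ = 1`: periodic,
`σ = -1`: anti-periodic). Here `F`, `G`, `h` are `f`, `f'`, `f''`. -/
def LMGraph (σ : ℂ) (V : ℝ → ℂ) (f r : L2C) : Prop :=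
  ∃ (F G : ℝ → ℂ) (h : L2C), f =ᵐ[μ] F ∧
    (∀ x ∈ Icc (0 : ℝ) 1, F x = F 0 + ∫ y in (0 : ℝ)..x, G y) ∧
    (∀ x ∈ Icc (0 : ℝ) 1, G x = G 0 + ∫ y in (0 : ℝ)..x, h y) ∧
    F 1 = σ * F 0 ∧ G 1 = σ * G 0 ∧
    r =ᵐ[μ] fun x => -h x - 2 * V x * G x

/-- The spectrum of `L_M(V)` with the boundary condition `σ`: the `lam` for which `L_M - lam`
is not a bijection of the domain onto `L²`. -/
def specLM (σ : ℂ) (V : ℝ → ℂ) : Set ℂ :=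
  {lam | ¬ ∀ r : L2C, ∃! f : L2C, LMGraph σ V f (r + lam • f)}

/-- `F` solves `-F'' - 2VF' = lam F` on `[0,1]`, with derivative `G`. -/
def IsSolLM (V : ℝ → ℂ) (lam : ℂ) (F G : ℝ → ℂ) : Prop :=
  ContinuousOn F (Icc 0 1) ∧ ContinuousOn G (Icc 0 1) ∧
    (∀ x ∈ Icc (0 : ℝ) 1, F x = F 0 + ∫ y in (0 : ℝ)..x, G y) ∧
    (∀ x ∈ Icc (0 : ℝ) 1, G x = G 0 + ∫ y in (0 : ℝ)..x, (-(2 * V y * G y) - lam * F y))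

/-- `d` is the discriminant `Δ_M(V, lam)`, the trace of the Floquet matrix of `L_M(V)`. -/
def IsDiscriminant (V : ℝ → ℂ) (lam d : ℂ) : Prop :=
  ∃ F₁ G₁ F₂ G₂ : ℝ → ℂ, IsSolLM V lam F₁ G₁ ∧ IsSolLM V lam F₂ G₂ ∧
    F₁ 0 = 1 ∧ G₁ 0 = 0 ∧ F₂ 0 = 0 ∧ G₂ 0 = 1 ∧ d = F₁ 1 + G₂ 1

/-- The potential `V = i v`: the focusing mKdV equation for `v` is the defocusing one for `i v`. -/
noncomputable def focPot {l : ℕ} (v : H l) (x : ℝ) : ℂ := Complex.I * (fn v x : ℂ)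

/-- `F₀` is in the Poisson algebra of the focusing mKdV equation on `W`: the periodic and
anti-periodic spectra of `L_M(i v)` are constants of motion of the Hamiltonian flow of `F₀`.
They are constant also with multiplicities, as the whole discriminant
`lam ↦ Δ_M(i v, lam)` is, whose `±2`-points with their orders are these spectra with their
algebraic multiplicities. -/
def InPoissonAlgebraFocMKdV {l : ℕ} (W : Set (H l)) (F₀ : H l → ℝ) : Prop :=
  ∀ (I : Set ℝ) (v : ℝ → H l), Convex ℝ I → (interior I).Nonempty →
    IsHamiltonianCurve W F₀ I v →
      (∀ s ∈ I, ∀ t ∈ I, specLM 1 (focPot (v s)) = specLM 1 (focPot (v t)) ∧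
        specLM (-1) (focPot (v s)) = specLM (-1) (focPot (v t))) ∧
      ∀ lam : ℂ, ∃ d : ℂ, ∀ t ∈ I, IsDiscriminant (focPot (v t)) lam d

end SineGordon

/-!
Write `u = 2 ∂ₓ⁻¹ v + c_sg(v)` and `K(v) = ∫ exp(2i ∂ₓ⁻¹ v) dx`.

*Parametrization.* For a function `2 ∂ₓ⁻¹ v + θ` the integrals of `cos` and `sin` are the real and
imaginary parts of `exp(iθ) K(v)`, and this number is positive exactly when `K(v) ≠ 0` and
`θ = -arg K(v)` (`exp_mul_pos_iff`). So `P₊` is the graph of `c_sg` over the set `K ≠ 0`, with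
inverse `u ↦ ½ uₓ`, which is affine on the whole phase space. Analyticity reduces to that of `K`,
a composition of bounded linear maps with the exponential of the Banach algebra `C([0,1], ℂ)`, and
of a local branch of the logarithm. The involution `u ↦ ŭ + π` exchanges `P₊` and `P₋` and respects
the sine-Gordon equation, so everything about `Ψ⁻` follows from the case of `Ψ⁺`.

*Hamiltonian.* Integrating `cos u` gives `H_sg = ¼ |K|`, and `|K| ≥ Re (exp(iθ) K)` with equality at
`v` for `θ = c_sg(v)`; hence both sides have the same derivative at `v`, and `c_sg` need not be
differentiated. An integration by parts turns this derivative into the pairing with the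
antiderivative of `½ sin u` (`exists_isL2Gradient_Hsg`).

*Isospectrality.* With `U = 2 ∫₀ˣ v` and `p = exp(iU) F'`, the equation `L_M F = lam F` becomes
`F' = exp(-iU) p`, `p' = -lam exp(iU) F`, whose coefficients are continuous and periodic even if `v`
is only in `L²`. These Volterra systems are uniquely solvable, and their solutions depend smoothly
on the coefficients in the sup norm. A number `lam` is in the spectrum with boundary condition
`σ = ±1` iff the trace of the monodromy matrix is `2σ` (`mem_specLM_iff`), and the trace is the
discriminant (`isDiscriminant_monTrace`). Along `v_t = ½ sin u` the coefficient matrix `A` satisfies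
the zero curvature equation `A_t = M_x + [M, A]` with `M = [[-s, β], [γ, s]]`, where
`s(x) = i ∫₀ˣ v_t` and `β`, `γ` do not depend on `x`. Since `s` vanishes at `0` and at `1`, `M` is
periodic, and the trace does not change (`hasDerivWithinAt_monTrace_zero`).
-/

namespace SineGordon


/-! ### Primitives on the unit interval -/

theorem _root_.AbsolutelyContinuousOnInterval.of_dist_le {X Y : Type*} [PseudoMetricSpace X]
    [PseudoMetricSpace Y] {F : ℝ → X} {G : ℝ → Y} {a b C : ℝ}
    (hF : AbsolutelyContinuousOnInterval F a b)
    (h : ∀ x ∈ uIcc a b, ∀ y ∈ uIcc a b, dist (G x) (G y) ≤ C * dist (F x) (F y)) :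
    AbsolutelyContinuousOnInterval G a b := by
  unfold AbsolutelyContinuousOnInterval at hF ⊢
  refine squeeze_zero' ?_ ?_ (by simpa using hF.const_mul C)
  · exact Filter.Eventually.of_forall fun _ ↦ Finset.sum_nonneg fun i hi ↦ dist_nonneg
  rw [eventually_inf_principal]
  filter_upwards with (n, I) hnI
  simp only [Finset.mul_sum]
  gcongr with i hi
  exact h _ (hnI.1 i hi).1 _ (hnI.1 i hi).2

/-- On `[0,1]`, the function `F` is an (absolutely continuous) primitive of the integrable
function `f`. -/
structure IsPrim {𝕜 : Type*} [RCLike 𝕜] (F f : ℝ → 𝕜) : Prop where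
  ii : IntervalIntegrable f volume 0 1
  eq : ∀ x ∈ Icc (0 : ℝ) 1, F x = F 0 + ∫ y in (0 : ℝ)..x, f y

namespace IsPrim

variable {𝕜 : Type*} [RCLike 𝕜] {F G f g : ℝ → 𝕜}

theorem ac_integral (hf : IntervalIntegrable f volume 0 1) :
    AbsolutelyContinuousOnInterval (fun x => ∫ y in (0 : ℝ)..x, f y) 0 1 := by
  have hre : IntervalIntegrable (fun x => RCLike.re (f x)) volume 0 1 :=
    ⟨hf.1.re, hf.2.re⟩
  have him : IntervalIntegrable (fun x => RCLike.im (f x)) volume 0 1 :=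
    ⟨hf.1.im, hf.2.im⟩
  have h1 := (hre.absolutelyContinuousOnInterval_intervalIntegral (c := 0) (by simp))
  have h2 := (him.absolutelyContinuousOnInterval_intervalIntegral (c := 0) (by simp))
  have h1' : AbsolutelyContinuousOnInterval
      (fun x => ((∫ y in (0 : ℝ)..x, RCLike.re (f y) : ℝ) : 𝕜)) 0 1 :=
    h1.of_dist_le (C := 1) fun x _ y _ => by
      rw [one_mul, dist_eq_norm, ← RCLike.ofReal_sub, RCLike.norm_ofReal, Real.dist_eq]
  have h2' : AbsolutelyContinuousOnInterval
      (fun x => (RCLike.I : 𝕜) • ((∫ y in (0 : ℝ)..x, RCLike.im (f y) : ℝ) : 𝕜)) 0 1 := by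
    refine AbsolutelyContinuousOnInterval.const_smul _
      (h2.of_dist_le (C := 1) fun x _ y _ => ?_)
    rw [one_mul, dist_eq_norm, ← RCLike.ofReal_sub, RCLike.norm_ofReal, Real.dist_eq]
  refine (h1'.add h2').of_dist_le (C := 1) fun x hx y hy => ?_
  have key : ∀ x ∈ uIcc (0 : ℝ) 1, ∫ y in (0 : ℝ)..x, f y =
      ((∫ y in (0 : ℝ)..x, RCLike.re (f y) : ℝ) : 𝕜) +
      (RCLike.I : 𝕜) • ((∫ y in (0 : ℝ)..x, RCLike.im (f y) : ℝ) : 𝕜) := by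
    intro x hx
    rw [uIcc_of_le zero_le_one] at hx
    have hi : IntegrableOn f (Ioc 0 x) volume :=
      ((intervalIntegrable_iff_integrableOn_Ioc_of_le zero_le_one).1 hf).mono_set
        (Ioc_subset_Ioc_right hx.2)
    simp only [intervalIntegral.integral_of_le hx.1]
    have := integral_re_add_im (𝕜 := 𝕜) hi
    rw [← this, smul_eq_mul, mul_comm (RCLike.I : 𝕜)]
  rw [key x hx, key y hy, one_mul]
  rfl

theorem intervalIntegrable_zero (hF : IsPrim F f) {x : ℝ} (hx : x ∈ Icc (0 : ℝ) 1) :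
    IntervalIntegrable f volume 0 x :=
  hF.ii.mono_set (by rw [uIcc_of_le hx.1, uIcc_of_le zero_le_one]; exact Icc_subset_Icc_right hx.2)

theorem ac (hF : IsPrim F f) : AbsolutelyContinuousOnInterval F 0 1 := by
  refine (ac_integral hF.ii).of_dist_le (C := 1) fun x hx y hy => ?_
  rw [uIcc_of_le zero_le_one] at hx hy
  rw [hF.eq x hx, hF.eq y hy, one_mul, dist_add_left]

theorem continuousOn (hF : IsPrim F f) : ContinuousOn F (Icc 0 1) := by
  simpa using hF.ac.continuousOn

theorem ae_hasDerivAt (hF : IsPrim F f) :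
    ∀ᵐ x, x ∈ uIcc (0 : ℝ) 1 → HasDerivAt F (f x) x := by
  have h0 : ∀ᵐ x : ℝ, x ≠ 0 := by simp [ae_iff, measure_singleton]
  have h1 : ∀ᵐ x : ℝ, x ≠ 1 := by simp [ae_iff, measure_singleton]
  filter_upwards [hF.ii.ae_hasDerivAt_integral, h0, h1] with x hx hx0 hx1 hxI
  have hd := (hx hxI 0 (by simp)).const_add (F 0)
  rw [uIcc_of_le zero_le_one] at hxI
  refine hd.congr_of_eventuallyEq ?_
  filter_upwards [Icc_mem_nhds (lt_of_le_of_ne hxI.1 hx0.symm) (lt_of_le_of_ne hxI.2 hx1)] with y hy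
  exact hF.eq y hy

/-- The fundamental theorem of calculus for absolutely continuous functions. -/
theorem of_ac (hF : AbsolutelyContinuousOnInterval F 0 1) (hf : IntervalIntegrable f volume 0 1)
    (hd : ∀ᵐ x, x ∈ uIcc (0 : ℝ) 1 → HasDerivAt F (f x) x) : IsPrim F f := by
  refine ⟨hf, ?_⟩
  have h0 : ∀ᵐ x, x ∈ uIcc (0 : ℝ) 1 →
      HasDerivAt (fun x => F x - ∫ y in (0 : ℝ)..x, f y) 0 x := by
    filter_upwards [hd, hf.ae_hasDerivAt_integral] with x h1 h2 hx
    have h := (h1 hx).sub (h2 hx 0 (by simp))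
    rw [sub_self] at h
    exact h
  obtain ⟨C, hC⟩ := (hF.sub (ac_integral hf)).const_of_ae_hasDerivAt_zero h0
  intro x hx
  rw [uIcc_of_le zero_le_one] at hC
  have h1 : F x - ∫ y in (0 : ℝ)..x, f y = C := hC x hx
  have h2 : F 0 - ∫ y in (0 : ℝ)..0, f y = C := hC 0 (by simp)
  rw [intervalIntegral.integral_same, sub_zero] at h2
  rw [h2, ← h1]; ring

theorem congr_right (hF : IsPrim F f) (h : f =ᵐ[μ] g) : IsPrim F g := by
  have hi : IntervalIntegrable g volume 0 1 := by
    rw [intervalIntegrable_iff_integrableOn_Ioc_of_le zero_le_one]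
    exact ((intervalIntegrable_iff_integrableOn_Ioc_of_le zero_le_one).1 hF.ii).congr h
  refine ⟨hi, fun x hx => ?_⟩
  rw [hF.eq x hx, intervalIntegral.integral_of_le hx.1, intervalIntegral.integral_of_le hx.1]
  congr 1
  exact integral_congr_ae (ae_restrict_of_ae_restrict_of_subset (Ioc_subset_Ioc_right hx.2) h)

theorem congr_left (hF : IsPrim F f) (h : ∀ x ∈ Icc (0 : ℝ) 1, G x = F x) : IsPrim G f :=
  ⟨hF.ii, fun x hx => by rw [h x hx, h 0 (by simp), hF.eq x hx]⟩

theorem add (hF : IsPrim F f) (hG : IsPrim G g) :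
    IsPrim (fun x => F x + G x) fun x => f x + g x := by
  refine ⟨hF.ii.add hG.ii, fun x hx => ?_⟩
  rw [intervalIntegral.integral_add (hF.intervalIntegrable_zero hx)
    (hG.intervalIntegrable_zero hx), hF.eq x hx, hG.eq x hx]
  ring

theorem const_mul (c : 𝕜) (hF : IsPrim F f) : IsPrim (fun x => c * F x) fun x => c * f x := by
  refine ⟨hF.ii.const_mul c, fun x hx => ?_⟩
  rw [intervalIntegral.integral_const_mul, hF.eq x hx]
  ring

theorem const (c : 𝕜) : IsPrim (fun _ => c) fun _ => 0 :=
  ⟨by simp, fun x _ => by simp⟩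

/-- The product rule. -/
theorem mul (hF : IsPrim F f) (hG : IsPrim G g) :
    IsPrim (fun x => F x * G x) fun x => f x * G x + F x * g x := by
  refine of_ac (hF.ac.smul hG.ac) ?_ ?_
  · refine IntervalIntegrable.add ?_ ?_
    · exact hF.ii.mul_continuousOn (by simpa using hG.continuousOn)
    · exact hG.ii.continuousOn_mul (by simpa using hF.continuousOn)
  · filter_upwards [hF.ae_hasDerivAt, hG.ae_hasDerivAt] with x h1 h2 hx
    exact (h1 hx).mul (h2 hx)

/-- The chain rule. -/
theorem comp {φ φ' : 𝕜 → 𝕜} (hφ : ∀ z, HasDerivAt φ (φ' z) z) (hc : Continuous φ')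
    (hF : IsPrim F f) : IsPrim (fun x => φ (F x)) fun x => φ' (F x) * f x := by
  obtain ⟨R, hR⟩ := (isCompact_uIcc.image_of_continuousOn
    hF.ac.continuousOn).isBounded.subset_closedBall 0
  obtain ⟨C, hC⟩ := (isCompact_closedBall (0 : 𝕜) R).exists_bound_of_continuousOn hc.continuousOn
  have hac : AbsolutelyContinuousOnInterval (fun x => φ (F x)) 0 1 := by
    refine hF.ac.of_dist_le (C := C) fun x hx y hy => ?_
    rw [dist_eq_norm, dist_eq_norm]
    exact (convex_closedBall (0 : 𝕜) R).norm_image_sub_le_of_norm_hasDerivWithin_le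
      (fun z _ => (hφ z).hasDerivWithinAt) hC (hR ⟨y, hy, rfl⟩) (hR ⟨x, hx, rfl⟩)
  refine of_ac hac ?_ ?_
  · refine hF.ii.continuousOn_mul (hc.comp_continuousOn (by simpa using hF.continuousOn))
  · filter_upwards [hF.ae_hasDerivAt] with x h1 hx
    exact (hφ _).comp x (h1 hx)

theorem of_intervalIntegrable (c : 𝕜) (hf : IntervalIntegrable f volume 0 1) :
    IsPrim (fun x => c + ∫ y in (0 : ℝ)..x, f y) f :=
  ⟨hf, fun x _ => by simp⟩

theorem of_hasDerivAt (h : ∀ x, HasDerivAt F (f x) x) (hc : Continuous f) : IsPrim F f :=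
  ⟨hc.intervalIntegrable _ _, fun x _ => by
    rw [intervalIntegral.integral_eq_sub_of_hasDerivAt (fun y _ => h y)
      (hc.intervalIntegrable _ _)]
    ring⟩

theorem ofReal {F f : ℝ → ℝ} (hF : IsPrim F f) :
    IsPrim (fun x => (F x : ℂ)) fun x => (f x : ℂ) :=
  ⟨⟨hF.ii.1.ofReal, hF.ii.2.ofReal⟩, fun x hx => by
    rw [hF.eq x hx, Complex.ofReal_add, intervalIntegral.integral_ofReal]⟩

/-- Integration by parts against a function with the same end values. -/
theorem integral_mul_eq_neg (hF : IsPrim F f) (hG : IsPrim G g) (h : F 1 * G 1 = F 0 * G 0) :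
    ∫ x, F x * g x ∂μ = -∫ x, f x * G x ∂μ := by
  have h1 := (hF.mul hG).eq 1 (by simp)
  have hi1 : IntervalIntegrable (fun x => f x * G x) volume 0 1 :=
    hF.ii.mul_continuousOn (by simpa using hG.continuousOn)
  have hi2 : IntervalIntegrable (fun x => F x * g x) volume 0 1 :=
    hG.ii.continuousOn_mul (by simpa using hF.continuousOn)
  rw [intervalIntegral.integral_add hi1 hi2, h, intervalIntegral.integral_of_le zero_le_one,
    intervalIntegral.integral_of_le zero_le_one] at h1
  linear_combination -h1

end IsPrim


/-! ### Weak derivatives on the circle -/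

/-- The periodic extension of a test function supported in `(0,1)` is smooth. -/
theorem contDiff_comp_fract {φ : ℝ → ℝ} (hφ : ContDiff ℝ ∞ φ) (hs : tsupport φ ⊆ Ioo 0 1) :
    ContDiff ℝ ∞ fun x => φ (Int.fract x) := by
  rw [contDiff_iff_contDiffAt]
  intro x
  have hshift : ∀ n : ℝ, ContDiff ℝ ∞ fun y => φ (y - n) := fun n =>
    hφ.comp (contDiff_id.sub contDiff_const)
  by_cases hx : x = ⌊x⌋
  · have h0 : ∀ᶠ y in 𝓝 (0 : ℝ), φ y = 0 :=
      notMem_tsupport_iff_eventuallyEq.1 fun h => lt_irrefl _ (hs h).1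
    have h1 : ∀ᶠ y in 𝓝 (1 : ℝ), φ y = 0 :=
      notMem_tsupport_iff_eventuallyEq.1 fun h => lt_irrefl _ (hs h).2
    have t0 : Tendsto (fun y : ℝ => y - ⌊x⌋) (𝓝 x) (𝓝 0) := by
      have : Tendsto (fun y : ℝ => y - ⌊x⌋) (𝓝 x) (𝓝 (x - ⌊x⌋)) :=
        (continuous_id.sub continuous_const).tendsto x
      rwa [sub_eq_zero.2 hx] at this
    have t1 : Tendsto (fun y : ℝ => y - ⌊x⌋ + 1) (𝓝 x) (𝓝 1) := by
      simpa using t0.add_const 1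
    refine (contDiffAt_const (c := (0 : ℝ))).congr_of_eventuallyEq ?_
    have hn : Ioo (x - 1) (x + 1) ∈ 𝓝 x := Ioo_mem_nhds (by linarith) (by linarith)
    filter_upwards [t0.eventually h0, t1.eventually h1, hn] with y h0 h1 hy
    by_cases hxy : x ≤ y
    · have : ⌊y⌋ = ⌊x⌋ := by
        rw [Int.floor_eq_iff, ← hx]; exact ⟨hxy, hy.2⟩
      rw [Int.fract, this, h0]
    · have : ⌊y⌋ = ⌊x⌋ - 1 := by
        rw [Int.floor_eq_iff]; push_cast; rw [← hx]
        exact ⟨hy.1.le, by linarith⟩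
      rw [Int.fract, this, ← h1]; push_cast; congr 1; ring
  · have hlt : (⌊x⌋ : ℝ) < x := lt_of_le_of_ne (Int.floor_le x) (Ne.symm hx)
    refine (hshift ⌊x⌋).contDiffAt.congr_of_eventuallyEq ?_
    filter_upwards [Ioo_mem_nhds hlt (Int.lt_floor_add_one x)] with y hy
    have : ⌊y⌋ = ⌊x⌋ := by rw [Int.floor_eq_iff]; exact ⟨hy.1.le, hy.2⟩
    rw [Int.fract, this]

theorem ae_mem_Ioo : ∀ᵐ x ∂μ, x ∈ Ioo (0 : ℝ) 1 := by
  have h1 : ∀ᵐ x : ℝ ∂μ, x ≠ 1 := ae_restrict_of_ae (by simp [ae_iff, measure_singleton])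
  filter_upwards [h1, ae_restrict_mem measurableSet_Ioc] with x h1 hx
  exact ⟨hx.1, lt_of_le_of_ne hx.2 h1⟩

theorem ae_mem_Icc : ∀ᵐ x ∂μ, x ∈ Icc (0 : ℝ) 1 :=
  ae_mem_Ioo.mono fun _ h => Ioo_subset_Icc_self h

/-- The fundamental lemma of the calculus of variations on the circle. -/
theorem eq_zero_of_forall_integral_mul_eq_zero {f : L2}
    (h : ∀ φ : ℝ → ℝ, ContDiff ℝ ∞ φ → Function.Periodic φ 1 → ∫ x, f x * φ x ∂μ = 0) :
    f = 0 := by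
  have key : ∀ᵐ x ∂μ, x ∈ Ioo (0 : ℝ) 1 → f x = 0 := by
    refine isOpen_Ioo.ae_eq_zero_of_integral_contDiff_smul_eq_zero
      ((integrable_L2 f).locallyIntegrable.locallyIntegrableOn _) fun φ hφ _ hs => ?_
    rw [← h _ (contDiff_comp_fract hφ hs) fun x => by simp]
    refine integral_congr_ae ?_
    filter_upwards [ae_mem_Ioo] with x hx
    rw [Int.fract_eq_self.2 ⟨hx.1.le, hx.2⟩, smul_eq_mul, mul_comm]
  refine Lp.ext ?_
  filter_upwards [key, ae_mem_Ioo, Lp.coeFn_zero ℝ 2 μ] with x h1 h2 h3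
  rw [h1 h2, h3]; rfl

theorem integral_sub_mul (f g : L2) {φ : ℝ → ℝ} (hφ : Continuous φ) :
    ∫ x, (f - g : L2) x * φ x ∂μ = ∫ x, f x * φ x ∂μ - ∫ x, g x * φ x ∂μ := by
  rw [← integral_sub (integrable_mul f hφ) (integrable_mul g hφ)]
  refine integral_congr_ae ?_
  filter_upwards [Lp.coeFn_sub f g] with x hx
  rw [hx]; simp [sub_mul]

theorem IsWeakDeriv.sub {f g f' g' : L2} (h : IsWeakDeriv f g) (h' : IsWeakDeriv f' g') :
    IsWeakDeriv (f - f') (g - g') := by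
  have := h.add (h'.smul (-1))
  rwa [neg_one_smul, neg_one_smul, ← sub_eq_add_neg, ← sub_eq_add_neg] at this

theorem IsWeakDeriv.unique {f g g' : L2} (h : IsWeakDeriv f g) (h' : IsWeakDeriv f g') :
    g = g' := by
  refine sub_eq_zero.1 (eq_zero_of_forall_integral_mul_eq_zero fun φ hφ hp => ?_)
  rw [integral_sub_mul _ _ hφ.continuous, sub_eq_zero, ← neg_inj, ← h φ hφ hp, h' φ hφ hp]

theorem IsWeakDeriv.integral_eq_zero {f g : L2} (h : IsWeakDeriv f g) : ∫ x, g x ∂μ = 0 := by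
  have := h (fun _ => 1) contDiff_const (fun _ => rfl)
  simpa using this

/-- The du Bois-Reymond lemma: a function with weak derivative zero is constant. -/
theorem ae_eq_const_of_integral_mul_deriv_eq_zero {f : L2}
    (h : ∀ φ : ℝ → ℝ, ContDiff ℝ ∞ φ → Function.Periodic φ 1 → ∫ x, f x * deriv φ x ∂μ = 0) :
    f = (const_memLp (∫ x, f x ∂μ)).toLp _ := by
  refine sub_eq_zero.1 (eq_zero_of_forall_integral_mul_eq_zero fun φ hφ hp => ?_)
  rw [integral_sub_mul _ _ hφ.continuous]
  set m : ℝ := ∫ y in (0 : ℝ)..1, φ y with hm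
  have hint : ∀ a b : ℝ, IntervalIntegrable (fun y => φ y - m) volume a b := fun a b =>
    (hφ.continuous.sub continuous_const).intervalIntegrable _ _
  have hd : ∀ x, HasDerivAt (fun x => ∫ y in (0 : ℝ)..x, (φ y - m)) (φ x - m) x := fun x =>
    intervalIntegral.integral_hasDerivAt_right (hint _ _)
      ((hφ.continuous.sub continuous_const).stronglyMeasurableAtFilter _ _)
      (hφ.continuous.sub continuous_const).continuousAt
  have hderiv : deriv (fun x => ∫ y in (0 : ℝ)..x, (φ y - m)) = fun x => φ x - m :=
    funext fun x => (hd x).deriv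
  have hsm : ContDiff ℝ ∞ fun x => ∫ y in (0 : ℝ)..x, (φ y - m) := by
    rw [contDiff_infty_iff_deriv, hderiv]
    exact ⟨fun x => (hd x).differentiableAt, hφ.sub contDiff_const⟩
  have hper : Function.Periodic (fun x => ∫ y in (0 : ℝ)..x, (φ y - m)) 1 := by
    intro x
    have hp' : Function.Periodic (fun y => φ y - m) 1 := fun y => by simp only [hp y]
    have h1 := hp'.intervalIntegral_add_eq x 0
    have h2 : ∫ y in (0 : ℝ)..(0 + 1), (φ y - m) = 0 := by
      rw [zero_add, intervalIntegral.integral_sub (hφ.continuous.intervalIntegrable _ _)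
        (by simp)]
      simp [hm]
    simp only
    rw [← intervalIntegral.integral_add_adjacent_intervals (hint 0 x) (hint x (x + 1)), h1, h2,
      add_zero]
  have key := h _ hsm hper
  rw [hderiv] at key
  have e1 : ∫ x, f x * (φ x - m) ∂μ = ∫ x, f x * φ x ∂μ - (∫ x, f x ∂μ) * m := by
    rw [← integral_mul_const, ← integral_sub (integrable_mul f hφ.continuous)
      ((integrable_L2 f).mul_const m)]
    exact integral_congr_ae (Eventually.of_forall fun x => by simp only; ring)
  have e2 : ∫ x, ((const_memLp (∫ x, f x ∂μ)).toLp _ : L2) x * φ x ∂μ = (∫ x, f x ∂μ) * m := by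
    rw [hm, intervalIntegral.integral_of_le zero_le_one, ← integral_const_mul]
    refine integral_congr_ae ?_
    filter_upwards [(const_memLp (∫ x, f x ∂μ)).coeFn_toLp] with x hx
    rw [hx]
  rw [e2, ← e1, key]

theorem eq_of_isWeakDeriv {f f' g : L2} (h : IsWeakDeriv f g) (h' : IsWeakDeriv f' g)
    (hm : ∫ x, f x ∂μ = ∫ x, f' x ∂μ) : f = f' := by
  have h0 := h.sub h'
  rw [sub_self] at h0
  have := ae_eq_const_of_integral_mul_deriv_eq_zero (f := f - f') fun φ hφ hp => by
    rw [h0 φ hφ hp, neg_eq_zero]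
    refine integral_eq_zero_of_ae ?_
    filter_upwards [Lp.coeFn_zero ℝ 2 μ] with x hx
    rw [hx]; simp
  have hz : ∫ x, (f - f' : L2) x ∂μ = 0 := by
    have := integral_sub_mul f f' (φ := fun _ => 1) continuous_const
    simp only [mul_one] at this
    rw [this, hm, sub_self]
  rw [hz] at this
  refine sub_eq_zero.1 (this.trans ?_)
  exact MemLp.toLp_zero _

theorem isPrim_prim0 (v : L2) : IsPrim (prim0 v) fun x => v x - ∫ z, v z ∂μ :=
  ⟨prim0_ii v, fun x _ => by simp [prim0]⟩

theorem prim0_zero (v : L2) : prim0 v 0 = 0 := by simp [prim0]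

theorem prim0_one (v : L2) : prim0 v 1 = 0 := by
  unfold prim0
  rw [intervalIntegral.integral_sub (intervalIntegrable_L2 v) intervalIntegrable_const,
    intervalIntegral.integral_of_le zero_le_one]
  simp

/-- A function on `[0,1]` with equal end values and an `L²` derivative almost everywhere is weakly
differentiable on the circle. -/
theorem IsPrim.isWeakDeriv {f g : L2} {F : ℝ → ℝ} (hF : IsPrim F g) (h01 : F 1 = F 0)
    (hf : f =ᵐ[μ] F) : IsWeakDeriv f g := by
  intro φ hφ hp
  have h1 : φ 1 = φ 0 := by simpa using hp 0
  have hG : IsPrim φ (deriv φ) := IsPrim.of_hasDerivAt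
    (fun x => (hφ.differentiable (by simp) x).hasDerivAt) (hφ.continuous_deriv (by simp))
  rw [← hF.integral_mul_eq_neg hG (by rw [h01, h1])]
  refine integral_congr_ae ?_
  filter_upwards [hf] with x hx
  rw [hx]

/-- A weakly differentiable function on the circle has an absolutely continuous representative with
equal end values. -/
theorem IsWeakDeriv.exists_isPrim {f g : L2} (h : IsWeakDeriv f g) :
    ∃ F : ℝ → ℝ, f =ᵐ[μ] F ∧ IsPrim F g ∧ F 1 = F 0 := by
  have h0 := h.integral_eq_zero
  have hP : IsPrim (prim0 g) g := by simpa [h0] using isPrim_prim0 g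
  have hi : Integrable (prim0 g) μ :=
    ((prim0_continuousOn g).integrableOn_compact isCompact_Icc).mono_set Ioc_subset_Icc_self
  set c := ∫ x, f x ∂μ - ∫ x, prim0 g x ∂μ with hc
  have hPc : IsPrim (fun x => prim0 g x + c) g := by
    simpa using hP.add (IsPrim.const c)
  have hcont := hPc.continuousOn
  have hmem : MemLp (fun x => prim0 g x + c) 2 μ := by
    obtain ⟨C, hC⟩ := isCompact_Icc.exists_bound_of_continuousOn hcont
    refine MemLp.of_bound
      ((hcont.mono Ioc_subset_Icc_self).aestronglyMeasurable measurableSet_Ioc) C ?_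
    filter_upwards [ae_mem_Icc] with x hx using hC x hx
  have h01 : prim0 g 1 + c = prim0 g 0 + c := by rw [prim0_zero, prim0_one]
  refine ⟨fun x => prim0 g x + c, ?_, hPc, h01⟩
  have he : f = hmem.toLp _ := by
    refine eq_of_isWeakDeriv h
      (hPc.isWeakDeriv h01 hmem.coeFn_toLp) ?_
    rw [integral_congr_ae hmem.coeFn_toLp, integral_add hi (integrable_const _)]
    simp [hc]
  rw [he]
  exact hmem.coeFn_toLp

/-! ### Membership in Sobolev spaces -/

/-- The weak derivatives stored in an element of `H^m` are determined by its function. -/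
theorem H_ext {m : ℕ} {f g : H m} (h : fn f = fn g) : f = g := by
  have key : ∀ j : ℕ, ∀ hj : j < m + 1, f.1 ⟨j, hj⟩ = g.1 ⟨j, hj⟩ := by
    intro j
    induction j with
    | zero => exact fun _ => h
    | succ j ih =>
      intro hj
      have h1 := f.2 ⟨j, by omega⟩
      have h2 := g.2 ⟨j, by omega⟩
      have e : f.1 (Fin.castSucc ⟨j, by omega⟩) = g.1 (Fin.castSucc ⟨j, by omega⟩) :=
        ih (by omega)
      rw [e] at h1
      exact h1.unique h2
  exact Subtype.ext (PiLp.ext fun j => key j j.2)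

/-- The function `F` on `[0,1]` is almost everywhere equal to an element of `H^m(𝕋,ℝ)`. -/
def MemH (m : ℕ) (F : ℝ → ℝ) : Prop := ∃ f : H m, fn f =ᵐ[μ] F

theorem MemH.congr {m : ℕ} {F G : ℝ → ℝ} (h : MemH m F) (hFG : F =ᵐ[μ] G) : MemH m G :=
  let ⟨f, hf⟩ := h; ⟨f, hf.trans hFG⟩

theorem memH_zero_of_memLp {F : ℝ → ℝ} (h : MemLp F 2 μ) : MemH 0 F :=
  ⟨⟨WithLp.toLp 2 fun _ => h.toLp _, fun j => j.elim0⟩, h.coeFn_toLp⟩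

theorem MemH.memLp {m : ℕ} {F : ℝ → ℝ} (h : MemH m F) : MemLp F 2 μ :=
  let ⟨f, hf⟩ := h; (memLp_congr_ae hf).1 (Lp.memLp (fn f))

theorem memLp_of_continuousOn {𝕜 : Type*} [RCLike 𝕜] {F : ℝ → 𝕜}
    (h : ContinuousOn F (Icc 0 1)) : MemLp F 2 μ := by
  obtain ⟨C, hC⟩ := isCompact_Icc.exists_bound_of_continuousOn h
  refine MemLp.of_bound ((h.mono Ioc_subset_Icc_self).aestronglyMeasurable measurableSet_Ioc) C ?_
  filter_upwards [ae_mem_Icc] with x hx using hC x hx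

theorem MemH.add {m : ℕ} {F G : ℝ → ℝ} (hF : MemH m F) (hG : MemH m G) :
    MemH m fun x => F x + G x := by
  obtain ⟨f, hf⟩ := hF
  obtain ⟨g, hg⟩ := hG
  refine ⟨f + g, ?_⟩
  filter_upwards [hf, hg, Lp.coeFn_add (fn f) (fn g)] with x h1 h2 h3
  rw [← h1, ← h2]
  exact h3

theorem MemH.const_mul {m : ℕ} {F : ℝ → ℝ} (c : ℝ) (hF : MemH m F) :
    MemH m fun x => c * F x := by
  obtain ⟨f, hf⟩ := hF
  refine ⟨c • f, ?_⟩
  filter_upwards [hf, Lp.coeFn_smul c (fn f)] with x h1 h3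
  rw [← h1]
  exact h3

theorem MemH.succ {m : ℕ} {F f : ℝ → ℝ} (hF : IsPrim F f) (h01 : F 1 = F 0) (hf : MemH m f) :
    MemH (m + 1) F := by
  obtain ⟨g, hg⟩ := hf
  have hm := memLp_of_continuousOn hF.continuousOn
  refine ⟨⟨WithLp.toLp 2 (Fin.cons (hm.toLp _) fun j : Fin (m + 1) => g.1 j), fun j => ?_⟩,
    hm.coeFn_toLp⟩
  refine Fin.cases ?_ (fun i => ?_) j
  · exact (hF.congr_right hg.symm).isWeakDeriv h01 hm.coeFn_toLp
  · exact g.2 i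

theorem MemH.exists_isPrim {m : ℕ} {F : ℝ → ℝ} (h : MemH (m + 1) F) :
    ∃ G g : ℝ → ℝ, F =ᵐ[μ] G ∧ IsPrim G g ∧ G 1 = G 0 ∧ MemH m g := by
  obtain ⟨f, hf⟩ := h
  obtain ⟨G, hG, hp, h01⟩ := (f.2 0).exists_isPrim
  exact ⟨G, _, hf.symm.trans hG, hp, h01, dx f, ae_eq_rfl⟩

theorem MemH.of_succ {m : ℕ} {F : ℝ → ℝ} (h : MemH (m + 1) F) : MemH m F := by
  obtain ⟨f, hf⟩ := h
  exact ⟨⟨WithLp.toLp 2 fun j : Fin (m + 1) => f.1 j.castSucc, fun j => f.2 j.castSucc⟩, hf⟩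

theorem MemH.of_le {m n : ℕ} (hmn : m ≤ n) {F : ℝ → ℝ} (h : MemH n F) : MemH m F := by
  induction n, hmn using Nat.le_induction with
  | base => exact h
  | succ n _ ih => exact ih h.of_succ

theorem memLp_mul_continuousOn {𝕜 : Type*} [RCLike 𝕜] {F G : ℝ → 𝕜} (hF : MemLp F 2 μ)
    (hG : ContinuousOn G (Icc 0 1)) :
    MemLp (fun x => F x * G x) 2 μ := by
  obtain ⟨C, hC⟩ := isCompact_Icc.exists_bound_of_continuousOn hG
  refine MemLp.of_le_mul (c := C) hF (hF.1.mul
    ((hG.mono Ioc_subset_Icc_self).aestronglyMeasurable measurableSet_Ioc)) ?_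
  filter_upwards [ae_mem_Icc] with x hx
  rw [norm_mul, mul_comm]
  exact mul_le_mul_of_nonneg_right (hC x hx) (norm_nonneg _)

/-- `H^m(𝕋,ℝ)` is closed under multiplication if `m ≥ 1`. -/
theorem MemH.mul {m : ℕ} {F G : ℝ → ℝ} (hF : MemH (m + 1) F) (hG : MemH (m + 1) G) :
    MemH (m + 1) fun x => F x * G x := by
  induction m generalizing F G with
  | zero =>
    obtain ⟨F', f, hF', hFp, hF01, hf⟩ := hF.exists_isPrim
    obtain ⟨G', g, hG', hGp, hG01, hg⟩ := hG.exists_isPrim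
    refine MemH.congr (F := fun x => F' x * G' x) ?_ ?_
    · refine MemH.succ (hFp.mul hGp) (by rw [hF01, hG01]) (memH_zero_of_memLp ?_)
      refine (memLp_mul_continuousOn hf.memLp hGp.continuousOn).add ?_
      simpa only [mul_comm] using memLp_mul_continuousOn hg.memLp hFp.continuousOn
    · filter_upwards [hF', hG'] with x h1 h2
      rw [h1, h2]
  | succ m ih =>
    obtain ⟨F', f, hF', hFp, hF01, hf⟩ := hF.exists_isPrim
    obtain ⟨G', g, hG', hGp, hG01, hg⟩ := hG.exists_isPrim
    refine MemH.congr (F := fun x => F' x * G' x) ?_ ?_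
    · exact MemH.succ (hFp.mul hGp) (by rw [hF01, hG01])
        ((ih hf (hG.congr hG').of_succ).add (ih (hF.congr hF').of_succ hg))
    · filter_upwards [hF', hG'] with x h1 h2
      rw [h1, h2]

/-- If `F' ∈ H^l` and `F` is periodic modulo `2π`, then `sin F` and `cos F` are in `H^{l+1}`. -/
theorem memH_sin_cos {l : ℕ} {F f : ℝ → ℝ} (hF : IsPrim F f) (hf : MemH l f)
    (hs : Real.sin (F 1) = Real.sin (F 0)) (hc : Real.cos (F 1) = Real.cos (F 0)) :
    MemH (l + 1) (fun x => Real.sin (F x)) ∧ MemH (l + 1) fun x => Real.cos (F x) := by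
  have hsin : IsPrim (fun x => Real.sin (F x)) fun x => Real.cos (F x) * f x :=
    hF.comp (φ' := Real.cos) Real.hasDerivAt_sin Real.continuous_cos
  have hcos : IsPrim (fun x => Real.cos (F x)) fun x => -Real.sin (F x) * f x :=
    hF.comp (φ' := fun x => -Real.sin x) Real.hasDerivAt_cos Real.continuous_sin.neg
  suffices h : ∀ m ≤ l, MemH m (fun x => Real.cos (F x) * f x) ∧
      MemH m fun x => Real.sin (F x) * f x by
    refine ⟨MemH.succ hsin hs (h l le_rfl).1, MemH.succ hcos hc ?_⟩
    simpa using (h l le_rfl).2.const_mul (-1)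
  intro m hm
  induction m with
  | zero =>
    constructor <;> refine memH_zero_of_memLp ?_ <;> simp only [mul_comm _ (f _)] <;>
      refine memLp_mul_continuousOn hf.memLp ?_
    · exact hcos.continuousOn
    · exact hsin.continuousOn
  | succ m ih =>
    obtain ⟨h1, h2⟩ := ih (by omega)
    refine ⟨MemH.mul (MemH.succ hcos hc ?_) (hf.of_le hm),
      MemH.mul (MemH.succ hsin hs h1) (hf.of_le hm)⟩
    simpa using h2.const_mul (-1)

theorem memH_of_contDiff {φ : ℝ → ℝ} (hφ : ContDiff ℝ ∞ φ) (hp : Function.Periodic φ 1) (m : ℕ) :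
    MemH m φ := by
  induction m generalizing φ with
  | zero => exact memH_zero_of_memLp (memLp_of_continuousOn hφ.continuous.continuousOn)
  | succ m ih =>
    refine MemH.succ (f := deriv φ) (IsPrim.of_hasDerivAt
      (fun x => (hφ.differentiable (by simp) x).hasDerivAt) (hφ.continuous_deriv (by simp)))
      (by simpa using hp 0) (ih (contDiff_infty_iff_deriv.1 hφ).2 fun x => ?_)
    rw [← deriv_comp_add_const]
    congr 1
    exact funext hp


/-! ### Bounded linear maps between Sobolev spaces and spaces of continuous functions -/

instance : IsProbabilityMeasure μ := ⟨by simp⟩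

-- Direct instances for the subspaces; unfolding their carriers in every search is slow.
noncomputable instance (m : ℕ) : NormedAddCommGroup (H m) := Submodule.normedAddCommGroup _

noncomputable instance (m : ℕ) : SeminormedAddCommGroup (H m) :=
  NormedAddCommGroup.toSeminormedAddCommGroup

noncomputable instance (m : ℕ) : NormedSpace ℝ (H m) := Submodule.normedSpace _

noncomputable instance (m : ℕ) : NormedAddCommGroup (H0 m) := Submodule.normedAddCommGroup _

noncomputable instance (m : ℕ) : SeminormedAddCommGroup (H0 m) :=
  NormedAddCommGroup.toSeminormedAddCommGroup

noncomputable instance (m : ℕ) : NormedSpace ℝ (H0 m) := Submodule.normedSpace _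

/-- Extension of a continuous function on `[0,1]` to the real line by its end values. -/
noncomputable def ext {E : Type*} [TopologicalSpace E] (f : C(unitInterval, E)) : ℝ → E :=
  Set.IccExtend zero_le_one f

section ext
variable {E : Type*} [NormedAddCommGroup E]

theorem ext_continuous (f : C(unitInterval, E)) : Continuous (ext f) :=
  f.continuous.Icc_extend'

theorem ext_apply (f : C(unitInterval, E)) {x : ℝ} (hx : x ∈ Icc (0 : ℝ) 1) :
    ext f x = f ⟨x, hx⟩ := IccExtend_of_mem _ _ hx

theorem ext_coe (f : C(unitInterval, E)) (x : unitInterval) : ext f x = f x :=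
  ext_apply f x.2

theorem norm_ext_le (f : C(unitInterval, E)) (x : ℝ) : ‖ext f x‖ ≤ ‖f‖ :=
  f.norm_coe_le_norm _

end ext

section J
variable (𝕜 : Type*) [RCLike 𝕜]

theorem continuous_integral_ext (f : C(unitInterval, 𝕜)) :
    Continuous fun x : ℝ => ∫ y in (0 : ℝ)..x, ext f y :=
  intervalIntegral.continuous_primitive (fun _ _ => (ext_continuous f).intervalIntegrable _ _) _

/-- The Volterra operator `f ↦ ∫₀ˣ f` on `C([0,1])`. -/
noncomputable def J : C(unitInterval, 𝕜) →L[𝕜] C(unitInterval, 𝕜) :=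
  LinearMap.mkContinuous
    { toFun := fun f => ⟨fun x => ∫ y in (0 : ℝ)..x, ext f y,
        (continuous_integral_ext 𝕜 f).comp continuous_subtype_val⟩
      map_add' := fun f g => by
        ext x
        exact intervalIntegral.integral_add ((ext_continuous f).intervalIntegrable _ _)
          ((ext_continuous g).intervalIntegrable _ _)
      map_smul' := fun c f => by
        ext x
        exact intervalIntegral.integral_smul c (ext f) } 1 fun f => by
    rw [ContinuousMap.norm_le _ (by positivity)]
    intro x
    refine (intervalIntegral.norm_integral_le_of_norm_le_const
      (C := ‖f‖) fun y _ => norm_ext_le f y).trans ?_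
    rw [sub_zero, abs_of_nonneg x.2.1, one_mul]
    exact mul_le_of_le_one_right (norm_nonneg _) x.2.2

variable {𝕜}

theorem J_apply (f : C(unitInterval, 𝕜)) (x : unitInterval) :
    J 𝕜 f x = ∫ y in (0 : ℝ)..x, ext f y := rfl

theorem J_zero (f : C(unitInterval, 𝕜)) : J 𝕜 f 0 = 0 := by simp [J_apply]

theorem isPrim_J (f : C(unitInterval, 𝕜)) : IsPrim (ext (J 𝕜 f)) (ext f) :=
  ⟨(ext_continuous f).intervalIntegrable _ _, fun x hx => by
    rw [ext_apply _ hx, ext_apply _ (x := 0) (by simp), J_apply, J_apply]; simp⟩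

theorem J_one (f : C(unitInterval, 𝕜)) : J 𝕜 f 1 = ∫ x, ext f x ∂μ := by
  rw [J_apply, Icc.coe_one, intervalIntegral.integral_of_le zero_le_one]

variable (𝕜) in
/-- The integral over `[0,1]` of continuous functions. -/
noncomputable def intC : C(unitInterval, 𝕜) →L[𝕜] 𝕜 :=
  (ContinuousMap.evalCLM 𝕜 (1 : unitInterval)).comp (J 𝕜)

theorem intC_apply (f : C(unitInterval, 𝕜)) : intC 𝕜 f = ∫ x, ext f x ∂μ := J_one f

end J

theorem norm_integral_le_L2 (f : L2) : ∫ x, ‖f x‖ ∂μ ≤ ‖f‖ := by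
  rw [Lp.norm_def, integral_norm_eq_lintegral_enorm (Lp.aestronglyMeasurable f),
    ← eLpNorm_one_eq_lintegral_enorm]
  exact ENNReal.toReal_mono (Lp.eLpNorm_ne_top f)
    (eLpNorm_le_eLpNorm_of_exponent_le (by norm_num) (Lp.aestronglyMeasurable f))

theorem intervalIntegrable_L2' (f : L2) (x : unitInterval) :
    IntervalIntegrable f volume 0 x :=
  (intervalIntegrable_L2 f).mono_set (by
    rw [uIcc_of_le x.2.1, uIcc_of_le zero_le_one]; exact Icc_subset_Icc_right x.2.2)

theorem continuous_primitive_L2 (f : L2) :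
    Continuous fun x : unitInterval => ∫ y in (0 : ℝ)..x, f y := by
  have h := (IsPrim.ac_integral (intervalIntegrable_L2 f)).continuousOn
  rw [uIcc_of_le zero_le_one] at h
  exact h.comp_continuous continuous_subtype_val fun x => x.2

/-- The primitive `f ↦ ∫₀ˣ f` of square integrable functions, as a continuous function. -/
noncomputable def primL : L2 →L[ℝ] C(unitInterval, ℝ) :=
  LinearMap.mkContinuous
    { toFun := fun f => ⟨fun x => ∫ y in (0 : ℝ)..x, f y, continuous_primitive_L2 f⟩
      map_add' := fun f g => by
        ext x
        change ∫ y in (0 : ℝ)..x, (f + g : L2) y =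
          (∫ y in (0 : ℝ)..x, f y) + ∫ y in (0 : ℝ)..x, g y
        rw [← intervalIntegral.integral_add (intervalIntegrable_L2' f x)
          (intervalIntegrable_L2' g x), intervalIntegral.integral_of_le x.2.1,
          intervalIntegral.integral_of_le x.2.1]
        exact integral_congr_ae (ae_restrict_of_ae_restrict_of_subset
          (Ioc_subset_Ioc_right x.2.2) (Lp.coeFn_add f g))
      map_smul' := fun c f => by
        ext x
        change ∫ y in (0 : ℝ)..x, (c • f : L2) y = c • ∫ y in (0 : ℝ)..x, f y
        rw [← intervalIntegral.integral_smul, intervalIntegral.integral_of_le x.2.1,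
          intervalIntegral.integral_of_le x.2.1]
        exact integral_congr_ae (ae_restrict_of_ae_restrict_of_subset
          (Ioc_subset_Ioc_right x.2.2) (Lp.coeFn_smul c f)) } 1 fun f => by
    rw [ContinuousMap.norm_le _ (by positivity)]
    intro x
    rw [one_mul]
    refine le_trans ?_ (norm_integral_le_L2 f)
    refine (intervalIntegral.norm_integral_le_integral_norm x.2.1).trans ?_
    rw [intervalIntegral.integral_of_le x.2.1]
    exact setIntegral_mono_set (integrable_L2 f).norm (Eventually.of_forall fun _ => norm_nonneg _)
      (Ioc_subset_Ioc_right x.2.2).eventuallyLE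

theorem primL_apply (f : L2) (x : unitInterval) : primL f x = ∫ y in (0 : ℝ)..x, f y := rfl

theorem isPrim_primL (f : L2) : IsPrim (ext (primL f)) f :=
  ⟨intervalIntegrable_L2 f, fun x hx => by
    rw [ext_apply _ hx, ext_apply _ (x := 0) (by simp), primL_apply, primL_apply]; simp⟩

/-- The mean value of square integrable functions. -/
noncomputable def meanL : L2 →L[ℝ] ℝ :=
  (ContinuousMap.evalCLM ℝ (1 : unitInterval)).comp primL

theorem meanL_apply (f : L2) : meanL f = ∫ x, f x ∂μ := by
  change ∫ y in (0 : ℝ)..(1 : unitInterval), f y = _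
  rw [Icc.coe_one, intervalIntegral.integral_of_le zero_le_one]

/-- The inclusion `C([0,1]) → L²`. -/
noncomputable def toL2 : C(unitInterval, ℝ) →L[ℝ] L2 :=
  LinearMap.mkContinuous
    { toFun := fun f => (memLp_of_continuousOn (ext_continuous f).continuousOn).toLp (ext f)
      map_add' := fun _ _ => rfl
      map_smul' := fun _ _ => rfl } 1 fun f => by
    refine (Lp.norm_le_of_ae_bound (C := ‖f‖) (norm_nonneg _) ?_).trans
      (by simp [measureUnivNNReal])
    filter_upwards [(memLp_of_continuousOn (ext_continuous f).continuousOn).coeFn_toLp] with x hx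
    refine le_trans (le_of_eq ?_) (norm_ext_le f x)
    exact congrArg _ hx

theorem coeFn_toL2 (f : C(unitInterval, ℝ)) : toL2 f =ᵐ[μ] ext f :=
  (memLp_of_continuousOn (ext_continuous f).continuousOn).coeFn_toLp

/-- The coordinate function `x` on `[0,1]`. -/
noncomputable def coord : C(unitInterval, ℝ) := ⟨fun x => x, continuous_subtype_val⟩

/-- The mean-zero antiderivative of the mean-zero part, as a continuous function. -/
noncomputable def antiC : L2 →L[ℝ] C(unitInterval, ℝ) :=
  let p := primL - meanL.smulRight coord
  p - ((intC ℝ).comp p).smulRight 1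

theorem prim0_eq (f : L2) {x : ℝ} (hx : x ∈ Icc (0 : ℝ) 1) :
    prim0 f x = ext (primL f - meanL f • coord) x := by
  rw [ext_apply _ hx, prim0, intervalIntegral.integral_sub (intervalIntegrable_L2' f ⟨x, hx⟩)
    intervalIntegrable_const, ContinuousMap.sub_apply, primL_apply, meanL_apply,
    ContinuousMap.smul_apply]
  simp [coord, mul_comm]

theorem ext_antiC (f : L2) {x : ℝ} (hx : x ∈ Icc (0 : ℝ) 1) :
    ext (antiC f) x = prim0 f x - ∫ y, prim0 f y ∂μ := by
  have h : ∫ y, prim0 f y ∂μ = intC ℝ (primL f - meanL f • coord) := by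
    rw [intC_apply]
    refine integral_congr_ae ?_
    filter_upwards [ae_mem_Icc] with y hy using prim0_eq f hy
  rw [prim0_eq f hx, h, ext_apply _ hx, ext_apply _ hx]
  simp [antiC]

theorem antiL2_eq (f : L2) : antiL2 f = toL2 (antiC f) := by
  refine Lp.ext ?_
  filter_upwards [(prim0_memLp f).coeFn_toLp, coeFn_toL2 (antiC f), ae_mem_Icc] with x h1 h2 hx
  rw [h2, ext_antiC f hx, ← h1]
  rfl

/-- The underlying function, as a bounded linear map `H^m → L²`. -/
noncomputable def fnL (m : ℕ) : H m →L[ℝ] L2 :=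
  (PiLp.proj 2 (fun _ : Fin (m + 1) => L2) 0).comp (Sob m).subtypeL

theorem fnL_apply {m : ℕ} (f : H m) : fnL m f = fn f := rfl

theorem mean_eq {m : ℕ} (f : H m) : mean f = meanL (fn f) := (meanL_apply _).symm

theorem const_eq_smul {m : ℕ} (a : ℝ) : (const a : H m) = a • const 1 := by
  refine H_ext ?_
  refine Lp.ext ?_
  have h : fn (a • const 1 : H m) = a • (const_memLp 1).toLp _ := rfl
  rw [h]
  filter_upwards [(const_memLp a).coeFn_toLp, (const_memLp 1).coeFn_toLp,
    Lp.coeFn_smul a ((const_memLp 1).toLp _ : L2)] with x h1 h2 h3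
  rw [h3, Pi.smul_apply, h2, smul_eq_mul, mul_one]
  exact h1

theorem coeFn_const {m : ℕ} (a : ℝ) : fn (const a : H m) =ᵐ[μ] fun _ => a :=
  (const_memLp a).coeFn_toLp

theorem mean_const {m : ℕ} (a : ℝ) : mean (const a : H m) = a := by
  rw [mean, integral_congr_ae (coeFn_const a)]
  simp

theorem mean_add {m : ℕ} (f g : H m) : mean (f + g) = mean f + mean g := by
  simp only [mean_eq, ← fnL_apply, map_add]

theorem mean_smul {m : ℕ} (a : ℝ) (f : H m) : mean (a • f) = a * mean f := by
  simp only [mean_eq, ← fnL_apply, map_smul, smul_eq_mul]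

theorem mean_dx {m : ℕ} (f : H (m + 1)) : mean (dx f) = 0 :=
  IsWeakDeriv.integral_eq_zero (f.2 0)

/-- The derivative, as a bounded linear map `H^{m+1} → H^m`. -/
noncomputable def dxL (m : ℕ) : H (m + 1) →L[ℝ] H m where
  toFun := dx
  map_add' _ _ := rfl
  map_smul' _ _ := rfl
  cont := Continuous.subtype_mk ((PiLp.continuous_toLp 2 _).comp
    (continuous_pi fun j => (PiLp.continuous_apply 2 _ j.succ).comp continuous_subtype_val)) _

theorem continuous_antiL2 : Continuous antiL2 := by
  simp only [funext antiL2_eq]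
  exact (toL2.comp antiC).continuous

/-- The mean-zero antiderivative, as a bounded linear map `H^m → H_0^{m+1}`. -/
noncomputable def antiL (m : ℕ) : H m →L[ℝ] H0 (m + 1) where
  toFun := anti
  map_add' f g := Subtype.ext (H_ext (by
    change antiL2 (fnL m (f + g)) = antiL2 (fn f) + antiL2 (fn g)
    simp only [antiL2_eq, map_add, fnL_apply]))
  map_smul' a f := Subtype.ext (H_ext (by
    change antiL2 (fnL m (a • f)) = a • antiL2 (fn f)
    simp only [antiL2_eq, map_smul, fnL_apply]))
  cont := by
    have h0 : Continuous fun v : H m => v - const (mean v) := by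
      have : (fun v : H m => v - const (mean v)) = fun v => v - (meanL (fnL m v)) • const 1 :=
        funext fun v => by rw [const_eq_smul, mean_eq]; rfl
      rw [this]
      exact continuous_id.sub ((meanL.comp (fnL m)).continuous.smul continuous_const)
    refine Continuous.subtype_mk (Continuous.subtype_mk ((PiLp.continuous_toLp 2 _).comp
      (continuous_pi fun j => ?_)) _) _
    refine Fin.cases ?_ (fun i => ?_) j
    · exact continuous_antiL2.comp (fnL m).continuous
    · exact (PiLp.continuous_apply 2 _ i).comp (continuous_subtype_val.comp h0)

theorem antiL_apply {m : ℕ} (f : H m) : antiL m f = anti f := rfl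

theorem dx_anti {m : ℕ} (v : H m) : dx (anti v).1 = v - const (mean v) := H_ext rfl

theorem anti_dx {m : ℕ} (f : H0 (m + 1)) : anti (dx f.1) = f := by
  refine Subtype.ext (H_ext ?_)
  refine eq_of_isWeakDeriv (g := fn (dx f.1)) ?_ (f.1.2 0) ?_
  · have h := ((anti (dx f.1)).1).2 0
    have e : fn (dx (anti (dx f.1)).1) = fn (dx f.1) := by
      rw [dx_anti, mean_dx, const_eq_smul, zero_smul, sub_zero]
    rw [← e]
    exact h
  · exact ((anti (dx f.1)).2 : mean _ = 0).trans (f.2 : mean _ = 0).symm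

theorem anti_const {m : ℕ} (a : ℝ) : anti (const a : H m) = 0 := by
  have h : dx (anti (const a : H m)).1 = 0 := by
    rw [dx_anti, mean_const, sub_self]
  rw [← anti_dx (anti (const a : H m)), h, ← antiL_apply, map_zero]

/-- The reflection, as a bounded linear map on `L²`. -/
noncomputable def reflL2L : L2 →L[ℝ] L2 :=
  (Lp.compMeasurePreservingₗᵢ ℝ (fun x : ℝ => 1 - x) mp_refl).toContinuousLinearMap

theorem reflL2L_apply (f : L2) : reflL2L f = reflL2 f := rfl

theorem coeFn_reflL2 (f : L2) : reflL2 f =ᵐ[μ] fun x => f (1 - x) :=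
  Lp.coeFn_compMeasurePreserving f mp_refl

/-- The reflection, as a bounded linear map on `H_0^m`. -/
noncomputable def reflL (m : ℕ) : H0 m →L[ℝ] H0 m where
  toFun := refl
  map_add' f g := Subtype.ext (H_ext (by
    change (-1 : ℝ) ^ 0 • reflL2L (fn f.1 + fn g.1) =
      (-1 : ℝ) ^ 0 • reflL2L (fn f.1) + (-1 : ℝ) ^ 0 • reflL2L (fn g.1)
    rw [map_add, smul_add]))
  map_smul' a f := Subtype.ext (H_ext (by
    change (-1 : ℝ) ^ 0 • reflL2L (a • fn f.1) = a • (-1 : ℝ) ^ 0 • reflL2L (fn f.1)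
    rw [map_smul, smul_comm]))
  cont := by
    refine Continuous.subtype_mk (Continuous.subtype_mk ((PiLp.continuous_toLp 2 _).comp
      (continuous_pi fun j => ?_)) _) _
    exact (reflL2L.continuous.comp ((PiLp.continuous_apply 2 _ j).comp
      (continuous_subtype_val.comp continuous_subtype_val))).const_smul ((-1 : ℝ) ^ (j : ℕ))

theorem fn_refl {m : ℕ} (f : H0 m) : fn (refl f).1 = reflL2 (fn f.1) := by
  change (-1 : ℝ) ^ 0 • reflL2 (fn f.1) = _
  simp

theorem fn_dx_refl {m : ℕ} (f : H0 (m + 1)) :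
    fn (dx (refl f).1) = -reflL2 (fn (dx f.1)) := by
  change (-1 : ℝ) ^ 1 • reflL2 (fn (dx f.1)) = _
  simp

theorem refl_refl {m : ℕ} (f : H0 m) : refl (refl f) = f := by
  refine Subtype.ext (H_ext ?_)
  rw [fn_refl, fn_refl]
  refine Lp.ext ?_
  filter_upwards [coeFn_reflL2 (reflL2 (fn f.1)),
    mp_refl.quasiMeasurePreserving.ae (coeFn_reflL2 (fn f.1))] with x h1 h2
  rw [h1, h2, sub_sub_cancel]


/-! ### The integral `∫ exp(2i ∂ₓ⁻¹ v) dx` and its argument -/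

/-- The map `g ↦ i g` from real to complex continuous functions. -/
noncomputable def imulL : C(unitInterval, ℝ) →L[ℝ] C(unitInterval, ℂ) :=
  ContinuousLinearMap.compLeftContinuous ℝ unitInterval (Complex.I • Complex.ofRealCLM)

theorem imulL_apply (g : C(unitInterval, ℝ)) (x : unitInterval) :
    imulL g x = Complex.I * (g x : ℂ) := rfl

/-- The map `g ↦ exp(i g)` from real to complex continuous functions. -/
noncomputable def expI (g : C(unitInterval, ℝ)) : C(unitInterval, ℂ) :=
  NormedSpace.exp (imulL g)

theorem expI_apply (g : C(unitInterval, ℝ)) (x : unitInterval) :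
    expI g x = Complex.exp (Complex.I * (g x : ℂ)) := by
  have h := NormedSpace.map_exp (ContinuousMap.evalAlgHom ℂ ℂ x)
    (ContinuousEvalConst.continuous_eval_const x) (imulL g)
  rw [Complex.exp_eq_exp_ℂ, ← imulL_apply]
  exact h

theorem ext_expI (g : C(unitInterval, ℝ)) (x : ℝ) :
    ext (expI g) x = Complex.exp (Complex.I * ((ext g x : ℝ) : ℂ)) := expI_apply g _

theorem analyticAt_expI (g : C(unitInterval, ℝ)) : AnalyticAt ℝ expI g :=
  (NormedSpace.exp_analytic (𝕂 := ℝ) (imulL g)).comp (imulL.analyticAt g)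

theorem hasFDerivAt_expI (g : C(unitInterval, ℝ)) :
    HasFDerivAt expI ((expI g • (1 : C(unitInterval, ℂ) →L[ℝ] C(unitInterval, ℂ))).comp imulL)
      g :=
  (hasFDerivAt_exp (𝕂 := ℝ) (x := imulL g)).comp g imulL.hasFDerivAt

/-- The antiderivative `∂ₓ⁻¹ v`, as a continuous function on `[0,1]`. -/
noncomputable def dinvC : L2 →L[ℝ] C(unitInterval, ℝ) := antiC + meanL.smulRight coord

theorem Dinv_ae {l : ℕ} (v : H l) : Dinv v =ᵐ[μ] ext (dinvC (fn v)) := by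
  filter_upwards [coeFn_toL2 (antiC (fn v)), ae_mem_Icc] with x h1 hx
  have h2 : fn (anti v).1 x = ext (antiC (fn v)) x := by
    rw [← h1]
    change antiL2 (fn v) x = _
    rw [antiL2_eq]
  rw [Dinv, h2, ext_apply _ hx, ext_apply _ hx, mean_eq]
  rfl

/-- `∫ exp(2i ∂ₓ⁻¹ f) dx` as a function on `L²`. -/
noncomputable def KL (f : L2) : ℂ := intC ℂ (expI (2 • dinvC f))

theorem K_eq {l : ℕ} (v : H l) : K v = KL (fn v) := by
  rw [KL, intC_apply, K]
  refine integral_congr_ae ?_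
  filter_upwards [Dinv_ae v] with x hx
  rw [ext_expI, hx]
  have : ext (2 • dinvC (fn v)) x = 2 * ext (dinvC (fn v)) x := nsmul_eq_mul 2 _
  rw [this]
  push_cast
  congr 1
  ring

theorem analyticAt_KL (f : L2) : AnalyticAt ℝ KL f := by
  have h1 : AnalyticAt ℝ (fun f : L2 => (2 • dinvC) f) f := (2 • dinvC).analyticAt f
  have h2 := (analyticAt_expI ((2 • dinvC) f)).comp h1
  exact (((intC ℂ).restrictScalars ℝ).analyticAt _).comp h2

/-- A real-valued local branch of `-arg KL`. -/
noncomputable def branch (f₀ f : L2) : ℝ := -(Complex.log (KL f / KL f₀)).im - (KL f₀).arg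

theorem analyticAt_branch {f₀ : L2} (h : KL f₀ ≠ 0) : AnalyticAt ℝ (branch f₀) f₀ := by
  have h1 : AnalyticAt ℝ (fun f => KL f / KL f₀) f₀ :=
    (analyticAt_KL f₀).div analyticAt_const h
  have h2 : AnalyticAt ℝ Complex.log (KL f₀ / KL f₀) := by
    rw [div_self h]
    exact (analyticAt_clog Complex.one_mem_slitPlane).restrictScalars
  have h3 : AnalyticAt ℝ (fun f => Complex.log (KL f / KL f₀)) f₀ :=
    AnalyticAt.comp (g := Complex.log) (f := fun f => KL f / KL f₀) h2 h1
  exact ((Complex.imCLM.analyticAt _).comp h3).neg.sub analyticAt_const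

theorem eventually_KL_ne_zero {f₀ : L2} (h : KL f₀ ≠ 0) : ∀ᶠ f in 𝓝 f₀, KL f ≠ 0 :=
  (analyticAt_KL f₀).continuousAt.eventually_ne h

/-- The angle `c_sg` is locally represented by the real-analytic function `branch`. -/
theorem coe_branch {f₀ f : L2} (h₀ : KL f₀ ≠ 0) (h : KL f ≠ 0) :
    (branch f₀ f : Real.Angle) = -((KL f).arg : Real.Angle) := by
  have h1 := Complex.arg_mul_coe_angle (div_ne_zero h h₀) h₀
  rw [div_mul_cancel₀ _ h₀] at h1
  rw [h1, branch, Complex.log_im, Real.Angle.coe_sub, Real.Angle.coe_neg]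
  abel

theorem csg_eq {l : ℕ} (v : H l) : csg v = -((KL (fn v)).arg : Real.Angle) := by
  rw [csg, K_eq]

/-! ### The two branches of the phase space -/

theorem integrable_cexp {g : ℝ → ℝ} (hg : AEStronglyMeasurable g μ) :
    Integrable (fun x => Complex.exp (Complex.I * (g x : ℂ))) μ := by
  refine Integrable.of_bound (C := 1) ?_ (Eventually.of_forall fun x => ?_)
  · exact Complex.continuous_exp.comp_aestronglyMeasurable
      ((Complex.continuous_ofReal.comp_aestronglyMeasurable hg).const_mul Complex.I)
  · rw [mul_comm, Complex.norm_exp_ofReal_mul_I]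

theorem integral_sin_add {g : ℝ → ℝ} (hg : AEStronglyMeasurable g μ) (θ : ℝ) :
    ∫ x, Real.sin (g x + θ) ∂μ =
      (Complex.exp (θ * Complex.I) * ∫ x, Complex.exp (Complex.I * (g x : ℂ)) ∂μ).im := by
  rw [← integral_const_mul]
  refine Eq.trans ?_ (Complex.imCLM.integral_comp_comm ((integrable_cexp hg).const_mul _))
  refine integral_congr_ae (Eventually.of_forall fun x => ?_)
  simp only
  rw [← Complex.exp_add, show (θ * Complex.I + Complex.I * (g x : ℂ) : ℂ)
    = ((g x + θ : ℝ) : ℂ) * Complex.I by push_cast; ring]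
  exact (Complex.exp_ofReal_mul_I_im _).symm

theorem integral_cos_add {g : ℝ → ℝ} (hg : AEStronglyMeasurable g μ) (θ : ℝ) :
    ∫ x, Real.cos (g x + θ) ∂μ =
      (Complex.exp (θ * Complex.I) * ∫ x, Complex.exp (Complex.I * (g x : ℂ)) ∂μ).re := by
  rw [← integral_const_mul]
  refine Eq.trans ?_ (Complex.reCLM.integral_comp_comm ((integrable_cexp hg).const_mul _))
  refine integral_congr_ae (Eventually.of_forall fun x => ?_)
  simp only
  rw [← Complex.exp_add, show (θ * Complex.I + Complex.I * (g x : ℂ) : ℂ)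
    = ((g x + θ : ℝ) : ℂ) * Complex.I by push_cast; ring]
  exact (Complex.exp_ofReal_mul_I_re _).symm

theorem coe_arg_exp_mul_I (θ : ℝ) : ((Complex.exp (θ * Complex.I)).arg : Real.Angle) = θ := by
  have h := Complex.arg_cos_add_sin_mul_I_coe_angle (θ : Real.Angle)
  rw [Real.Angle.cos_coe, Real.Angle.sin_coe] at h
  rwa [Complex.exp_mul_I, ← Complex.ofReal_cos, ← Complex.ofReal_sin]

/-- The number `exp(iθ) z` is positive exactly when `θ` is minus the argument of `z`. -/
theorem exp_mul_pos_iff (z : ℂ) (θ : ℝ) :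
    ((Complex.exp (θ * Complex.I) * z).im = 0 ∧ 0 < (Complex.exp (θ * Complex.I) * z).re) ↔
      z ≠ 0 ∧ (θ : Real.Angle) = -(z.arg : Real.Angle) := by
  set w := Complex.exp (θ * Complex.I) * z with hw
  have harg : z ≠ 0 → (w.arg : Real.Angle) = θ + z.arg := fun hz => by
    rw [hw, Complex.arg_mul_coe_angle (Complex.exp_ne_zero _) hz, coe_arg_exp_mul_I]
  constructor
  · rintro ⟨h1, h2⟩
    have hz : z ≠ 0 := by rintro rfl; simp [hw] at h2
    refine ⟨hz, ?_⟩
    have h0 : w.arg = 0 := Complex.arg_eq_zero_iff.2 ⟨h2.le, h1⟩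
    rw [eq_neg_iff_add_eq_zero, ← harg hz, h0, Real.Angle.coe_zero]
  · rintro ⟨hz, h⟩
    have h0 : w.arg = 0 := by
      rw [← Complex.arg_coe_angle_toReal_eq_arg, harg hz, h, neg_add_cancel,
        Real.Angle.toReal_zero]
    obtain ⟨h1, h2⟩ := Complex.arg_eq_zero_iff.1 h0
    refine ⟨h2, lt_of_le_of_ne h1 fun h3 => ?_⟩
    exact mul_ne_zero (Complex.exp_ne_zero _) hz (Complex.ext h3.symm h2)

theorem aestronglyMeasurable_Dinv {l : ℕ} (v : H l) : AEStronglyMeasurable (Dinv v) μ :=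
  (ext_continuous (dinvC (fn v))).aestronglyMeasurable.congr (Dinv_ae v).symm

theorem integral_cexp_Dinv {l : ℕ} (v : H l) :
    ∫ x, Complex.exp (Complex.I * ((2 * Dinv v x : ℝ) : ℂ)) ∂μ = K v := by
  rw [K]
  congr 1
  ext x
  push_cast
  congr 1
  ring

/-- A real number representing the angle `c_sg(v)`. -/
noncomputable def csgRep {l : ℕ} (v : H l) : ℝ := -(K v).arg

theorem coe_csgRep {l : ℕ} (v : H l) : (csgRep v : Real.Angle) = csg v := Real.Angle.coe_neg _

theorem wave_eq {l : ℕ} (v : H l) (x : ℝ) :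
    wave v x = ((2 * Dinv v x + csgRep v : ℝ) : Real.Angle) := by
  rw [wave, ← coe_csgRep, ← Real.Angle.coe_add]

theorem exp_csgRep_mul_K {l : ℕ} (v : H l) :
    Complex.exp (csgRep v * Complex.I) * K v = (‖K v‖ : ℂ) := by
  conv_lhs => rw [← Complex.norm_mul_exp_arg_mul_I (K v)]
  rw [mul_left_comm, ← Complex.exp_add, csgRep]
  simp

theorem integral_sin_wave {l : ℕ} (v : H l) : ∫ x, (wave v x).sin ∂μ = 0 := by
  simp only [wave_eq, Real.Angle.sin_coe]
  rw [integral_sin_add ((aestronglyMeasurable_Dinv v).const_mul 2), integral_cexp_Dinv,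
    exp_csgRep_mul_K, Complex.ofReal_im]

theorem integral_cos_wave {l : ℕ} (v : H l) : ∫ x, (wave v x).cos ∂μ = ‖K v‖ := by
  simp only [wave_eq, Real.Angle.cos_coe]
  rw [integral_cos_add ((aestronglyMeasurable_Dinv v).const_mul 2), integral_cexp_Dinv,
    exp_csgRep_mul_K, Complex.ofReal_re]

theorem eval_ae {k : ℤ} {l : ℕ} {v : H l} (hm : mean v = k * Real.pi) {u : Phase (l + 1)}
    (hu : u.1 = (2 : ℝ) • anti v) :
    eval k u =ᵐ[μ] fun x => ((2 * Dinv v x : ℝ) : Real.Angle) + u.2 := by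
  filter_upwards [Lp.coeFn_smul (2 : ℝ) (fn (anti v).1)] with x hx
  have h : fn u.1.1 x = 2 * fn (anti v).1 x := by
    rw [hu]
    exact hx
  rw [eval, h, Dinv, hm]
  congr 2
  ring

/-- `P₊` is the graph of `c_sg` over the set `K ≠ 0`. -/
theorem mem_Pplus_iff {k : ℤ} {l : ℕ} {v : H l} (hm : mean v = k * Real.pi) {u : Phase (l + 1)}
    (hu : u.1 = (2 : ℝ) • anti v) : u ∈ Pplus k (l + 1) ↔ K v ≠ 0 ∧ u.2 = csg v := by
  obtain ⟨θ, hθ⟩ : ∃ θ : ℝ, (θ : Real.Angle) = u.2 := ⟨u.2.toReal, u.2.coe_toReal⟩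
  have he := eval_ae hm hu
  have e1 : ∫ x, (eval k u x).sin ∂μ = (Complex.exp (θ * Complex.I) * K v).im := by
    rw [← integral_cexp_Dinv v,
      ← integral_sin_add ((aestronglyMeasurable_Dinv v).const_mul 2) θ]
    refine integral_congr_ae ?_
    filter_upwards [he] with x hx
    rw [hx, ← hθ, ← Real.Angle.coe_add, Real.Angle.sin_coe]
  have e2 : ∫ x, (eval k u x).cos ∂μ = (Complex.exp (θ * Complex.I) * K v).re := by
    rw [← integral_cexp_Dinv v,
      ← integral_cos_add ((aestronglyMeasurable_Dinv v).const_mul 2) θ]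
    refine integral_congr_ae ?_
    filter_upwards [he] with x hx
    rw [hx, ← hθ, ← Real.Angle.coe_add, Real.Angle.cos_coe]
  change (∫ x, (eval k u x).sin ∂μ = 0 ∧ 0 < ∫ x, (eval k u x).cos ∂μ) ↔ _
  rw [e1, e2, exp_mul_pos_iff, hθ, csg]

/-- The involution `u ↦ ŭ + π` between phase spaces of opposite charges. -/
noncomputable def flip {m : ℕ} (u : Phase m) : Phase m := (refl u.1, u.2 + (Real.pi : Real.Angle))

theorem flip_flip {m : ℕ} (u : Phase m) : flip (flip u) = u := by
  refine Prod.ext (refl_refl u.1) ?_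
  change u.2 + (Real.pi : Real.Angle) + (Real.pi : Real.Angle) = u.2
  rw [add_assoc, Real.Angle.coe_pi_add_coe_pi, add_zero]

theorem PsiMinus_eq {l : ℕ} (v : H l) : PsiMinus v = flip (PsiPlus v) := rfl

theorem eval_flip {k : ℤ} {m : ℕ} (u : Phase m) :
    eval (-k) (flip u) =ᵐ[μ] fun x => eval k u (1 - x) + (Real.pi : Real.Angle) := by
  filter_upwards [coeFn_reflL2 (fn u.1.1)] with x hx
  have h : fn (flip u).1.1 x = fn u.1.1 (1 - x) := by
    change fn (refl u.1).1 x = _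
    rw [fn_refl, hx]
  have h2 : (flip u).2 = u.2 + (Real.pi : Real.Angle) := rfl
  have h3 : ((2 * Real.pi * ((-k : ℤ) : ℝ) * x + fn u.1.1 (1 - x) : ℝ) : Real.Angle) =
      ((2 * Real.pi * k * (1 - x) + fn u.1.1 (1 - x) : ℝ) : Real.Angle) := by
    rw [Real.Angle.angle_eq_iff_two_pi_dvd_sub]
    exact ⟨-k, by push_cast; ring⟩
  rw [eval, eval, h, h2, h3, add_assoc]

theorem mem_Pminus_iff {k : ℤ} {m : ℕ} (u : Phase m) : u ∈ Pminus (-k) m ↔ flip u ∈ Pplus k m := by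
  have he : eval k (flip u) =ᵐ[μ] fun x => eval (-k) u (1 - x) + (Real.pi : Real.Angle) := by
    simpa using eval_flip (k := -k) u
  have hemb : MeasurableEmbedding (fun x : ℝ => 1 - x) :=
    (MeasurableEquiv.subLeft (1 : ℝ)).measurableEmbedding
  have e1 : ∫ x, (eval k (flip u) x).sin ∂μ = -∫ x, (eval (-k) u x).sin ∂μ := by
    rw [← mp_refl.integral_comp hemb, ← integral_neg]
    refine integral_congr_ae ?_
    filter_upwards [mp_refl.quasiMeasurePreserving.ae he] with x hx
    rw [hx, Real.Angle.sin_add_pi, sub_sub_cancel]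
  have e2 : ∫ x, (eval k (flip u) x).cos ∂μ = -∫ x, (eval (-k) u x).cos ∂μ := by
    rw [← mp_refl.integral_comp hemb, ← integral_neg]
    refine integral_congr_ae ?_
    filter_upwards [mp_refl.quasiMeasurePreserving.ae he] with x hx
    rw [hx, Real.Angle.cos_add_pi, sub_sub_cancel]
  change _ ↔ (∫ x, (eval k (flip u) x).sin ∂μ = 0 ∧ 0 < ∫ x, (eval k (flip u) x).cos ∂μ)
  rw [e1, e2, neg_eq_zero, neg_pos]
  exact Iff.rfl

/-! ### The parametrizations -/

/-- The inverse `u ↦ ½ uₓ` of the parametrizations, for the mean value `a`. -/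
noncomputable def halfDeriv {l : ℕ} (a : ℝ) (u : H0 (l + 1)) : H l :=
  const a + (1 / 2 : ℝ) • dx u.1

theorem mean_halfDeriv {l : ℕ} (a : ℝ) (u : H0 (l + 1)) : mean (halfDeriv a u) = a := by
  rw [halfDeriv, mean_add, mean_const, mean_smul, mean_dx, mul_zero, add_zero]

theorem anti_halfDeriv {l : ℕ} (a : ℝ) (u : H0 (l + 1)) :
    (2 : ℝ) • anti (halfDeriv a u) = u := by
  rw [halfDeriv, ← antiL_apply, map_add, map_smul, antiL_apply, antiL_apply, anti_const, anti_dx,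
    zero_add, smul_smul]
  norm_num

theorem halfDeriv_anti {l : ℕ} (v : H l) : halfDeriv (mean v) ((2 : ℝ) • anti v) = v := by
  have h : dx ((2 : ℝ) • anti v).1 = (2 : ℝ) • dx (anti v).1 := rfl
  rw [halfDeriv, h, smul_smul, dx_anti]
  norm_num

theorem halfDeriv_mem {k : ℤ} {l : ℕ} {u : Phase (l + 1)} (hu : u ∈ Pplus k (l + 1)) :
    halfDeriv (k * Real.pi) u.1 ∈ W k l ∧ PsiPlus (halfDeriv (k * Real.pi) u.1) = u := by
  have h := (mem_Pplus_iff (mean_halfDeriv _ _) (anti_halfDeriv _ u.1).symm).1 hu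
  exact ⟨⟨h.1, mean_halfDeriv _ _⟩, Prod.ext (anti_halfDeriv _ _) h.2.symm⟩

theorem bijOn_PsiPlus (k : ℤ) (l : ℕ) : BijOn PsiPlus (W k l) (Pplus k (l + 1)) := by
  refine ⟨fun v hv => (mem_Pplus_iff hv.2 rfl).2 ⟨hv.1, rfl⟩, fun v hv w hw h => ?_,
    fun u hu => ⟨_, halfDeriv_mem hu⟩⟩
  rw [← halfDeriv_anti v, ← halfDeriv_anti w, hv.2, hw.2]
  have h1 : (2 : ℝ) • anti v = (2 : ℝ) • anti w := congrArg Prod.fst h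
  rw [h1]

theorem mean_coe_H0 {m : ℕ} (w : H0 m) : mean (w : H m) = 0 := w.2

theorem analyticAt_add_coe {m : ℕ} (v : H m) (w : H0 m) :
    AnalyticAt ℝ (fun w : H0 m => fn (v + (w : H m))) w :=
  ((fnL m).analyticAt _).comp (analyticAt_const.add ((Sob0 m).subtypeL.analyticAt _))

theorem fn_add_zero {m : ℕ} (v : H m) : fn (v + ((0 : H0 m) : H m)) = fn v :=
  congrArg fn (add_zero v)

theorem eventually_mem_W {k : ℤ} {l : ℕ} {v : H l} (hv : v ∈ W k l) :
    ∀ᶠ w : H0 l in 𝓝 0, v + (w : H l) ∈ W k l := by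
  have h0 : KL (fn (v + ((0 : H0 l) : H l))) ≠ 0 := by
    rw [fn_add_zero, ← K_eq]
    exact hv.1
  filter_upwards [(analyticAt_add_coe v 0).continuousAt.eventually (eventually_KL_ne_zero h0)]
    with w hw
  exact ⟨by rwa [K_eq], by rw [mean_add, mean_coe_H0, add_zero, hv.2]⟩

theorem analyticIntoPhase_PsiPlus {k : ℤ} {l : ℕ} {v : H l} (hv : v ∈ W k l) :
    AnalyticIntoPhase PsiPlus v := by
  have h0 : KL (fn v) ≠ 0 := by
    rw [← K_eq]
    exact hv.1
  refine ⟨?_, fun w => branch (fn v) (fn (v + (w : H l))), ?_, ?_⟩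
  · exact (((2 : ℝ) • antiL l : H l →L[ℝ] H0 (l + 1)).analyticAt _).comp
      (analyticAt_const.add ((Sob0 l).subtypeL.analyticAt _))
  · exact (analyticAt_branch h0).comp_of_eq (analyticAt_add_coe v 0) (fn_add_zero v)
  · filter_upwards [eventually_mem_W hv] with w hw
    rw [coe_branch h0 (by rw [← K_eq]; exact hw.1), ← csg_eq]
    rfl

theorem analyticAt_halfDeriv {l : ℕ} (a : ℝ) (u : H0 (l + 1)) :
    AnalyticAt ℝ (halfDeriv (l := l) a) u :=
  analyticAt_const.add
    ((((1 / 2 : ℝ) • dxL l).comp (Sob0 (l + 1)).subtypeL).analyticAt u)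

theorem isAnalyticParam_PsiPlus (k : ℤ) (l : ℕ) :
    IsAnalyticParam (W k l) (Pplus k (l + 1)) (PsiPlus (l := l)) where
  isOpen_dom _ hv := eventually_mem_W hv
  bijOn := bijOn_PsiPlus k l
  analytic _ hv := analyticIntoPhase_PsiPlus hv
  analytic_inv _ _ := ⟨fun u => halfDeriv (k * Real.pi) u.1,
    fun _ _ => (analyticAt_halfDeriv _ _).comp analyticAt_fst,
    eventually_nhdsWithin_of_forall fun _ hu' => halfDeriv_mem hu'⟩

theorem bijOn_PsiMinus (k : ℤ) (l : ℕ) : BijOn PsiMinus (W k l) (Pminus (-k) (l + 1)) := by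
  refine ⟨fun v hv => ?_, fun v hv w hw h => (bijOn_PsiPlus k l).2.1 hv hw ?_, fun u hu => ?_⟩
  · rw [mem_Pminus_iff, PsiMinus_eq, flip_flip]
    exact (bijOn_PsiPlus k l).1 hv
  · rw [← flip_flip (PsiPlus v), ← PsiMinus_eq, h, PsiMinus_eq, flip_flip]
  · obtain ⟨v, hv, h⟩ := (bijOn_PsiPlus k l).2.2 ((mem_Pminus_iff u).1 hu)
    exact ⟨v, hv, by rw [PsiMinus_eq, h, flip_flip]⟩

theorem analyticIntoPhase_PsiMinus {k : ℤ} {l : ℕ} {v : H l} (hv : v ∈ W k l) :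
    AnalyticIntoPhase PsiMinus v := by
  obtain ⟨h1, c, hc, h2⟩ := analyticIntoPhase_PsiPlus hv
  refine ⟨?_, fun w => c w + Real.pi, hc.add analyticAt_const, ?_⟩
  · exact AnalyticAt.comp (g := reflL (l + 1)) ((reflL (l + 1)).analyticAt _) h1
  · filter_upwards [h2] with w hw
    rw [Real.Angle.coe_add, ← hw]
    rfl

theorem halfDeriv_refl_mem {k : ℤ} {l : ℕ} {u : Phase (l + 1)} (hu : u ∈ Pminus (-k) (l + 1)) :
    halfDeriv (k * Real.pi) (refl u.1) ∈ W k l ∧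
      PsiMinus (halfDeriv (k * Real.pi) (refl u.1)) = u := by
  have h := halfDeriv_mem ((mem_Pminus_iff u).1 hu)
  refine ⟨h.1, ?_⟩
  rw [PsiMinus_eq]
  exact (congrArg flip h.2).trans (flip_flip u)

theorem analyticAt_halfDeriv_refl {l : ℕ} (a : ℝ) (u : H0 (l + 1)) :
    AnalyticAt ℝ (fun u : H0 (l + 1) => halfDeriv (l := l) a (refl u)) u :=
  AnalyticAt.comp (g := halfDeriv (l := l) a) (f := reflL (l + 1)) (analyticAt_halfDeriv _ _)
    ((reflL (l + 1)).analyticAt _)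

theorem isAnalyticParam_PsiMinus (k : ℤ) (l : ℕ) :
    IsAnalyticParam (W k l) (Pminus (-k) (l + 1)) (PsiMinus (l := l)) where
  isOpen_dom _ hv := eventually_mem_W hv
  bijOn := bijOn_PsiMinus k l
  analytic _ hv := analyticIntoPhase_PsiMinus hv
  analytic_inv u _ := ⟨fun u => halfDeriv (k * Real.pi) (refl u.1),
    fun θ _ => AnalyticAt.comp (g := fun u : H0 (l + 1) => halfDeriv (k * Real.pi) (refl u))
      (f := fun p : H0 (l + 1) × ℝ => p.1) (x := (u.1, θ)) (analyticAt_halfDeriv_refl _ _)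
      analyticAt_fst,
    eventually_nhdsWithin_of_forall fun _ hu' => halfDeriv_refl_mem hu'⟩


/-! ### The sine-Gordon vector field -/

theorem isPrim_dinvC (f : L2) : IsPrim (ext (dinvC f)) f := by
  have h : ∀ x ∈ Icc (0 : ℝ) 1, ext (dinvC f) x =
      ext (primL f) x + -intC ℝ (primL f - meanL f • coord) := fun x hx => by
    rw [ext_apply _ hx, ext_apply _ hx]
    simp only [dinvC, antiC, add_apply, sub_apply,
      ContinuousLinearMap.smulRight_apply, ContinuousLinearMap.comp_apply, ContinuousMap.add_apply,
      ContinuousMap.sub_apply, ContinuousMap.smul_apply, ContinuousMap.one_apply, smul_eq_mul]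
    ring
  refine IsPrim.congr_left ?_ h
  simpa using (isPrim_primL f).add (IsPrim.const (-intC ℝ (primL f - meanL f • coord)))

theorem dinvC_one (f : L2) : ext (dinvC f) 1 = ext (dinvC f) 0 + meanL f := by
  rw [(isPrim_dinvC f).eq 1 (by simp), meanL_apply, intervalIntegral.integral_of_le zero_le_one]

/-- A continuous real-valued lift of `2 ∂ₓ⁻¹ v + c_sg(v)`. -/
noncomputable def lift {l : ℕ} (v : H l) (x : ℝ) : ℝ := 2 * ext (dinvC (fn v)) x + csgRep v

theorem wave_ae {l : ℕ} (v : H l) : wave v =ᵐ[μ] fun x => (lift v x : Real.Angle) := by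
  filter_upwards [Dinv_ae v] with x hx
  rw [wave_eq, hx, lift]

theorem field_ae {l : ℕ} (v : H l) : field v =ᵐ[μ] fun x => 1 / 2 * Real.sin (lift v x) := by
  filter_upwards [wave_ae v] with x hx
  rw [field, hx, Real.Angle.sin_coe]

theorem isPrim_lift {l : ℕ} (v : H l) : IsPrim (lift v) fun x => 2 * fn v x := by
  have h := ((isPrim_dinvC (fn v)).const_mul 2).add (IsPrim.const (csgRep v))
  simp only [add_zero] at h
  exact h

theorem lift_one {k : ℤ} {l : ℕ} {v : H l} (hm : mean v = k * Real.pi) :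
    lift v 1 = lift v 0 + k * (2 * Real.pi) := by
  rw [lift, lift, dinvC_one, ← mean_eq, hm]
  ring

theorem integral_field {l : ℕ} (v : H l) : ∫ x, field v x ∂μ = 0 := by
  simp only [field]
  rw [integral_const_mul, integral_sin_wave, mul_zero]

/-- The lift of the phase increases by `2πk` over the period, so its sine is in `H^{l+1}`. -/
theorem exists_field {k : ℤ} {l : ℕ} {v : H l} (hv : v ∈ W k l) :
    ∃ X : H0 (l + 1), fn X.1 =ᵐ[μ] field v := by
  have h1 := lift_one hv.2
  have hp : MemH l fun x => 2 * fn v x := MemH.const_mul 2 ⟨v, ae_eq_rfl⟩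
  obtain ⟨X, hX⟩ := ((memH_sin_cos (isPrim_lift v) hp
    (by rw [h1, Real.sin_add_int_mul_two_pi])
    (by rw [h1, Real.cos_add_int_mul_two_pi])).1.const_mul (1 / 2)).congr (field_ae v).symm
  refine ⟨⟨X, ?_⟩, hX⟩
  change ∫ x, fn X x ∂μ = 0
  rw [integral_congr_ae hX, integral_field]

/-! ### Transformation of the sine-Gordon equation -/

theorem contDiffWithinAt_branch {l : ℕ} {I : Set ℝ} {v : ℝ → H l} {t : ℝ}
    (hv : ContDiffWithinAt ℝ 1 v I t) (h : K (v t) ≠ 0) :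
    ContDiffWithinAt ℝ 1 (fun s => branch (fn (v t)) (fn (v s))) I t := by
  rw [K_eq] at h
  have h1 : ContDiffWithinAt ℝ 1 (fun s => fnL l (v s)) I t :=
    (fnL l).contDiff.contDiffAt.comp_contDiffWithinAt t hv
  exact (analyticAt_branch h).contDiffAt.comp_contDiffWithinAt t h1

theorem contDiff_halfDeriv {l : ℕ} (a : ℝ) : ContDiff ℝ 1 (halfDeriv (l := l) a) := by
  have h : ContDiff ℝ 1 (((1 / 2 : ℝ) • dxL l).comp (Sob0 (l + 1)).subtypeL) :=
    ContinuousLinearMap.contDiff _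
  exact contDiff_const.add h

/-- The function `uₓ` of `u = Ψ⁺(v)` is `2v`, so both equations say the same, and `v ↦ Ψ⁺(v)`,
`u ↦ ½ uₓ` preserve `C¹` curves. -/
theorem isSolSG_PsiPlus_iff {k : ℤ} {l : ℕ} {I : Set ℝ} {v : ℝ → H l}
    (hv : ∀ t ∈ I, v t ∈ W k l) :
    IsSolSG k I (fun t => PsiPlus (v t)) ↔ IsSolV k I v := by
  have hU : ∀ t ∈ I, const (2 * Real.pi * k) + dx (PsiPlus (v t)).1.1 = (2 : ℝ) • v t := by
    intro t ht
    have h1 : dx (PsiPlus (v t)).1.1 = (2 : ℝ) • dx (anti (v t)).1 := rfl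
    rw [h1, dx_anti, (hv t ht).2, const_eq_smul, const_eq_smul (k * Real.pi)]
    module
  have hd : ∀ t ∈ I, (fn (derivWithin (fun s => const (2 * Real.pi * k) + dx (PsiPlus (v s)).1.1)
      I t) =ᵐ[μ] fun x => (eval k (PsiPlus (v t)) x).sin) ↔
      fn (derivWithin v I t) =ᵐ[μ] field (v t) := by
    intro t ht
    have e1 : derivWithin (fun s => const (2 * Real.pi * k) + dx (PsiPlus (v s)).1.1) I t
        = (2 : ℝ) • derivWithin v I t := by
      rw [derivWithin_congr hU (hU t ht)]
      exact derivWithin_const_smul_field (2 : ℝ) v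
    have e2 : eval k (PsiPlus (v t)) =ᵐ[μ] wave (v t) := eval_ae (hv t ht).2 rfl
    have e3 : fn ((2 : ℝ) • derivWithin v I t) =ᵐ[μ] fun x => 2 * fn (derivWithin v I t) x :=
      Lp.coeFn_smul (2 : ℝ) (fn (derivWithin v I t))
    rw [e1]
    constructor <;> intro h
    · filter_upwards [h, e2, e3] with x h1 h2 h3
      rw [field, ← h2, ← h1, h3]
      ring
    · filter_upwards [h, e2, e3] with x h1 h2 h3
      rw [h2, h3, h1, field]
      ring
  constructor
  · rintro ⟨⟨h1, -⟩, h3⟩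
    refine ⟨?_, fun t ht => ⟨hv t ht, (hd t ht).1 (h3 t ht)⟩⟩
    refine ((contDiff_halfDeriv (k * Real.pi)).comp_contDiffOn h1).congr fun t ht => ?_
    rw [← (hv t ht).2]
    exact (halfDeriv_anti (v t)).symm
  · rintro ⟨h1, h3⟩
    refine ⟨⟨?_, fun t ht => ⟨_, contDiffWithinAt_branch (h1 t ht) (hv t ht).1, ?_⟩⟩,
      fun t ht => (hd t ht).2 (h3 t ht).2⟩
    · have h : ContDiff ℝ 1 ((2 : ℝ) • antiL l : H l →L[ℝ] H0 (l + 1)) :=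
        ContinuousLinearMap.contDiff _
      exact h.comp_contDiffOn h1
    · filter_upwards [self_mem_nhdsWithin] with s hs
      have ht0 := (hv t ht).1
      have hs0 := (hv s hs).1
      rw [K_eq] at ht0 hs0
      rw [coe_branch ht0 hs0, ← csg_eq]
      rfl

theorem reflL2_const {m : ℕ} (a : ℝ) : reflL2 (fn (const a : H m)) = fn (const a : H m) := by
  refine Lp.ext ?_
  filter_upwards [coeFn_reflL2 (fn (const a : H m)), coeFn_const (m := m) a,
    mp_refl.quasiMeasurePreserving.ae (coeFn_const (m := m) a)] with x h1 h2 h3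
  rw [h1, h2, h3]

theorem fn_const_add_dx_flip {m : ℕ} (k : ℤ) (u : Phase (m + 1)) :
    fn (const (2 * Real.pi * (-k : ℤ)) + dx (flip u).1.1) =
      -reflL2 (fn (const (2 * Real.pi * k) + dx u.1.1)) := by
  have h1 : fn (const (2 * Real.pi * (-k : ℤ)) + dx (flip u).1.1) =
    fn (const (2 * Real.pi * (-k : ℤ)) : H m) + fn (dx (refl u.1).1) := rfl
  have h2 : fn (const (2 * Real.pi * k) + dx u.1.1) =
    fn (const (2 * Real.pi * k) : H m) + fn (dx u.1.1) := rfl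
  have h3 : (const (2 * Real.pi * (-k : ℤ)) : H m) = -const (2 * Real.pi * k) := by
    rw [const_eq_smul, const_eq_smul (2 * Real.pi * k), ← neg_smul]
    push_cast
    congr 1
    ring
  rw [h1, h2, h3, fn_dx_refl, ← reflL2L_apply, ← reflL2L_apply, map_add, reflL2L_apply,
    reflL2L_apply, reflL2_const, neg_add, ← fnL_apply, map_neg, fnL_apply]

/-- The equation `uₓₜ = sin u` is preserved, as the reflection changes the sign of the left side
and the shift by `π` that of the right side. -/
theorem IsSolSG.flip {k : ℤ} {m : ℕ} {I : Set ℝ} {u : ℝ → Phase (m + 1)} (hI : Convex ℝ I)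
    (hne : (interior I).Nonempty) (h : IsSolSG k I u) :
    IsSolSG (-k) I fun t => SineGordon.flip (u t) := by
  obtain ⟨⟨h1, h2⟩, h3⟩ := h
  have h1' : ContDiffOn ℝ 1 (fun t => (SineGordon.flip (u t)).1) I :=
    (reflL (m + 1)).contDiff.comp_contDiffOn h1
  refine ⟨⟨h1', fun t ht => ?_⟩, fun t ht => ?_⟩
  · obtain ⟨c, hc, hc'⟩ := h2 t ht
    refine ⟨fun t => c t + Real.pi, hc.add contDiffWithinAt_const, ?_⟩
    filter_upwards [hc'] with s hs
    rw [Real.Angle.coe_add, ← hs]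
    rfl
  · have hu : UniqueDiffWithinAt ℝ I t := uniqueDiffOn_convex hI hne t ht
    have key : ∀ (a : ℝ) (w : ℝ → H0 (m + 1)), ContDiffOn ℝ 1 w I →
        HasDerivWithinAt (fun s => fn (const a + dx (w s).1 : H m))
          (fn (derivWithin (fun s => const a + dx (w s).1) I t)) I t := by
      intro a w hw
      have hd : DifferentiableWithinAt ℝ (fun s => const a + dx (w s).1 : ℝ → H m) I t := by
        have e := (((dxL m).comp (Sob0 (m + 1)).subtypeL).contDiff.comp_contDiffOn
          hw).differentiableOn one_ne_zero t ht
        exact (differentiableWithinAt_const (const a : H m)).add e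
      exact (fnL m).hasFDerivAt.comp_hasDerivWithinAt t hd.hasDerivWithinAt
    have k1 := reflL2L.hasFDerivAt.comp_hasDerivWithinAt t (key (2 * Real.pi * k) _ h1)
    have k2 := key (2 * Real.pi * (-k : ℤ)) _ h1'
    have e1 : fn (derivWithin (fun s => const (2 * Real.pi * (-k : ℤ)) +
        dx (SineGordon.flip (u s)).1.1) I t) =
        -reflL2 (fn (derivWithin (fun s => const (2 * Real.pi * k) + dx (u s).1.1) I t)) := by
      refine (hu.eq_deriv _ k2 ?_)
      exact (HasDerivWithinAt.neg k1).congr (fun s _ => fn_const_add_dx_flip k (u s))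
        (fn_const_add_dx_flip k (u t))
    rw [e1]
    filter_upwards [Lp.coeFn_neg (reflL2 (fn (derivWithin
      (fun s => const (2 * Real.pi * k) + dx (u s).1.1) I t))), coeFn_reflL2 (fn (derivWithin
      (fun s => const (2 * Real.pi * k) + dx (u s).1.1) I t)),
      mp_refl.quasiMeasurePreserving.ae (h3 t ht), eval_flip (k := k) (u t)] with x g1 g2 g3 g4
    rw [g1, Pi.neg_apply, g2, g3, g4, Real.Angle.sin_add_pi]

theorem isSolSG_PsiMinus_iff {k : ℤ} {l : ℕ} {I : Set ℝ} {v : ℝ → H l} (hI : Convex ℝ I)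
    (hne : (interior I).Nonempty) (hv : ∀ t ∈ I, v t ∈ W k l) :
    IsSolSG (-k) I (fun t => PsiMinus (v t)) ↔ IsSolV k I v := by
  rw [← isSolSG_PsiPlus_iff hv]
  have e : (fun t => PsiMinus (v t)) = fun t => flip (PsiPlus (v t)) := rfl
  rw [e]
  refine ⟨fun h => ?_, fun h => h.flip hI hne⟩
  have h' := h.flip hI hne
  simp only [flip_flip, neg_neg] at h'
  exact h'

/-! ### The Hamiltonian and its gradient -/

theorem Hsg_eq {l : ℕ} (v : H l) : Hsg v = 1 / 4 * ‖KL (fn v)‖ := by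
  rw [Hsg, integral_cos_wave, K_eq]

theorem hasFDerivAt_KL (f : L2) : HasFDerivAt KL
    (((intC ℂ).restrictScalars ℝ).comp
      (((expI (2 • dinvC f) • (1 : C(unitInterval, ℂ) →L[ℝ] C(unitInterval, ℂ))).comp imulL).comp
        (2 • dinvC))) f := by
  have h1 : HasFDerivAt (fun f : L2 => (2 • dinvC) f) (2 • dinvC : L2 →L[ℝ] _) f :=
    (2 • dinvC).hasFDerivAt
  have h2 := (hasFDerivAt_expI ((2 • dinvC) f)).comp f h1
  exact ((intC ℂ).restrictScalars ℝ).hasFDerivAt.comp f h2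

theorem fderiv_KL_apply (f h : L2) : fderiv ℝ KL f h =
    ∫ x, Complex.exp (2 * Complex.I * (ext (dinvC f) x : ℝ)) *
      (2 * Complex.I * (ext (dinvC h) x : ℝ)) ∂μ := by
  rw [(hasFDerivAt_KL f).fderiv]
  simp only [ContinuousLinearMap.comp_apply, ContinuousLinearMap.coe_restrictScalars',
    smul_apply, one_apply_eq_self, smul_eq_mul]
  rw [intC_apply]
  refine integral_congr_ae ?_
  filter_upwards [ae_mem_Icc] with x hx
  simp only [ext_apply _ hx]
  rw [ContinuousMap.mul_apply, expI_apply, imulL_apply, ContinuousMap.smul_apply,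
    ContinuousMap.smul_apply, nsmul_eq_mul, nsmul_eq_mul]
  push_cast
  rw [show Complex.I * (2 * ((dinvC f) ⟨x, hx⟩ : ℂ)) = 2 * Complex.I * ((dinvC f) ⟨x, hx⟩ : ℂ) by
    ring]
  ring

/-- The derivative of `|KL|`: since `|KL| ≥ Re (exp(iθ) KL)` with equality at `v` for `θ = c_sg(v)`,
both sides have the same derivative at `v`. -/
theorem fderiv_norm_KL {l : ℕ} {v : H l} (hv : K v ≠ 0) (h : L2) :
    fderiv ℝ (fun f => ‖KL f‖) (fn v) h =
      (Complex.exp (csgRep v * Complex.I) * fderiv ℝ KL (fn v) h).re := by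
  have hv' := hv
  rw [K_eq] at hv'
  have hK := (hasFDerivAt_KL (fn v)).differentiableAt
  have hn : DifferentiableAt ℝ (fun f => ‖KL f‖) (fn v) := hK.norm ℝ hv'
  set z := Complex.exp (csgRep v * Complex.I) with hz
  have hr : HasFDerivAt (fun f => (z * KL f).re)
      (Complex.reCLM.comp (z • fderiv ℝ KL (fn v))) (fn v) :=
    Complex.reCLM.hasFDerivAt.comp (fn v) (hK.hasFDerivAt.const_mul z)
  have hmin : IsLocalMin (fun f => ‖KL f‖ - (z * KL f).re) (fn v) := by
    refine Eventually.of_forall fun f => ?_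
    have e : (z * KL (fn v)).re = ‖KL (fn v)‖ := by
      rw [← K_eq, hz, exp_csgRep_mul_K, Complex.ofReal_re]
    have e2 : (z * KL f).re ≤ ‖KL f‖ := by
      refine (Complex.re_le_norm _).trans ?_
      rw [norm_mul, hz, Complex.norm_exp_ofReal_mul_I, one_mul]
    simp only [e, sub_self]
    linarith
  have h0 := hmin.hasFDerivAt_eq_zero (hn.hasFDerivAt.sub hr)
  rw [sub_eq_zero.1 h0]
  rfl

theorem fderiv_norm_KL_apply {l : ℕ} {v : H l} (hv : K v ≠ 0) (h : L2) :
    fderiv ℝ (fun f => ‖KL f‖) (fn v) h =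
      ∫ x, -2 * Real.sin (lift v x) * ext (dinvC h) x ∂μ := by
  rw [fderiv_norm_KL hv, fderiv_KL_apply, ← integral_const_mul]
  refine Eq.trans (Complex.reCLM.integral_comp_comm ?_).symm ?_
  · refine Continuous.integrableOn_Ioc ?_
    have h1 := ext_continuous (dinvC (fn v))
    have h2 := ext_continuous (dinvC h)
    fun_prop
  · refine integral_congr_ae (Eventually.of_forall fun x => ?_)
    simp only
    rw [← mul_assoc, ← Complex.exp_add, show (csgRep v * Complex.I +
      2 * Complex.I * (ext (dinvC (fn v)) x : ℝ) : ℂ) = (lift v x : ℝ) * Complex.I by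
        rw [lift]; push_cast; ring, Complex.reCLM_apply, Complex.exp_mul_I,
        ← Complex.ofReal_cos, ← Complex.ofReal_sin]
    simp [Complex.sin_ofReal_re]
    ring

theorem contDiffAt_norm_KL {f : L2} (hf : KL f ≠ 0) : ContDiffAt ℝ 1 (fun f => ‖KL f‖) f :=
  (analyticAt_KL f).contDiffAt.norm ℝ hf

theorem contDiffAt_Hsg {l : ℕ} {v : H l} (hv : K v ≠ 0) :
    ContDiffAt ℝ 1 (fun w : H0 l => Hsg (v + (w : H l))) 0 := by
  simp only [Hsg_eq]
  rw [K_eq, ← fn_add_zero v] at hv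
  exact contDiffAt_const.mul
    (ContDiffAt.comp (g := fun f => ‖KL f‖) (f := fun w : H0 l => fn (v + (w : H l))) 0
      (contDiffAt_norm_KL hv) (analyticAt_add_coe v 0).contDiffAt)

/-- The `L²`-gradient of the Hamiltonian is an antiderivative of the vector field. -/
theorem exists_isL2Gradient_Hsg {k : ℤ} {l : ℕ} {v : H l} (hv : v ∈ W k l) :
    ∃ g : H 1, IsL2Gradient Hsg v g ∧ fn (dx g) =ᵐ[μ] field v := by
  obtain ⟨X, hX⟩ := exists_field hv
  obtain ⟨Y, hY⟩ : MemH 0 (field v) := MemH.of_le (Nat.zero_le (l + 1)) ⟨X.1, hX⟩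
  have hYm : mean Y = 0 := by rw [mean, integral_congr_ae hY, integral_field]
  have hg : fn (dx (anti Y).1) =ᵐ[μ] field v := by
    rw [dx_anti, hYm, const_eq_smul, zero_smul, sub_zero]
    exact hY
  refine ⟨(anti Y).1, ?_, hg⟩
  obtain ⟨G, hG, hGp, hG01⟩ := ((anti Y).1.2 0).exists_isPrim
  have hGp' : IsPrim G (field v) := hGp.congr_right hg
  refine ⟨(1 / 4 : ℝ) • ((fderiv ℝ (fun f => ‖KL f‖) (fn v)).comp
    ((fnL l).comp (Sob0 l).subtypeL)), fun h => ?_, ?_⟩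
  · have e1 : ((1 / 4 : ℝ) • ((fderiv ℝ (fun f => ‖KL f‖) (fn v)).comp
        ((fnL l).comp (Sob0 l).subtypeL))) h =
        1 / 4 * fderiv ℝ (fun f => ‖KL f‖) (fn v) (fn h.1) := rfl
    have hm : meanL (fn h.1) = 0 := (mean_eq h.1).symm.trans h.2
    have e2 := hGp'.integral_mul_eq_neg (isPrim_dinvC (fn h.1))
      (by rw [hG01, dinvC_one, hm, add_zero])
    rw [e1, fderiv_norm_KL_apply hv.1]
    have e3 : ∫ x, fn (anti Y).1 x * fn h.1 x ∂μ = ∫ x, G x * fn h.1 x ∂μ :=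
      integral_congr_ae (hG.mono fun x hx => by simp only; rw [← hx]; rfl)
    rw [e3, e2, ← integral_const_mul, ← integral_neg]
    refine integral_congr_ae ?_
    filter_upwards [field_ae v] with x hx
    rw [hx]
    ring
  · have hv0 := hv.1
    rw [K_eq] at hv0
    have h1 : HasFDerivAt (fun w : H0 l => fn (v + (w : H l)))
        ((fnL l).comp (Sob0 l).subtypeL) 0 :=
      (fnL l).hasFDerivAt.comp 0 ((Sob0 l).subtypeL.hasFDerivAt.const_add v)
    have h2 : HasFDerivAt (fun f => ‖KL f‖) (fderiv ℝ (fun f => ‖KL f‖) (fn v))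
        (fn (v + ((0 : H0 l) : H l))) := by
      rw [fn_add_zero]
      exact ((contDiffAt_norm_KL hv0).differentiableAt one_ne_zero).hasFDerivAt
    have h3 := (HasFDerivAt.comp (g := fun f => ‖KL f‖) (0 : H0 l) h2 h1).const_mul (1 / 4)
    refine h3.congr_of_eventuallyEq (Eventually.of_forall fun w => ?_)
    exact Hsg_eq _

theorem isHamiltonianFor_Hsg (k : ℤ) (l : ℕ) : IsHamiltonianFor (W k l) Hsg field := by
  intro v hv
  obtain ⟨g, hg, hgX⟩ := exists_isL2Gradient_Hsg hv
  refine ⟨contDiffAt_Hsg hv.1, g, hg, hgX, fun F gF hF Y hY => ?_⟩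
  obtain ⟨L, hL, hLd⟩ := hF
  rw [hLd.fderiv, hL, gardner]
  refine integral_congr_ae ?_
  filter_upwards [hY, hgX] with x h1 h2
  rw [h1, h2]

/-- The vector field `∂ₓ ∂F` does not depend on the choice of the gradient. -/
theorem IsL2Gradient.fn_dx_eq {l : ℕ} {F : H l → ℝ} {v : H l} {g g' : H 1}
    (h : IsL2Gradient F v g) (h' : IsL2Gradient F v g') : fn (dx g) = fn (dx g') := by
  obtain ⟨L, hL, hd⟩ := h
  obtain ⟨L', hL', hd'⟩ := h'
  have hLL : L = L' := hd.unique hd'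
  have hw : IsWeakDeriv (fn g) (fn (dx g)) := g.2 0
  have hw' : IsWeakDeriv (fn g') (fn (dx g')) := g'.2 0
  refine sub_eq_zero.1 (eq_zero_of_forall_integral_mul_eq_zero fun φ hφ hp => ?_)
  rw [integral_sub_mul _ _ hφ.continuous, sub_eq_zero, ← neg_inj, ← hw φ hφ hp, ← hw' φ hφ hp]
  have hpd : Function.Periodic (deriv φ) 1 := fun x => by
    rw [← deriv_comp_add_const]
    congr 1
    exact funext hp
  obtain ⟨Y, hY⟩ := memH_of_contDiff (contDiff_infty_iff_deriv.1 hφ).2 hpd l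
  have hm : mean Y = 0 := by
    rw [mean, integral_congr_ae hY, ← intervalIntegral.integral_of_le zero_le_one,
      intervalIntegral.integral_deriv_eq_sub (fun x _ => hφ.differentiable (by simp) x)
        ((hφ.continuous_deriv (by simp)).intervalIntegrable _ _)]
    simpa [sub_eq_zero] using hp 0
  have e1 := hL ⟨Y, hm⟩
  rw [hLL, hL' ⟨Y, hm⟩] at e1
  have e2 : ∀ f : L2, ∫ x, f x * deriv φ x ∂μ = ∫ x, f x * fn Y x ∂μ := fun f =>
    integral_congr_ae (hY.mono fun x hx => by simp only; rw [hx])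
  rw [e2, e2]
  exact e1.symm


/-! ### Volterra systems -/

/-- The factor `1 - a` of the unit `1 - a ^ n` is a unit. -/
theorem isUnit_one_sub_of_norm_pow_lt_one {R : Type*} [NormedRing R] [HasSummableGeomSeries R]
    {a : R} {n : ℕ} (h : ‖a ^ n‖ < 1) : IsUnit (1 - a) := by
  have h1 : IsUnit (1 - a ^ n) := isUnit_one_sub_of_norm_lt_one h
  rw [← mul_neg_geom_sum] at h1
  refine ((Commute.isUnit_mul_iff ?_).1 h1).1
  rw [Commute, SemiconjBy, mul_neg_geom_sum, geom_sum_mul_neg]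

theorem hasFDerivAt_inverse_one_sub {C X : Type*} [NormedAddCommGroup C] [NormedSpace ℂ C]
    [NormedAddCommGroup X] [NormedSpace ℂ X] [CompleteSpace X] (N : C →L[ℂ] X →L[ℂ] X) {c : C}
    (hc : IsUnit (1 - N c)) (y : X) :
    HasFDerivAt (fun c => Ring.inverse (1 - N c) y)
      ((Ring.inverse (1 - N c)).comp (N.flip (Ring.inverse (1 - N c) y))) c := by
  have h1 : HasFDerivAt (fun c => 1 - N c) (-N) c := N.hasFDerivAt.const_sub 1
  obtain ⟨u, hu⟩ := hc
  have h2 := hasFDerivAt_ringInverse (𝕜 := ℂ) u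
  rw [hu] at h2
  have h3 := (h2.comp c h1).clm_apply (hasFDerivAt_const y c)
  refine h3.congr_fderiv (ContinuousLinearMap.ext fun d => ?_)
  rw [← hu, Ring.inverse_unit]
  simp [ContinuousLinearMap.mulLeftRight_apply]

/-- Complex-valued continuous functions on `[0,1]`. -/
abbrev CE : Type := C(unitInterval, ℂ)

/-- The Volterra operator of the system `F' = a p`, `p' = b F`. -/
noncomputable def volterra : CE × CE →L[ℂ] CE × CE →L[ℂ] CE × CE :=
  LinearMap.mkContinuous₂
    (LinearMap.mk₂ ℂ (fun c y : CE × CE => (J ℂ (c.1 * y.2), J ℂ (c.2 * y.1)))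
      (fun c c' y => by
        simp only [Prod.fst_add, Prod.snd_add, add_mul, map_add, Prod.mk_add_mk])
      (fun r c y => by
        simp only [Prod.smul_fst, Prod.smul_snd, smul_mul_assoc, map_smul, Prod.smul_mk])
      (fun c y y' => by
        simp only [Prod.fst_add, Prod.snd_add, mul_add, map_add, Prod.mk_add_mk])
      (fun r c y => by
        simp only [Prod.smul_fst, Prod.smul_snd, mul_smul_comm, map_smul, Prod.smul_mk]))
    1 fun c y => by
    have hJ : ∀ f : CE, ‖J ℂ f‖ ≤ ‖f‖ := fun f =>
      (J ℂ).le_of_opNorm_le (LinearMap.mkContinuous_norm_le _ zero_le_one _) f |>.trans (by simp)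
    rw [one_mul]
    refine max_le ?_ ?_
    · refine (hJ _).trans ((norm_mul_le _ _).trans ?_)
      exact mul_le_mul (norm_fst_le c) (norm_snd_le y) (norm_nonneg _) (norm_nonneg _)
    · refine (hJ _).trans ((norm_mul_le _ _).trans ?_)
      exact mul_le_mul (norm_snd_le c) (norm_fst_le y) (norm_nonneg _) (norm_nonneg _)

theorem volterra_apply (c y : CE × CE) :
    volterra c y = (J ℂ (c.1 * y.2), J ℂ (c.2 * y.1)) := rfl

theorem norm_J_mul_apply_le (a p : CE) {C M : ℝ} {n : ℕ} (ha : ‖a‖ ≤ C)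
    (hp : ∀ x : unitInterval, ‖p x‖ ≤ M * (C * x) ^ n / n.factorial) (x : unitInterval) :
    ‖J ℂ (a * p) x‖ ≤ M * (C * x) ^ (n + 1) / (n + 1).factorial := by
  have hi : ∫ y in (0 : ℝ)..x, M * C * ((C * y) ^ n / n.factorial) =
      M * (C * x) ^ (n + 1) / (n + 1).factorial := by
    simp only [mul_pow]
    rw [intervalIntegral.integral_const_mul, intervalIntegral.integral_div,
      intervalIntegral.integral_const_mul, integral_pow, Nat.factorial_succ]
    have : (n.factorial : ℝ) ≠ 0 := by positivity
    push_cast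
    field_simp
    ring
  rw [J_apply, ← hi]
  refine intervalIntegral.norm_integral_le_of_norm_le x.2.1 (Eventually.of_forall fun y hy => ?_)
    ((by fun_prop : Continuous fun y : ℝ =>
      M * C * ((C * y) ^ n / n.factorial)).intervalIntegrable _ _)
  have hy' : y ∈ Icc (0 : ℝ) 1 := ⟨hy.1.le, hy.2.trans x.2.2⟩
  rw [ext_apply _ hy', ContinuousMap.mul_apply, norm_mul]
  refine (mul_le_mul ((a.norm_coe_le_norm _).trans ha) (hp ⟨y, hy'⟩) (norm_nonneg _)
    ((norm_nonneg _).trans ha)).trans (le_of_eq ?_)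
  ring

theorem norm_volterra_pow_apply_le (c y : CE × CE) (n : ℕ) (x : unitInterval) :
    ‖((volterra c ^ n) y).1 x‖ ≤ ‖y‖ * (‖c‖ * x) ^ n / n.factorial ∧
      ‖((volterra c ^ n) y).2 x‖ ≤ ‖y‖ * (‖c‖ * x) ^ n / n.factorial := by
  induction n generalizing x with
  | zero =>
    simp only [pow_zero, mul_one, Nat.factorial_zero, Nat.cast_one, div_one]
    exact ⟨(y.1.norm_coe_le_norm x).trans (norm_fst_le y),
      (y.2.norm_coe_le_norm x).trans (norm_snd_le y)⟩
  | succ n ih =>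
    rw [pow_succ']
    exact ⟨norm_J_mul_apply_le _ _ (norm_fst_le c) (fun x => (ih x).2) x,
      norm_J_mul_apply_le _ _ (norm_snd_le c) (fun x => (ih x).1) x⟩

theorem norm_volterra_pow_le (c : CE × CE) (n : ℕ) :
    ‖volterra c ^ n‖ ≤ ‖c‖ ^ n / n.factorial := by
  refine ContinuousLinearMap.opNorm_le_bound _ (by positivity) fun y => ?_
  have hx : ∀ x : unitInterval, ‖y‖ * (‖c‖ * x) ^ n / n.factorial ≤
      ‖c‖ ^ n / n.factorial * ‖y‖ := fun x => by
    have h1 : (‖c‖ * x) ^ n ≤ ‖c‖ ^ n :=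
      pow_le_pow_left₀ (mul_nonneg (norm_nonneg _) x.2.1)
        (mul_le_of_le_one_right (norm_nonneg _) x.2.2) n
    calc ‖y‖ * (‖c‖ * x) ^ n / n.factorial ≤ ‖y‖ * ‖c‖ ^ n / n.factorial := by gcongr
      _ = ‖c‖ ^ n / n.factorial * ‖y‖ := by ring
  refine max_le ?_ ?_ <;> rw [ContinuousMap.norm_le _ (by positivity)] <;> intro x
  · exact (norm_volterra_pow_apply_le c y n x).1.trans (hx x)
  · exact (norm_volterra_pow_apply_le c y n x).2.trans (hx x)

/-- Volterra systems are uniquely solvable, since the powers of the Volterra operator decay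
factorially. -/
theorem isUnit_one_sub_volterra (c : CE × CE) : IsUnit (1 - volterra c) := by
  obtain ⟨n, hn⟩ := ((FloorSemiring.tendsto_pow_div_factorial_atTop ‖c‖).eventually
    (gt_mem_nhds zero_lt_one)).exists
  exact isUnit_one_sub_of_norm_pow_lt_one (R := CE × CE →L[ℂ] CE × CE)
    ((norm_volterra_pow_le c n).trans_lt hn)

/-- The solution operator of the equation `y = y₀ + volterra c y`. -/
noncomputable def solve (c : CE × CE) : CE × CE →L[ℂ] CE × CE := Ring.inverse (1 - volterra c)

theorem solve_eq_iff (c y y₀ : CE × CE) : solve c y₀ = y ↔ y = y₀ + volterra c y := by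
  have h1 : solve c * (1 - volterra c) = 1 :=
    Ring.inverse_mul_cancel _ (isUnit_one_sub_volterra c)
  have h2 : (1 - volterra c) * solve c = 1 :=
    Ring.mul_inverse_cancel _ (isUnit_one_sub_volterra c)
  have h3 : ∀ z, (1 - volterra c) z = z - volterra c z := fun z => rfl
  constructor
  · rintro rfl
    have h4 : (1 - volterra c) (solve c y₀) = y₀ := DFunLike.congr_fun h2 y₀
    rw [h3, sub_eq_iff_eq_add] at h4
    exact h4
  · intro h
    have h4 : (1 - volterra c) y = y₀ := by rw [h3, sub_eq_iff_eq_add]; exact h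
    rw [← h4]
    exact DFunLike.congr_fun h1 y

theorem hasFDerivAt_solve (c y : CE × CE) : HasFDerivAt (fun c => solve c y)
    ((solve c).comp (volterra.flip (solve c y))) c :=
  hasFDerivAt_inverse_one_sub volterra (isUnit_one_sub_volterra c) y

/-! ### The fundamental system and the discriminant -/

/-- The solution with initial values `(1, 0)`. -/
noncomputable def sol₁ (c : CE × CE) : CE × CE := solve c (1, 0)

/-- The solution with initial values `(0, 1)`. -/
noncomputable def sol₂ (c : CE × CE) : CE × CE := solve c (0, 1)

/-- The trace of the monodromy matrix of the system `F' = a p`, `p' = b F`. -/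
noncomputable def monTrace (c : CE × CE) : ℂ := (sol₁ c).1 1 + (sol₂ c).2 1

theorem solve_const_eq_iff (c y : CE × CE) (α β : ℂ) (q : CE) :
    solve c (algebraMap ℂ CE α, algebraMap ℂ CE β + q) = y ↔
      y.1 = algebraMap ℂ CE α + J ℂ (c.1 * y.2) ∧
        y.2 = algebraMap ℂ CE β + q + J ℂ (c.2 * y.1) := by
  rw [solve_eq_iff, volterra_apply, Prod.ext_iff]
  rfl

theorem isPrim_iff (F f : CE) (α : ℂ) :
    F = algebraMap ℂ CE α + J ℂ f ↔ IsPrim (ext F) (ext f) ∧ F 0 = α := by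
  constructor
  · rintro rfl
    refine ⟨?_, ?_⟩
    · refine ((IsPrim.const α).add (isPrim_J f)).congr_right ?_ |>.congr_left fun x _ => rfl
      exact Eventually.of_forall fun x => zero_add _
    · rw [ContinuousMap.add_apply, J_zero, add_zero]
      rfl
  · rintro ⟨h1, h2⟩
    ext x
    have h3 := h1.eq x x.2
    have h0 : ext F 0 = F 0 := ext_apply F (x := 0) (by simp)
    rw [ext_coe, h0, h2] at h3
    rw [h3, ContinuousMap.add_apply, J_apply]
    rfl

theorem sol₁_spec (c : CE × CE) :
    (IsPrim (ext (sol₁ c).1) (ext (c.1 * (sol₁ c).2)) ∧ (sol₁ c).1 0 = 1) ∧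
      IsPrim (ext (sol₁ c).2) (ext (c.2 * (sol₁ c).1)) ∧ (sol₁ c).2 0 = 0 := by
  have h := (solve_const_eq_iff c (sol₁ c) 1 0 0).1 (by simp [sol₁])
  rw [add_zero] at h
  exact ⟨(isPrim_iff _ _ _).1 h.1, (isPrim_iff _ _ _).1 h.2⟩

theorem sol₂_spec (c : CE × CE) :
    (IsPrim (ext (sol₂ c).1) (ext (c.1 * (sol₂ c).2)) ∧ (sol₂ c).1 0 = 0) ∧
      IsPrim (ext (sol₂ c).2) (ext (c.2 * (sol₂ c).1)) ∧ (sol₂ c).2 0 = 1 := by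
  have h := (solve_const_eq_iff c (sol₂ c) 0 1 0).1 (by simp [sol₂])
  rw [add_zero] at h
  exact ⟨(isPrim_iff _ _ _).1 h.1, (isPrim_iff _ _ _).1 h.2⟩

theorem ext_mul (f g : CE) (x : ℝ) : ext (f * g) x = ext f x * ext g x := rfl

theorem ext_zero_apply (f : CE) : ext f 0 = f 0 := ext_apply f (x := 0) (by simp)

theorem ext_one_apply (f : CE) : ext f 1 = f 1 := ext_apply f (x := 1) (by simp)

/-- The monodromy matrix has determinant one. -/
theorem wronskian_one (c : CE × CE) :
    (sol₁ c).1 1 * (sol₂ c).2 1 - (sol₂ c).1 1 * (sol₁ c).2 1 = 1 := by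
  obtain ⟨⟨h1, i1⟩, h2, i2⟩ := sol₁_spec c
  obtain ⟨⟨h3, i3⟩, h4, i4⟩ := sol₂_spec c
  have hW := (h1.mul h4).add ((h3.mul h2).const_mul (-1))
  have h0 := (hW.congr_right (g := fun _ => 0) (Eventually.of_forall fun x => by
    simp only [ext_mul]; ring)).eq 1 (by simp)
  simp only [intervalIntegral.integral_zero, ext_zero_apply, ext_one_apply, i1, i2, i3, i4] at h0
  linear_combination h0

/-- The coefficients `(exp(-iu), -lam exp(iu))`, `u = 2 ∫₀ˣ v`. For a solution `(F, p)` of the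
corresponding system, `F' = exp(-iu) p` and `F'' + 2ivF' + lam F = 0`. -/
noncomputable def coeffs (lam : ℂ) (f : L2) : CE × CE :=
  (expI (-(2 • primL f)), (-lam) • expI (2 • primL f))

theorem ext_primL_zero (f : L2) : ext (primL f) 0 = 0 := by
  rw [ext_apply _ (x := 0) (by simp), primL_apply]
  simp

theorem ext_primL_one (f : L2) : ext (primL f) 1 = meanL f := by
  rw [ext_apply _ (x := 1) (by simp)]
  rfl

theorem ext_coeffs_fst (lam : ℂ) (f : L2) (x : ℝ) :
    ext (coeffs lam f).1 x = Complex.exp (-(2 * Complex.I * (ext (primL f) x : ℝ))) := by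
  change ext (expI (-(2 • primL f))) x = _
  have h : ext (-(2 • primL f)) x = -(2 * ext (primL f) x) := by
    change -((2 • primL f) _) = _
    rw [ContinuousMap.smul_apply, nsmul_eq_mul]
    rfl
  rw [ext_expI, h]
  push_cast
  congr 1
  ring

theorem ext_expI_two_primL (f : L2) (x : ℝ) :
    ext (expI (2 • primL f)) x = Complex.exp (2 * Complex.I * (ext (primL f) x : ℝ)) := by
  have h : ext (2 • primL f) x = 2 * ext (primL f) x := nsmul_eq_mul 2 _
  rw [ext_expI, h]
  push_cast
  congr 1
  ring

theorem ext_coeffs_snd (lam : ℂ) (f : L2) (x : ℝ) :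
    ext (coeffs lam f).2 x = -lam * Complex.exp (2 * Complex.I * (ext (primL f) x : ℝ)) := by
  rw [← ext_expI_two_primL]
  rfl

theorem isPrim_cexp (z : ℂ) (f : L2) :
    IsPrim (fun x => Complex.exp (z * (ext (primL f) x : ℝ)))
      fun x => z * (f x : ℝ) * Complex.exp (z * (ext (primL f) x : ℝ)) := by
  have h := ((isPrim_primL f).ofReal.const_mul z).comp Complex.hasDerivAt_exp
    Complex.continuous_exp
  refine h.congr_right (Eventually.of_forall fun x => ?_)
  ring

theorem isPrim_coeffs_fst (lam : ℂ) (f : L2) :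
    IsPrim (ext (coeffs lam f).1)
      fun x => -(2 * Complex.I * (f x : ℝ)) * ext (coeffs lam f).1 x := by
  have h := isPrim_cexp (-(2 * Complex.I)) f
  have e : ∀ x, ext (coeffs lam f).1 x =
      Complex.exp (-(2 * Complex.I) * (ext (primL f) x : ℝ)) := fun x => by
    rw [ext_coeffs_fst]
    congr 1
    ring
  simp only [e]
  refine (h.congr_right (Eventually.of_forall fun x => ?_)).congr_left fun x _ => e x
  simp only
  ring

theorem coeffs_mul (lam : ℂ) (f : L2) (x : ℝ) :
    ext (coeffs lam f).1 x * ext (coeffs lam f).2 x = -lam := by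
  rw [ext_coeffs_fst, ext_coeffs_snd, mul_left_comm, ← Complex.exp_add, neg_add_cancel,
    Complex.exp_zero, mul_one]

theorem ext_coeffs_fst_zero (lam : ℂ) (f : L2) : ext (coeffs lam f).1 0 = 1 := by
  rw [ext_coeffs_fst, ext_primL_zero]
  simp

theorem cexp_two_I_meanL {k : ℤ} {l : ℕ} {v : H l} (hm : mean v = k * Real.pi) :
    Complex.exp (2 * Complex.I * (ext (primL (fn v)) 1 : ℝ)) = 1 := by
  rw [ext_primL_one, ← mean_eq, hm, Complex.exp_eq_one_iff]
  exact ⟨k, by push_cast; ring⟩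

theorem ext_coeffs_fst_one {k : ℤ} {l : ℕ} {v : H l} (hm : mean v = k * Real.pi) (lam : ℂ) :
    ext (coeffs lam (fn v)).1 1 = 1 := by
  rw [ext_coeffs_fst, Complex.exp_neg, cexp_two_I_meanL hm, inv_one]

theorem isSolLM_of_isPrim {l : ℕ} (v : H l) (lam : ℂ) {y : CE × CE}
    (h1 : IsPrim (ext y.1) (ext ((coeffs lam (fn v)).1 * y.2)))
    (h2 : IsPrim (ext y.2) (ext ((coeffs lam (fn v)).2 * y.1))) :
    IsSolLM (focPot v) lam (ext y.1) (ext ((coeffs lam (fn v)).1 * y.2)) := by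
  refine ⟨(ext_continuous _).continuousOn, (ext_continuous _).continuousOn, h1.eq, ?_⟩
  have h3 := ((isPrim_coeffs_fst lam (fn v)).mul h2).congr_right
    (g := fun x => -(2 * focPot v x * ext ((coeffs lam (fn v)).1 * y.2) x) - lam * ext y.1 x)
    (Eventually.of_forall fun x => by
      simp only [ext_mul, focPot]
      rw [← mul_assoc (ext (coeffs lam (fn v)).1 x), coeffs_mul]
      ring)
  exact h3.eq

/-- The system and the operator have the same Floquet trace: the coefficient `exp(-iU)`, which relates
`p` and `F'`, is `1` at both ends because the mean value is `kπ`. -/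
theorem isDiscriminant_monTrace {k : ℤ} {l : ℕ} {v : H l} (hm : mean v = k * Real.pi) (lam : ℂ) :
    IsDiscriminant (focPot v) lam (monTrace (coeffs lam (fn v))) := by
  obtain ⟨⟨h1, i1⟩, h2, i2⟩ := sol₁_spec (coeffs lam (fn v))
  obtain ⟨⟨h3, i3⟩, h4, i4⟩ := sol₂_spec (coeffs lam (fn v))
  refine ⟨_, _, _, _, isSolLM_of_isPrim v lam h1 h2, isSolLM_of_isPrim v lam h3 h4, ?_, ?_, ?_, ?_,
    ?_⟩
  · rw [ext_zero_apply, i1]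
  · rw [ext_mul, ext_zero_apply (sol₁ _).2, i2, mul_zero]
  · rw [ext_zero_apply, i3]
  · rw [ext_mul, ext_zero_apply (sol₂ _).2, i4, mul_one, ext_coeffs_fst_zero]
  · rw [ext_mul, ext_coeffs_fst_one hm, one_mul, ext_one_apply, ext_one_apply]
    rfl


/-! ### The spectrum in terms of the discriminant -/

theorem exists_ext_eq {F : ℝ → ℂ} (hF : ContinuousOn F (Icc 0 1)) :
    ∃ y : CE, ∀ x ∈ Icc (0 : ℝ) 1, ext y x = F x :=
  ⟨⟨fun x => F x, hF.comp_continuous continuous_subtype_val fun x => x.2⟩,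
    fun _ hx => ext_apply _ hx⟩

theorem eq_zero_of_ext_ae_eq_zero {w : CE} (h : ext w =ᵐ[μ] 0) : w = 0 := by
  have h1 : EqOn (ext w) 0 (Icc 0 1) := by
    refine Measure.eqOn_Icc_of_ae_eq volume zero_ne_one ?_ (ext_continuous w).continuousOn
      continuousOn_const
    rwa [← restrict_Ioc_eq_restrict_Icc]
  ext x
  rw [← ext_coe]
  exact h1 x.2

theorem eq_zero_of_J_eq_zero {w : CE} (h : J ℂ w = 0) : w = 0 := by
  refine eq_zero_of_ext_ae_eq_zero ?_
  filter_upwards [ae_restrict_of_ae (isPrim_J w).ae_hasDerivAt, ae_mem_Icc] with x h1 hx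
  rw [h] at h1
  have h2 := h1 (by rwa [uIcc_of_le zero_le_one])
  exact h2.unique (hasDerivAt_const x 0)

theorem eq_add_J_iff {F f q : CE} {w : ℝ → ℂ} (hq : IsPrim (ext q) w) (hq0 : q 0 = 0) (α : ℂ) :
    F = algebraMap ℂ CE α + q + J ℂ f ↔ IsPrim (ext F) (fun x => ext f x + w x) ∧ F 0 = α := by
  have h1 : F = algebraMap ℂ CE α + q + J ℂ f ↔ F - q = algebraMap ℂ CE α + J ℂ f := by
    rw [sub_eq_iff_eq_add, add_right_comm]
  rw [h1, isPrim_iff, ContinuousMap.sub_apply, hq0, sub_zero]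
  refine and_congr_left fun _ => ⟨fun h => ?_, fun h => ?_⟩
  · exact (h.add hq).congr_left fun x _ => (sub_add_cancel (ext F x) (ext q x)).symm
  · refine ((h.add (hq.const_mul (-1))).congr_right ?_).congr_left (fun x _ => ?_)
    · exact Eventually.of_forall fun x => by ring
    · change ext F x - ext q x = _
      ring

theorem ext_expI_mul_coeffs_fst (lam : ℂ) (f : L2) (x : ℝ) :
    ext (expI (2 • primL f)) x * ext (coeffs lam f).1 x = 1 := by
  rw [ext_expI_two_primL, ext_coeffs_fst, ← Complex.exp_add, add_neg_cancel, Complex.exp_zero]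

theorem ext_coeffs_snd' (lam : ℂ) (f : L2) (x : ℝ) :
    ext (coeffs lam f).2 x = -lam * ext (expI (2 • primL f)) x := rfl

theorem integrable_L2C (r : L2C) : Integrable r μ := (Lp.memLp r).integrable (by norm_num)

theorem intervalIntegrable_of_integrable {f : ℝ → ℂ} (h : Integrable f μ) :
    IntervalIntegrable f volume 0 1 :=
  (intervalIntegrable_iff_integrableOn_Ioc_of_le zero_le_one).2 h

/-- In the variables `F = f`, `p = exp(iu) f'`, the equation `L_M f = r + lam f` with its boundary
conditions is an inhomogeneous Volterra system. -/
theorem lMGraph_iff {k : ℤ} {l : ℕ} {v : H l} (hm : mean v = k * Real.pi) (σ lam : ℂ)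
    (f r : L2C) :
    LMGraph σ (focPot v) f (r + lam • f) ↔
      ∃ y : CE × CE, f =ᵐ[μ] ext y.1 ∧
        IsPrim (ext y.1) (ext ((coeffs lam (fn v)).1 * y.2)) ∧
        IsPrim (ext y.2) (fun x => ext ((coeffs lam (fn v)).2 * y.1) x +
          -(ext (expI (2 • primL (fn v))) x * r x)) ∧
        y.1 1 = σ * y.1 0 ∧ y.2 1 = σ * y.2 0 := by
  set a := (coeffs lam (fn v)).1 with ha
  set b := (coeffs lam (fn v)).2 with hb
  set E := expI (2 • primL (fn v)) with hE
  have hEa : ∀ x, ext E x * ext a x = 1 := ext_expI_mul_coeffs_fst lam (fn v)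
  have hbE : ∀ x, ext b x = -lam * ext E x := ext_coeffs_snd' lam (fn v)
  have hE1 : ext E 1 = 1 := by rw [hE, ext_expI_two_primL, cexp_two_I_meanL hm]
  have hE0 : ext E 0 = 1 := by
    rw [hE, ext_expI_two_primL, ext_primL_zero]
    simp
  have hrf : (r + lam • f : L2C) =ᵐ[μ] fun x => r x + lam * f x := by
    filter_upwards [Lp.coeFn_add r (lam • f), Lp.coeFn_smul lam f] with x h1 h2
    rw [h1, Pi.add_apply, h2]
    rfl
  constructor
  · rintro ⟨F, G, h, hfF, hF, hG, hF1, hG1, hr⟩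
    have hGp : IsPrim G h := ⟨intervalIntegrable_of_integrable (integrable_L2C h), hG⟩
    have hFp : IsPrim F G := ⟨ContinuousOn.intervalIntegrable
      (by simpa using hGp.continuousOn), hF⟩
    have hEp : IsPrim (ext E) fun x => 2 * Complex.I * (fn v x : ℝ) * ext E x := by
      have e := isPrim_cexp (2 * Complex.I) (fn v)
      simp only [← ext_expI_two_primL] at e
      exact e
    have hpp := hEp.mul hGp
    obtain ⟨y₁, hy₁⟩ := exists_ext_eq hFp.continuousOn
    obtain ⟨y₂, hy₂⟩ := exists_ext_eq hpp.continuousOn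
    have h0 : (0 : ℝ) ∈ Icc (0 : ℝ) 1 := by simp
    have h1 : (1 : ℝ) ∈ Icc (0 : ℝ) 1 := by simp
    refine ⟨(y₁, y₂), ?_, ?_, ?_, ?_, ?_⟩
    · filter_upwards [hfF, ae_mem_Icc] with x g1 hx
      rw [g1, hy₁ x hx]
    · refine (hFp.congr_left hy₁).congr_right ?_
      filter_upwards [ae_mem_Icc] with x hx
      rw [ext_mul, hy₂ x hx]
      linear_combination -(G x) * hEa x
    · refine (hpp.congr_left hy₂).congr_right ?_
      filter_upwards [hfF, hr, hrf, ae_mem_Icc] with x g1 g2 g3 hx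
      rw [g3, g1] at g2
      rw [ext_mul, hy₁ x hx, hbE]
      simp only [focPot] at g2
      linear_combination (ext E x) * g2
    · rw [← ext_one_apply, ← ext_zero_apply, hy₁ 1 h1, hy₁ 0 h0, hF1]
    · rw [← ext_one_apply, ← ext_zero_apply, hy₂ 1 h1, hy₂ 0 h0, hE0, hE1, one_mul, one_mul, hG1]
  · rintro ⟨y, hfy, h1, h2, h3, h4⟩
    have hap : IsPrim (ext a) fun x => -(2 * Complex.I * (fn v x : ℝ)) * ext a x :=
      isPrim_coeffs_fst lam (fn v)
    have hGp := hap.mul h2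
    have hGp' : IsPrim (ext (a * y.2)) fun x =>
        -(2 * focPot v x * ext (a * y.2) x) - lam * ext y.1 x - r x := by
      refine hGp.congr_right (Eventually.of_forall fun x => ?_)
      simp only [focPot, ext_mul, hbE]
      linear_combination (-lam * ext y.1 x - r x) * hEa x
    have hmem : MemLp (fun x => -(2 * focPot v x * ext (a * y.2) x) - lam * ext y.1 x - r x) 2
        μ := by
      have m1 : MemLp (fun x => ((fn v x : ℝ) : ℂ) * ext (a * y.2) x) 2 μ :=
        memLp_mul_continuousOn (Lp.memLp (fn v)).ofReal (ext_continuous _).continuousOn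
      have m2 := ((m1.const_mul (-(2 * Complex.I))).sub
        ((memLp_of_continuousOn (ext_continuous y.1).continuousOn).const_mul lam)).sub (Lp.memLp r)
      refine (memLp_congr_ae (Eventually.of_forall fun x => ?_)).1 m2
      simp only [Pi.sub_apply, focPot]
      ring
    refine ⟨ext y.1, ext (a * y.2), hmem.toLp _, hfy, h1.eq,
      (hGp'.congr_right hmem.coeFn_toLp.symm).eq, ?_, ?_, ?_⟩
    · rw [ext_one_apply, ext_zero_apply, h3]
    · have ha1 : ext a 1 = 1 := ext_coeffs_fst_one hm lam
      have ha0 : ext a 0 = 1 := ext_coeffs_fst_zero lam (fn v)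
      rw [ext_mul, ext_mul, ha1, ha0, one_mul, one_mul, ext_one_apply, ext_zero_apply, h4]
    · filter_upwards [hrf, hfy, hmem.coeFn_toLp] with x g1 g2 g3
      rw [g1, g3, g2]
      ring

/-- The solutions of the inhomogeneous Volterra system, by superposition. -/
theorem exists_isPrim_system {c : CE × CE} {w : ℝ → ℂ} (hw : IntervalIntegrable w volume 0 1) :
    ∃ Z : CE × CE, Z.1 0 = 0 ∧ Z.2 0 = 0 ∧ ∀ (y : CE × CE),
      (IsPrim (ext y.1) (ext (c.1 * y.2)) ∧ IsPrim (ext y.2) fun x => ext (c.2 * y.1) x + w x) ↔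
        y = y.1 0 • sol₁ c + y.2 0 • sol₂ c + Z := by
  have hq' := IsPrim.of_intervalIntegrable 0 hw
  obtain ⟨q, hq⟩ := exists_ext_eq hq'.continuousOn
  have hqp := hq'.congr_left hq
  have hq0 : q 0 = 0 := by
    rw [← ext_zero_apply, hq 0 (by simp)]
    simp
  have hZ := (solve_const_eq_iff c _ 0 0 q).1 rfl
  rw [map_zero, zero_add, zero_add] at hZ
  refine ⟨solve c (0, q), ?_, ?_, fun y => ?_⟩
  · rw [hZ.1, J_zero]
  · rw [hZ.2, ContinuousMap.add_apply, J_zero, hq0, add_zero]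
  have hlin : y.1 0 • sol₁ c + y.2 0 • sol₂ c + solve c (0, q) =
      solve c (algebraMap ℂ CE (y.1 0), algebraMap ℂ CE (y.2 0) + q) := by
    rw [sol₁, sol₂, ← map_smul, ← map_smul, ← map_add, ← map_add]
    congr 1
    have h0 : ∀ z : ℂ, z • (0 : CE) = 0 := fun z => ContinuousMap.ext fun _ => mul_zero z
    simp only [Prod.smul_mk, Prod.mk_add_mk, Algebra.algebraMap_eq_smul_one, h0, add_zero, zero_add]
  rw [hlin, eq_comm (a := y), solve_const_eq_iff, isPrim_iff, eq_add_J_iff hqp hq0]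
  simp

/-- A singular `2 × 2` matrix has a nontrivial kernel. -/
theorem exists_kernel {A B C D : ℂ} (h : A * D - B * C = 0) :
    ∃ α β : ℂ, (α ≠ 0 ∨ β ≠ 0) ∧ A * α + B * β = 0 ∧ C * α + D * β = 0 := by
  by_cases h1 : A = 0 ∧ B = 0
  · obtain ⟨rfl, rfl⟩ := h1
    by_cases h2 : C = 0 ∧ D = 0
    · obtain ⟨rfl, rfl⟩ := h2
      exact ⟨1, 0, by simp, by simp, by simp⟩
    · refine ⟨D, -C, ?_, by ring, by ring⟩
      rw [not_and_or] at h2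
      simpa [or_comm] using h2
  · refine ⟨B, -A, ?_, by ring, by linear_combination -h⟩
    rw [not_and_or] at h1
    simpa [or_comm] using h1

/-- The spectrum with the boundary condition `σ = ±1` is the set of zeros of `Δ - 2σ`. -/
theorem mem_specLM_iff {k : ℤ} {l : ℕ} {v : H l} (hm : mean v = k * Real.pi) {σ : ℂ}
    (hσ : σ * σ = 1) (lam : ℂ) :
    lam ∈ specLM σ (focPot v) ↔ monTrace (coeffs lam (fn v)) = 2 * σ := by
  set c := coeffs lam (fn v) with hc
  set E := expI (2 • primL (fn v)) with hE
  obtain ⟨⟨-, i1⟩, -, i2⟩ := sol₁_spec c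
  obtain ⟨⟨-, i3⟩, -, i4⟩ := sol₂_spec c
  have hW := wronskian_one c
  set A := (sol₁ c).1 1 - σ with hA
  set B := (sol₂ c).1 1 with hB
  set C := (sol₁ c).2 1 with hC
  set D := (sol₂ c).2 1 - σ with hD
  -- the determinant of `Φ(1) - σ`, by `det Φ(1) = 1` and `σ² = 1`
  have hdet : A * D - B * C = 2 - σ * monTrace c := by
    rw [hA, hD, monTrace]
    linear_combination hW + hσ
  have hiff : monTrace c = 2 * σ ↔ A * D - B * C = 0 := by
    rw [hdet]
    constructor
    · intro h
      rw [h]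
      linear_combination -2 * hσ
    · intro h
      linear_combination (-σ) * h - monTrace c * hσ
  have hsys : ∀ r : L2C, ∃ Z : CE × CE,
      ∀ f : L2C, LMGraph σ (focPot v) f (r + lam • f) ↔
      ∃ α β : ℂ, f =ᵐ[μ] ext (α • sol₁ c + β • sol₂ c + Z).1 ∧ A * α + B * β = -Z.1 1 ∧
        C * α + D * β = -Z.2 1 := by
    intro r
    have hw : IntervalIntegrable (fun x => -(ext E x * r x)) volume 0 1 :=
      ((intervalIntegrable_of_integrable (integrable_L2C r)).continuousOn_mul
        (ext_continuous E).continuousOn).neg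
    obtain ⟨Z, hZ1, hZ2, hZ⟩ := exists_isPrim_system (c := c) hw
    refine ⟨Z, fun f => ?_⟩
    rw [lMGraph_iff hm]
    have e1 : ∀ (α β : ℂ) (x : unitInterval), (α • sol₁ c + β • sol₂ c + Z).1 x =
        α * (sol₁ c).1 x + β * (sol₂ c).1 x + Z.1 x := fun _ _ _ => rfl
    have e2 : ∀ (α β : ℂ) (x : unitInterval), (α • sol₁ c + β • sol₂ c + Z).2 x =
        α * (sol₁ c).2 x + β * (sol₂ c).2 x + Z.2 x := fun _ _ _ => rfl
    constructor
    · rintro ⟨y, hfy, h1, h2, h3, h4⟩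
      have hy := (hZ y).1 ⟨h1, h2⟩
      refine ⟨y.1 0, y.2 0, by rwa [← hy], ?_, ?_⟩
      · have := congrArg (fun z : CE × CE => z.1 1) hy
        simp only [e1, h3] at this
        linear_combination -this
      · have := congrArg (fun z : CE × CE => z.2 1) hy
        simp only [e2, h4] at this
        linear_combination -this
    · rintro ⟨α, β, hf, h3, h4⟩
      have y1 := e1 α β 0
      have y2 := e2 α β 0
      rw [i1, i3, hZ1, mul_one, mul_zero, add_zero, add_zero] at y1
      rw [i2, i4, hZ2, mul_one, mul_zero, zero_add, add_zero] at y2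
      have hy := (hZ (α • sol₁ c + β • sol₂ c + Z)).2 (by rw [y1, y2])
      refine ⟨_, hf, hy.1, hy.2, ?_, ?_⟩
      · rw [y1, e1]
        linear_combination h3
      · rw [y2, e2]
        linear_combination h4
  rw [hiff]
  have hmem : ∀ w : CE, MemLp (ext w) 2 μ := fun w =>
    memLp_of_continuousOn (ext_continuous w).continuousOn
  constructor
  · intro hspec
    by_contra hdet0
    refine hspec fun r => ?_
    obtain ⟨Z, hZ⟩ := hsys r
    -- the coefficients are given by Cramer's rule
    refine ⟨(hmem (((B * Z.2 1 - D * Z.1 1) / (A * D - B * C)) • sol₁ c +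
      ((C * Z.1 1 - A * Z.2 1) / (A * D - B * C)) • sol₂ c + Z).1).toLp _, ?_, fun f hf => ?_⟩
    · refine (hZ _).2 ⟨_, _, (hmem _).coeFn_toLp, ?_, ?_⟩
      · rw [mul_div_assoc', mul_div_assoc', ← add_div, div_eq_iff hdet0]
        ring
      · rw [mul_div_assoc', mul_div_assoc', ← add_div, div_eq_iff hdet0]
        ring
    · obtain ⟨α, β, hfe, h1, h2⟩ := (hZ f).1 hf
      have hα : α = (B * Z.2 1 - D * Z.1 1) / (A * D - B * C) := by
        rw [eq_div_iff hdet0]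
        linear_combination D * h1 - B * h2
      have hβ : β = (C * Z.1 1 - A * Z.2 1) / (A * D - B * C) := by
        rw [eq_div_iff hdet0]
        linear_combination A * h2 - C * h1
      rw [← hα, ← hβ]
      exact Lp.ext (hfe.trans (hmem _).coeFn_toLp.symm)
  · intro hdet0 hbij
    obtain ⟨Z, hZ⟩ := hsys 0
    obtain ⟨f, hf, huniq⟩ := hbij 0
    obtain ⟨α, β, hfe, h1, h2⟩ := (hZ f).1 hf
    obtain ⟨α', β', hne, k1, k2⟩ := exists_kernel hdet0
    have hf' := huniq ((hmem ((α + α') • sol₁ c + (β + β') • sol₂ c + Z).1).toLp _)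
      ((hZ _).2 ⟨α + α', β + β', (hmem _).coeFn_toLp, by linear_combination h1 + k1,
        by linear_combination h2 + k2⟩)
    have hw : α' • (sol₁ c).1 + β' • (sol₂ c).1 = 0 := by
      refine eq_zero_of_ext_ae_eq_zero ?_
      have g := (hmem ((α + α') • sol₁ c + (β + β') • sol₂ c + Z).1).coeFn_toLp
      rw [hf'] at g
      filter_upwards [g, hfe] with x g1 g2
      rw [g1] at g2
      have g3 : (α + α') * ext (sol₁ c).1 x + (β + β') * ext (sol₂ c).1 x + ext Z.1 x =
        α * ext (sol₁ c).1 x + β * ext (sol₂ c).1 x + ext Z.1 x := g2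
      change α' * ext (sol₁ c).1 x + β' * ext (sol₂ c).1 x = 0
      linear_combination g3
    have hα : α' = 0 := by
      have := DFunLike.congr_fun hw 0
      simpa [i1, i3] using this
    have hβ : β' ≠ 0 := hne.resolve_left (not_not.2 hα)
    have hs1 : (sol₂ c).1 = 0 := ContinuousMap.ext fun x => by
      have g : α' * (sol₁ c).1 x + β' * (sol₂ c).1 x = 0 := DFunLike.congr_fun hw x
      rw [hα, zero_mul, zero_add] at g
      exact (mul_eq_zero.1 g).resolve_left hβ
    -- the second solution cannot have a vanishing first component
    have hs2 := (isPrim_iff _ _ _).2 (sol₂_spec c).1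
    rw [hs1, map_zero, zero_add] at hs2
    have := DFunLike.congr_fun (eq_zero_of_J_eq_zero hs2.symm) 0
    rw [ContinuousMap.mul_apply, i4, mul_one, ← ext_zero_apply, ext_coeffs_fst_zero] at this
    exact one_ne_zero this

/-! ### Isospectrality -/

theorem ext_add (f g : CE) (x : ℝ) : ext (f + g) x = ext f x + ext g x := rfl

theorem ext_sub (f g : CE) (x : ℝ) : ext (f - g) x = ext f x - ext g x := rfl

theorem ext_neg (f : CE) (x : ℝ) : ext (-f) x = -ext f x := rfl

theorem ext_smul (z : ℂ) (f : CE) (x : ℝ) : ext (z • f) x = z * ext f x := rfl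

theorem ext_two_nsmul (f : CE) (x : ℝ) : ext (2 • f) x = 2 * ext f x := nsmul_eq_mul 2 _

/-- The derivative of the trace of the monodromy matrix vanishes along a deformation of the
coefficients given by a zero curvature equation: with `M = [[-S, β], [γ, S]]`, the variation of the
fundamental matrix `Φ` is `M Φ - Φ M(0)`. -/
theorem trace_variation_eq_zero (c : CE × CE) (S : CE) (β γ : ℂ) (hS : IsPrim (ext S)
      fun x => β * ext c.2 x - γ * ext c.1 x) (hS0 : S 0 = 0) (hS1 : S 1 = 0) :
    (solve c (volterra (-(2 • (S * c.1)), 2 • (S * c.2)) (sol₁ c))).1 1 +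
      (solve c (volterra (-(2 • (S * c.1)), 2 • (S * c.2)) (sol₂ c))).2 1 = 0 := by
  obtain ⟨⟨h1, i1⟩, h2, i2⟩ := sol₁_spec c
  obtain ⟨⟨h3, i3⟩, h4, i4⟩ := sol₂_spec c
  have key : ∀ y z y' : CE × CE, y'.1 0 = 0 → y'.2 0 = 0 →
      IsPrim (ext y'.1) (ext (z.1 * y.2 + c.1 * y'.2)) →
      IsPrim (ext y'.2) (ext (z.2 * y.1 + c.2 * y'.1)) → solve c (volterra z y) = y' := by
    intro y z y' g1 g2 g3 g4
    have e1 := (isPrim_iff y'.1 _ 0).2 ⟨g3, g1⟩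
    have e2 := (isPrim_iff y'.2 _ 0).2 ⟨g4, g2⟩
    rw [map_zero, zero_add, map_add] at e1 e2
    rw [solve_eq_iff, volterra_apply, volterra_apply]
    exact Prod.ext e1 e2
  have k1 : solve c (volterra (-(2 • (S * c.1)), 2 • (S * c.2)) (sol₁ c)) =
      (-(S * (sol₁ c).1) + β • (sol₁ c).2 - γ • (sol₂ c).1,
        γ • (sol₁ c).1 + S * (sol₁ c).2 - γ • (sol₂ c).2) := by
    refine key _ _ _ (by simp [hS0, i2, i3]) (by simp [hS0, i1, i4]) ?_ ?_
    · refine ((((hS.mul h1).const_mul (-1)).add (h2.const_mul β)).add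
        (h3.const_mul (-γ))).congr_right (Eventually.of_forall fun x => ?_) |>.congr_left
          fun x _ => ?_ <;>
      simp only [ext_sub, ext_add, ext_neg, ext_mul, ext_smul, ext_two_nsmul] <;> ring
    · refine (((h1.const_mul γ).add (hS.mul h2)).add
        (h4.const_mul (-γ))).congr_right (Eventually.of_forall fun x => ?_) |>.congr_left
          fun x _ => ?_ <;>
      simp only [ext_sub, ext_add, ext_neg, ext_mul, ext_smul, ext_two_nsmul] <;> ring
  have k2 : solve c (volterra (-(2 • (S * c.1)), 2 • (S * c.2)) (sol₂ c)) =
      (-(S * (sol₂ c).1) + β • (sol₂ c).2 - β • (sol₁ c).1,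
        γ • (sol₂ c).1 + S * (sol₂ c).2 - β • (sol₁ c).2) := by
    refine key _ _ _ (by simp [hS0, i1, i4]) (by simp [hS0, i2, i3]) ?_ ?_
    · refine ((((hS.mul h3).const_mul (-1)).add (h4.const_mul β)).add
        (h1.const_mul (-β))).congr_right (Eventually.of_forall fun x => ?_) |>.congr_left
          fun x _ => ?_ <;>
      simp only [ext_sub, ext_add, ext_neg, ext_mul, ext_smul, ext_two_nsmul] <;> ring
    · refine (((h3.const_mul γ).add (hS.mul h4)).add
        (h2.const_mul (-β))).congr_right (Eventually.of_forall fun x => ?_) |>.congr_left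
          fun x _ => ?_ <;>
      simp only [ext_sub, ext_add, ext_neg, ext_mul, ext_smul, ext_two_nsmul] <;> ring
  rw [k1, k2]
  simp only [ContinuousMap.sub_apply, ContinuousMap.add_apply, ContinuousMap.neg_apply,
    ContinuousMap.mul_apply, ContinuousMap.smul_apply, hS1, smul_eq_mul]
  ring


theorem hasDerivWithinAt_solve {I : Set ℝ} {c : ℝ → CE × CE} {c' : CE × CE} {t : ℝ}
    (hc : HasDerivWithinAt c c' I t) (y : CE × CE) :
    HasDerivWithinAt (fun s => solve (c s) y) (solve (c t) (volterra c' (solve (c t) y))) I t :=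
  ((hasFDerivAt_solve (c t) y).restrictScalars ℝ).comp_hasDerivWithinAt t hc

theorem hasDerivWithinAt_monTrace {I : Set ℝ} {c : ℝ → CE × CE} {c' : CE × CE} {t : ℝ}
    (hc : HasDerivWithinAt c c' I t) :
    HasDerivWithinAt (fun s => monTrace (c s)) ((solve (c t) (volterra c' (sol₁ (c t)))).1 1 +
      (solve (c t) (volterra c' (sol₂ (c t)))).2 1) I t := by
  have e1 := (((ContinuousMap.evalCLM ℂ (1 : unitInterval)).comp
    (ContinuousLinearMap.fst ℂ CE CE)).restrictScalars ℝ).hasFDerivAt.comp_hasDerivWithinAt t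
      (hasDerivWithinAt_solve hc (1, 0))
  have e2 := (((ContinuousMap.evalCLM ℂ (1 : unitInterval)).comp
    (ContinuousLinearMap.snd ℂ CE CE)).restrictScalars ℝ).hasFDerivAt.comp_hasDerivWithinAt t
      (hasDerivWithinAt_solve hc (0, 1))
  exact e1.add e2

theorem hasDerivWithinAt_coeffs {I : Set ℝ} {f : ℝ → L2} {f' : L2} {t : ℝ}
    (hf : HasDerivWithinAt f f' I t) (lam : ℂ) :
    HasDerivWithinAt (fun s => coeffs lam (f s))
      (-(2 • (imulL (primL f') * (coeffs lam (f t)).1)),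
        2 • (imulL (primL f') * (coeffs lam (f t)).2)) I t := by
  have hp : HasDerivWithinAt (fun s => 2 • primL (f s)) (2 • primL f') I t :=
    (2 • primL : L2 →L[ℝ] _).hasFDerivAt.comp_hasDerivWithinAt t hf
  have h1 := (hasFDerivAt_expI _).comp_hasDerivWithinAt t hp.neg
  have h2 := ((hasFDerivAt_expI _).comp_hasDerivWithinAt t hp).const_smul (-lam)
  refine (h1.prodMk h2).congr_deriv (Prod.ext ?_ ?_)
  · ext x
    change expI (-(2 • primL (f t))) x * (imulL (-(2 • primL f')) x) =
      -((2 • (imulL (primL f') * expI (-(2 • primL (f t))))) x)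
    rw [imulL_apply, ContinuousMap.neg_apply, ContinuousMap.smul_apply, ContinuousMap.smul_apply,
      ContinuousMap.mul_apply, imulL_apply, nsmul_eq_mul, nsmul_eq_mul]
    push_cast
    ring
  · ext x
    change -lam * (expI (2 • primL (f t)) x * (imulL (2 • primL f') x)) =
      (2 • (imulL (primL f') * ((-lam) • expI (2 • primL (f t))))) x
    rw [imulL_apply, ContinuousMap.smul_apply, ContinuousMap.smul_apply,
      ContinuousMap.mul_apply, imulL_apply, ContinuousMap.smul_apply, nsmul_eq_mul, nsmul_eq_mul,
      smul_eq_mul]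
    push_cast
    ring

theorem lift_eq {l : ℕ} (v : H l) {x : ℝ} (hx : x ∈ Icc (0 : ℝ) 1) :
    lift v x = lift v 0 + 2 * ext (primL (fn v)) x := by
  rw [(isPrim_lift v).eq x hx, (isPrim_primL (fn v)).eq x hx, ext_primL_zero, zero_add,
    intervalIntegral.integral_const_mul]

/-- Along the flow of the vector field `½ sin(u)`, `u = 2 ∂ₓ⁻¹ v + c_sg(v)`, the trace of the
monodromy matrix does not change: the zero curvature equation holds with `s = i ∫₀ˣ v_t`,
`γ = exp(-i u(0)) / 4` and `β = -exp(i u(0)) / (4 lam)`. -/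
theorem hasDerivWithinAt_monTrace_zero {l : ℕ} {I : Set ℝ} {v : ℝ → H l} {v' : H l} {t : ℝ}
    (hv : HasDerivWithinAt v v' I t) (hv' : fn v' =ᵐ[μ] field (v t)) {lam : ℂ} (hlam : lam ≠ 0) :
    HasDerivWithinAt (fun s => monTrace (coeffs lam (fn (v s)))) 0 I t := by
  have hf : HasDerivWithinAt (fun s => fn (v s)) (fn v') I t :=
    (fnL l).hasFDerivAt.comp_hasDerivWithinAt t hv
  refine (hasDerivWithinAt_monTrace (hasDerivWithinAt_coeffs hf lam)).congr_deriv ?_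
  have hext : ∀ x, ext (imulL (primL (fn v'))) x = Complex.I * (ext (primL (fn v')) x : ℝ) :=
    fun _ => rfl
  refine trace_variation_eq_zero _ (imulL (primL (fn v')))
    (-Complex.exp (Complex.I * (lift (v t) 0 : ℝ)) / (4 * lam))
    (Complex.exp (-(Complex.I * (lift (v t) 0 : ℝ))) / 4) ?_ ?_ ?_
  · have h := (isPrim_primL (fn v')).ofReal.const_mul Complex.I
    refine (h.congr_right ?_).congr_left fun x _ => hext x
    filter_upwards [hv', field_ae (v t), ae_mem_Icc] with x h1 h2 hx
    rw [h1, h2, lift_eq (v t) hx, ext_coeffs_fst, ext_coeffs_snd]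
    set p := ext (primL (fn (v t))) x
    set q := lift (v t) 0
    have e1 : Complex.exp (Complex.I * (q : ℂ)) * Complex.exp (2 * Complex.I * (p : ℂ)) =
        Complex.exp (((q : ℂ) + 2 * p) * Complex.I) := by
      rw [← Complex.exp_add]
      congr 1
      ring
    have e2 : Complex.exp (-(Complex.I * (q : ℂ))) * Complex.exp (-(2 * Complex.I * (p : ℂ))) =
        Complex.exp (-((q : ℂ) + 2 * p) * Complex.I) := by
      rw [← Complex.exp_add]
      congr 1
      ring
    push_cast
    rw [Complex.sin, ← e1, ← e2]
    field_simp
    rw [Complex.I_sq]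
    ring
  · rw [← ext_zero_apply, hext, ext_primL_zero]
    simp
  · rw [← ext_one_apply, hext, ext_primL_one, meanL_apply, integral_congr_ae hv', integral_field]
    simp

/-- At `lam = 0`, where `β` has a pole, the trace does not depend on `v` at all: `p` is constant. -/
theorem monTrace_coeffs_zero (f : L2) : monTrace (coeffs 0 f) = 2 := by
  have h0 : (coeffs 0 f).2 = 0 := ContinuousMap.ext fun x => by
    change -0 * expI (2 • primL f) x = 0
    rw [neg_zero, zero_mul]
  have hJ : ∀ y : CE, J ℂ ((coeffs 0 f).2 * y) = 0 := fun y => by rw [h0, zero_mul, map_zero]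
  have h1 := (solve_const_eq_iff (coeffs 0 f) _ 1 0 0).1 rfl
  have h2 := (solve_const_eq_iff (coeffs 0 f) _ 0 1 0).1 rfl
  rw [hJ] at h1 h2
  simp only [map_one, map_zero, add_zero, zero_add] at h1 h2
  have e1 : (sol₁ (coeffs 0 f)).1 = 1 := by
    rw [sol₁, h1.1, h1.2, mul_zero, map_zero, add_zero]
  have e2 : (sol₂ (coeffs 0 f)).2 = 1 := h2.2
  rw [monTrace, e1, e2]
  norm_num

theorem monTrace_coeffs_eq {l : ℕ} {I : Set ℝ} {v : ℝ → H l} (hI : Convex ℝ I)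
    (hne : (interior I).Nonempty) (hv : DifferentiableOn ℝ v I)
    (hv' : ∀ t ∈ I, fn (derivWithin v I t) =ᵐ[μ] field (v t)) (lam : ℂ) {s t : ℝ} (hs : s ∈ I)
    (ht : t ∈ I) : monTrace (coeffs lam (fn (v s))) = monTrace (coeffs lam (fn (v t))) := by
  by_cases hlam : lam = 0
  · rw [hlam, monTrace_coeffs_zero, monTrace_coeffs_zero]
  · have hd : ∀ r ∈ I, HasDerivWithinAt (fun s => monTrace (coeffs lam (fn (v s)))) 0 I r :=
      fun r hr => hasDerivWithinAt_monTrace_zero (hv r hr).hasDerivWithinAt (hv' r hr) hlam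
    refine hI.is_const_of_fderivWithin_eq_zero (𝕜 := ℝ)
      (fun r hr => (hd r hr).differentiableWithinAt) (fun r hr => ?_) hs ht
    rw [(hd r hr).hasFDerivWithinAt.fderivWithin (uniqueDiffOn_convex hI hne r hr)]
    ext
    simp

/-- Orbits of the Hamiltonian flow of `H_sg` are solutions of `v_t = ½ sin(2 ∂ₓ⁻¹ v + c_sg(v))`. -/
theorem IsHamiltonianCurve.fn_derivWithin {k : ℤ} {l : ℕ} {I : Set ℝ} {v : ℝ → H l}
    (h : IsHamiltonianCurve (W k l) Hsg I v) {t : ℝ} (ht : t ∈ I) :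
    fn (derivWithin v I t) =ᵐ[μ] field (v t) := by
  obtain ⟨hW, g, hg, hd⟩ := h.2 t ht
  obtain ⟨g', hg', hX⟩ := exists_isL2Gradient_Hsg hW
  rw [hg.fn_dx_eq hg'] at hd
  exact hd.trans hX

theorem inPoissonAlgebraFocMKdV_Hsg (k : ℤ) (l : ℕ) :
    InPoissonAlgebraFocMKdV (W k l) Hsg := by
  intro I v hI hne h
  have hv : DifferentiableOn ℝ v I := h.1.differentiableOn one_ne_zero
  have htr := fun lam => fun {s t : ℝ} => monTrace_coeffs_eq (s := s) (t := t) hI hne hv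
    (fun t ht => h.fn_derivWithin ht) lam
  have hspec : ∀ σ : ℂ, σ * σ = 1 → ∀ s ∈ I, ∀ t ∈ I,
      specLM σ (focPot (v s)) = specLM σ (focPot (v t)) := by
    intro σ hσ s hs t ht
    ext lam
    rw [mem_specLM_iff (h.2 s hs).1.2 hσ, mem_specLM_iff (h.2 t ht).1.2 hσ, htr lam hs ht]
  refine ⟨fun s hs t ht => ⟨hspec 1 (by ring) s hs t ht, hspec (-1) (by ring) s hs t ht⟩,
    fun lam => ?_⟩
  obtain ⟨r, hr⟩ := hne
  refine ⟨monTrace (coeffs lam (fn (v r))), fun t ht => ?_⟩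
  rw [htr lam (interior_subset hr) ht]
  exact isDiscriminant_monTrace (h.2 t ht).1.2 lam

end SineGordon

theorem theorem2 (k : ℤ) (l : ℕ) :
    -- (i) the parametrizations, the vector field, the transformation of the equation
    (SineGordon.IsAnalyticParam (SineGordon.W k l) (SineGordon.Pplus k (l + 1))
        (SineGordon.PsiPlus (l := l)) ∧
      SineGordon.IsAnalyticParam (SineGordon.W k l) (SineGordon.Pminus (-k) (l + 1))
        (SineGordon.PsiMinus (l := l)) ∧
      (∀ v ∈ SineGordon.W k l, ∃ X : SineGordon.H0 (l + 1),
        SineGordon.fn X.1 =ᵐ[SineGordon.μ] SineGordon.field v) ∧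
      ∀ (I : Set ℝ) (v : ℝ → SineGordon.H l), Convex ℝ I → (interior I).Nonempty →
        (∀ t ∈ I, v t ∈ SineGordon.W k l) →
          (SineGordon.IsSolSG k I (fun t => SineGordon.PsiPlus (v t)) ↔
            SineGordon.IsSolV k I v) ∧
          (SineGordon.IsSolSG (-k) I (fun t => SineGordon.PsiMinus (v t)) ↔
            SineGordon.IsSolV k I v)) ∧
    -- (ii) the equation is Hamiltonian
    SineGordon.IsHamiltonianFor (SineGordon.W k l) SineGordon.Hsg SineGordon.field ∧
    -- (iii) the Hamiltonian is in the Poisson algebra of focusing mKdV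
    SineGordon.InPoissonAlgebraFocMKdV (SineGordon.W k l) SineGordon.Hsg :=
  ⟨⟨SineGordon.isAnalyticParam_PsiPlus k l, SineGordon.isAnalyticParam_PsiMinus k l,
      fun _ hv => SineGordon.exists_field hv, fun _ _ hI hne hv =>
        ⟨SineGordon.isSolSG_PsiPlus_iff hv, SineGordon.isSolSG_PsiMinus_iff hI hne hv⟩⟩,
    SineGordon.isHamiltonianFor_Hsg k l, SineGordon.inPoissonAlgebraFocMKdV_Hsg k l⟩
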